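/- Let $n\ge 1$ be an integer. On $\mathbb{C}^n$ let $|z|=(\sum_j|z_j|^2)^{1/2}$, and let $dV$ be Lebesgue measure normalized so that $\int_{\mathbb{C}^n} e^{-|z|^2}\,dV(z)=1$. For real $\alpha,\beta$ let $F^1_\alpha$ be the space of entire functions $g$ on $\mathbb{C}^n$ with $$\|g\|_{F^1_\alpha}=\int_{\mathbb{C}^n}|g(z)|e^{-\frac12|z|^2}\frac{dV(z)}{(1+|z|)^{\alpha}}<\infty ,$$ let $F^\infty_\beta$ be the space of entire functions $f$ on $\mathbb{C}^n$ with $$\|f\|_{F^\infty_\beta}=\operatorname*{ess\,sup}_{z\in\mathbb{C}^n}\frac{|f(z)|e^{-\frac12|z|^2}}{(1+|z|)^{\beta}}<\infty ,$$ and let $F^{\infty,0}_\beta$, with the norm of $F^\infty_\beta$, be the subspace of all $f\in F^\infty_\beta$ with $\lim_{|z|\to\infty}|f(z)|e^{-\frac12|z|^2}(1+|z|)^{-\beta}=0$. For an entire function $f$ with homogeneous expansion $f=\sum_{k\ge0}f_k$ and real $s$ put $f_s^-=\sum_{k\le|s|}f_k$ and $f_s^+=f-f_s^-$. For real $\sigma$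 put $(\psi,\varphi)_\sigma=\int_{\mathbb{C}^n}\psi(z)\overline{\varphi(z)}e^{-|z|^2}|z|^{-\sigma}\,dV(z)$ and $$\langle f,g\rangle_\sigma=\begin{cases}(f,g)_\sigma & \text{if }\sigma<2n,\\ (f_{\sigma/2}^-,g_{\sigma/2}^-)_0+(f_{\sigma/2}^+,g_{\sigma/2}^+)_\sigma & \text{if }\sigma\ge 2n.\end{cases}$$ Theorem 5.8. Let $\alpha$ and $\beta$ be real numbers. Then $(F^{\infty,0}_\beta)^*=F^1_\alpha$ with equivalent norms under the pairing $\langle\cdot,\cdot\rangle_{\alpha+\beta}$. That is, the integrals defining $\langle f,g\rangle_{\alpha+\beta}$ converge absolutely for all $f\in F^{\infty,0}_\beta$ and $g\in F^1_\alpha$; the map $g\mapsto\langle\cdot,g\rangle_{\alpha+\beta}$ is a conjugate-linear bijection of $F^1_\alpha$ onto the space $(F^{\infty,0}_\beta)^*$ of bounded linear functionals on $F^{\infty,0}_\beta$; and there is a constant $C=C(n,\alpha,\beta)>0$ such that $$C^{-1}\|g\|_{F^1_\alpha}\le\|\langle\cdot,g\rangle_{\alpha+\beta}\|_{(F^{\infty,0}_\beta)^*}\le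 C\|g\|_{F^1_\alpha}\qquad\text{for all }g\in F^1_\alpha .$$ -/

import Mathlib

open MeasureTheory Filter Topology
open scoped ENNReal ComplexConjugate

/-- The space `ℂⁿ` with the Hermitian norm `|z| = (∑ |z_j|²)^{1/2}`. -/
abbrev Cn (n : ℕ) : Type := EuclideanSpace ℂ (Fin n)

/-- The volume measure `dV` on `ℂⁿ`, normalized by `∫ e^{-|z|²} dV(z) = 1`, that is `π^{-n}` times
Lebesgue measure. -/
noncomputable def fockVol (n : ℕ) : Measure (Cn n) :=
  ENNReal.ofReal ((Real.pi ^ n)⁻¹) • volume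

/-- The normalization of `fockVol`. -/
theorem integral_exp_fockVol (n : ℕ) :
    ∫ z : Cn n, Real.exp (-‖z‖ ^ 2) ∂(fockVol n) = 1 := by
  have h := GaussianFourier.integral_rexp_neg_mul_sq_norm (V := Cn n) (b := 1) one_pos
  have hd : Module.finrank ℝ (Cn n) = 2 * n := by
    rw [← Module.finrank_mul_finrank ℝ ℂ (Cn n)]
    simp
  rw [hd] at h
  have hp : (0 : ℝ) < Real.pi ^ n := by positivity
  have h2 : ∫ v : Cn n, Real.exp (-‖v‖ ^ 2) = Real.pi ^ n := by
    simpa using h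
  rw [fockVol, integral_smul_measure, h2, ENNReal.toReal_ofReal (by positivity), smul_eq_mul]
  exact inv_mul_cancel₀ hp.ne'

instance fockVol_isOpenPosMeasure (n : ℕ) : (fockVol n).IsOpenPosMeasure := by
  refine ⟨fun U hU hne h => hU.measure_ne_zero volume hne ?_⟩
  rw [fockVol, Measure.smul_apply, smul_eq_mul, mul_eq_zero, ENNReal.ofReal_eq_zero] at h
  refine h.resolve_left (not_le.2 ?_)
  positivity

/-- The exponent of `1 + |z|` in the weight: `α / p` for finite `p`, and `α` for `p = ∞`. -/
noncomputable def fockExponent (p : ℝ≥0∞) (α : ℝ) : ℝ :=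
  if p = ∞ then α else α / p.toReal

/-- The weighted function `z ↦ f(z) e^{-|z|²/2} (1 + |z|)^{-α/p}` (with `α` in place of `α/p` when
`p = ∞`). Its `L^p(dV)` norm is the norm of `f` in `L^p_α`: it is
`(∫ |f(z) e^{-|z|²/2}|^p (1 + |z|)^{-α} dV(z))^{1/p}` for finite `p`, and
`ess sup |f(z)| e^{-|z|²/2} / (1 + |z|)^α` for `p = ∞`. -/
noncomputable def fockWeighted {n : ℕ} (p : ℝ≥0∞) (α : ℝ) (f : Cn n → ℂ) (z : Cn n) : ℂ :=
  ((Real.exp (-‖z‖ ^ 2 / 2) * (1 + ‖z‖) ^ (-fockExponent p α) : ℝ) : ℂ) * f z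

/-- The entire functions on `ℂⁿ` that belong to `L^p_α`, as a linear subspace of all functions. -/
noncomputable def fockSubmodule (n : ℕ) (p : ℝ≥0∞) (α : ℝ) : Submodule ℂ (Cn n → ℂ) where
  carrier := {f | Differentiable ℂ f ∧ MemLp (fockWeighted p α f) p (fockVol n)}
  add_mem' := by
    rintro f g ⟨hf, hf'⟩ ⟨hg, hg'⟩
    refine ⟨hf.add hg, ?_⟩
    have h : fockWeighted p α (f + g) = fockWeighted p α f + fockWeighted p α g := by
      funext z
      simp only [fockWeighted, Pi.add_apply, mul_add]
    rw [h]
    exact hf'.add hg'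
  zero_mem' := by
    refine ⟨differentiable_const 0, ?_⟩
    have h : fockWeighted p α (0 : Cn n → ℂ) = 0 := by
      funext z
      simp only [fockWeighted, Pi.zero_apply, mul_zero]
    rw [h]
    exact MemLp.zero
  smul_mem' := by
    rintro c f ⟨hf, hf'⟩
    refine ⟨hf.const_smul c, ?_⟩
    have h : fockWeighted p α (c • f) = c • fockWeighted p α f := by
      funext z
      simp only [fockWeighted, Pi.smul_apply, smul_eq_mul]
      ring
    rw [h]
    exact hf'.const_smul c

/-- The weighted Fock space `F^p_α`. It is a type of its own, so that it carries the topology of its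
norm and not that of pointwise convergence. -/
def FockSpace (n : ℕ) (p : ℝ≥0∞) (α : ℝ) : Type := fockSubmodule n p α

namespace FockSpace

variable {n : ℕ} {p : ℝ≥0∞} {α : ℝ}

noncomputable instance : AddCommGroup (FockSpace n p α) :=
  inferInstanceAs (AddCommGroup (fockSubmodule n p α))

noncomputable instance : Module ℂ (FockSpace n p α) :=
  inferInstanceAs (Module ℂ (fockSubmodule n p α))

instance : CoeFun (FockSpace n p α) (fun _ => Cn n → ℂ) := ⟨fun f => f.1⟩

/-- The linear map `f ↦ f(z) e^{-|z|²/2} (1 + |z|)^{-α/p}` of `F^p_α` into `L^p(dV)`. -/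
noncomputable def toLp : FockSpace n p α →ₗ[ℂ] Lp ℂ p (fockVol n) where
  toFun f := f.2.2.toLp (fockWeighted p α f)
  map_add' f g := by
    rw [← MemLp.toLp_add]
    congr 1
    funext z
    exact mul_add _ (f z) (g z)
  map_smul' c f := by
    rw [RingHom.id_apply, ← MemLp.toLp_const_smul]
    congr 1
    funext z
    exact mul_left_comm _ c (f z)

theorem continuous_fockWeighted (f : FockSpace n p α) : Continuous (fockWeighted p α f) := by
  have hf : Continuous f.1 := f.2.1.continuous
  refine Continuous.mul (Complex.continuous_ofReal.comp ?_) hf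
  refine Continuous.mul (by fun_prop) ?_
  refine Continuous.rpow_const (by fun_prop) fun z => Or.inl ?_
  positivity

theorem toLp_injective : Function.Injective (toLp : FockSpace n p α → Lp ℂ p (fockVol n)) := by
  intro f g h
  have h1 : fockWeighted p α f =ᵐ[fockVol n] fockWeighted p α g :=
    (MemLp.toLp_eq_toLp_iff f.2.2 g.2.2).1 h
  have h2 := (Continuous.ae_eq_iff_eq (fockVol n) (continuous_fockWeighted f)
    (continuous_fockWeighted g)).1 h1
  refine Subtype.ext (funext fun z => ?_)
  have h3 := congrFun h2 z
  refine mul_left_cancel₀ ?_ h3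
  rw [Ne, Complex.ofReal_eq_zero]
  positivity

/-- The norm of `F^p_α`, for `1 ≤ p ≤ ∞`: the `L^p(dV)` norm of the weighted function. -/
noncomputable instance [Fact (1 ≤ p)] : NormedAddCommGroup (FockSpace n p α) :=
  NormedAddCommGroup.induced (FockSpace n p α) (Lp ℂ p (fockVol n)) toLp toLp_injective

noncomputable instance [Fact (1 ≤ p)] : NormedSpace ℂ (FockSpace n p α) :=
  NormedSpace.induced ℂ (FockSpace n p α) (Lp ℂ p (fockVol n)) toLp

theorem norm_def [Fact (1 ≤ p)] (f : FockSpace n p α) :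
    ‖f‖ = (eLpNorm (fockWeighted p α f) p (fockVol n)).toReal :=
  Lp.norm_toLp _ f.2.2

end FockSpace

/-- The little space `F^{∞,0}_β`: the subspace of all `f` in `F^∞_β` with
`|f(z)| e^{-|z|²/2} / (1 + |z|)^β → 0` as `|z| → ∞`, with the norm of `F^∞_β`. -/
noncomputable def littleFock (n : ℕ) (β : ℝ) : Submodule ℂ (FockSpace n ∞ β) where
  carrier := {f | Tendsto (fun z => ‖f z‖ * Real.exp (-‖z‖ ^ 2 / 2) / (1 + ‖z‖) ^ β)
    (cocompact (Cn n)) (𝓝 0)}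
  add_mem' := by
    intro f g hf hg
    have h := Tendsto.add hf hg
    rw [add_zero] at h
    refine squeeze_zero (fun z => by positivity) (fun z => ?_) h
    rw [← add_div, ← add_mul]
    gcongr
    exact norm_add_le (f z) (g z)
  zero_mem' := by
    refine Tendsto.congr (fun z => ?_) tendsto_const_nhds
    change 0 = ‖(0 : ℂ)‖ * _ / _
    simp
  smul_mem' := by
    intro c f hf
    have h := Tendsto.const_mul ‖c‖ hf
    rw [mul_zero] at h
    refine Tendsto.congr (fun z => ?_) h
    change _ = ‖c * f z‖ * _ / _
    rw [norm_mul]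
    ring

/-- The homogeneous part `f_k` of degree `k` of the Taylor expansion of `f` at the origin. -/
noncomputable def homogPart {n : ℕ} (k : ℕ) (f : Cn n → ℂ) (z : Cn n) : ℂ :=
  ((k.factorial : ℂ))⁻¹ * iteratedFDeriv ℂ k f 0 (fun _ => z)

/-- `f_s^- = ∑_{k ≤ |s|} f_k`. -/
noncomputable def taylorHead {n : ℕ} (s : ℝ) (f : Cn n → ℂ) (z : Cn n) : ℂ :=
  ∑ k ∈ Finset.range (⌊|s|⌋₊ + 1), homogPart k f z

/-- `f_s^+ = f - f_s^-`. -/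
noncomputable def taylorTail {n : ℕ} (s : ℝ) (f : Cn n → ℂ) (z : Cn n) : ℂ :=
  f z - taylorHead s f z

/-- The integrand `ψ(z) conj(φ(z)) e^{-|z|²} |z|^{-σ}`. -/
noncomputable def rawIntegrand {n : ℕ} (σ : ℝ) (ψ φ : Cn n → ℂ) (z : Cn n) : ℂ :=
  ψ z * conj (φ z) * ((Real.exp (-‖z‖ ^ 2) * ‖z‖ ^ (-σ) : ℝ) : ℂ)

/-- `(ψ, φ)_σ = ∫ ψ(z) conj(φ(z)) e^{-|z|²} |z|^{-σ} dV(z)`. -/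
noncomputable def rawPairing {n : ℕ} (σ : ℝ) (ψ φ : Cn n → ℂ) : ℂ :=
  ∫ z, rawIntegrand σ ψ φ z ∂(fockVol n)

/-- The pairing `⟨f, g⟩_σ`: it is `(f, g)_σ` if `σ < 2n`, and
`(f_{σ/2}^-, g_{σ/2}^-)_0 + (f_{σ/2}^+, g_{σ/2}^+)_σ` if `σ ≥ 2n`. -/
noncomputable def fockPairing {n : ℕ} (σ : ℝ) (f g : Cn n → ℂ) : ℂ :=
  if σ < 2 * n then rawPairing σ f g
  else rawPairing 0 (taylorHead (σ / 2) f) (taylorHead (σ / 2) g) +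
    rawPairing σ (taylorTail (σ / 2) f) (taylorTail (σ / 2) g)

/-- The integrals in the definition of `⟨f, g⟩_σ` converge absolutely. -/
def FockPairingConverges {n : ℕ} (σ : ℝ) (f g : Cn n → ℂ) : Prop :=
  if σ < 2 * n then Integrable (rawIntegrand σ f g) (fockVol n)
  else Integrable (rawIntegrand 0 (taylorHead (σ / 2) f) (taylorHead (σ / 2) g)) (fockVol n) ∧
    Integrable (rawIntegrand σ (taylorTail (σ / 2) f) (taylorTail (σ / 2) g)) (fockVol n)

open scoped ZeroAtInfty

/-! Notation: w_γ(z) = e^{-|z|²/2} (1 + |z|)^{-γ}, σ = α + β, N = ⌊|σ/2|⌋ + 1, b = N - σ/2 > 0.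

Boundedness of the pairing (`exists_fockPairing_bound`). For |z| ≥ 1 the density e^{-|z|²} |z|^{-σ}
is comparable to w_α w_β, so the integral is at most the sup of w_β |f| times the L¹ norm of w_α g.
Near the origin |z|^{-σ} is integrable if σ < 2n; otherwise both tails vanish to order N, and
|z|^{2N} with 2N > σ compensates.

Representation (`exists_pairingDual_eq`). Rotation invariance makes different degrees orthogonal,
and polar coordinates give ⟨⟪z,·⟫^k, g⟩ = p_k k! conj(g_k(z)), where p_k > 0 is a quotient of Gamma
values or 1 (`fockPairing_inner_pow`). This determines the homogeneous parts of any g that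
represents a functional μ. Multiplication by w_β embeds the little space isometrically into C₀(ℂⁿ);
if L is the conjugated Hahn–Banach extension of μ, the candidate is g(z) = L(w_β K(⟪·,z⟫)) with K(x)
= ∑ x^k / (p_k k!). It is entire because the kernel is an everywhere convergent C₀-valued power
series in z.

Norm control (`integrable_comp_fockKer`, `exists_integral_kerFun_le`). Pulling the integral of w_α
|g| inside L reduces the bound on g to the finiteness of sup_w w_β(w) ∫ w_α(z) |K(⟪w,z⟫)| dV(z).
Apart from finitely many k, 1/p_k is a polynomial of degree N in k times a Beta integral of
(1-y)^{n+k-1} y^{b-1}. Hence |K(x)| is O((1+|x|)^N (1 + ∫₀¹ e^{(1-y) Re x} y^{b-1} dy)). Integration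
in z gives a Gaussian average centred at (1-y)w, and integration in y gains (1+|w|)^{-2b}. The
exponents add up: N + N - α - 2b = β.

Density (`eq_zero_of_forall_littleMono`). The dilate f(r·), r < 1, is a C₀-valued integral of
exponential kernels, which are sums of powers; and f(r·) tends to f in norm as r → 1, since w_β f
vanishes at infinity. So the candidate represents μ. Injectivity holds because the powers recover
every homogeneous part of g, and then the lower norm bound is the norm control applied to ⟨·,g⟩
itself. -/

instance fockVol_isAddHaarMeasure (n : ℕ) : (fockVol n).IsAddHaarMeasure := by
  refine Measure.IsAddHaarMeasure.smul volume ?_ ENNReal.ofReal_ne_top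
  rw [Ne, ENNReal.ofReal_eq_zero, not_le]
  positivity

/-! ### Peetre's inequality and Gaussian integrals. -/

theorem finrank_real_Cn (n : ℕ) : Module.finrank ℝ (Cn n) = 2 * n := by
  rw [← Module.finrank_mul_finrank ℝ ℂ (Cn n)]
  simp

/-- Peetre's inequality. -/
theorem one_add_rpow_le_mul {r ρ d : ℝ} (hr : 0 ≤ r) (hρ : 0 ≤ ρ) (hd : 0 ≤ d) (h₁ : r ≤ ρ + d)
    (h₂ : ρ ≤ r + d) (a : ℝ) : (1 + r) ^ a ≤ (1 + ρ) ^ a * (1 + d) ^ |a| := by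
  rcases le_total 0 a with ha | ha
  · rw [abs_of_nonneg ha, ← Real.mul_rpow (by positivity) (by positivity)]
    exact Real.rpow_le_rpow (by positivity) (by nlinarith) ha
  · rw [abs_of_nonpos ha]
    have h3 : (1 + ρ) ^ (-a) ≤ (1 + r) ^ (-a) * (1 + d) ^ (-a) := by
      rw [← Real.mul_rpow (by positivity) (by positivity)]
      exact Real.rpow_le_rpow (by positivity) (by nlinarith) (by linarith)
    have h4 : (1 + r) ^ a * (1 + r) ^ (-a) = 1 := by
      rw [← Real.rpow_add (by positivity)]; simp
    have h5 : (1 + ρ) ^ a * (1 + ρ) ^ (-a) = 1 := by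
      rw [← Real.rpow_add (by positivity)]; simp
    have h6 : 0 < (1 + r) ^ a := by positivity
    have h7 : 0 < (1 + ρ) ^ a := by positivity
    calc (1 + r) ^ a = (1 + r) ^ a * ((1 + ρ) ^ a * (1 + ρ) ^ (-a)) := by rw [h5, mul_one]
      _ ≤ (1 + r) ^ a * ((1 + ρ) ^ a * ((1 + r) ^ (-a) * (1 + d) ^ (-a))) := by gcongr
      _ = ((1 + r) ^ a * (1 + r) ^ (-a)) * ((1 + ρ) ^ a * (1 + d) ^ (-a)) := by ring
      _ = _ := by rw [h4, one_mul]

theorem one_add_norm_rpow_le_mul {E : Type*} [SeminormedAddCommGroup E] (z w : E) (a : ℝ) :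
    (1 + ‖z‖) ^ a ≤ (1 + ‖w‖) ^ a * (1 + ‖z - w‖) ^ |a| := by
  refine one_add_rpow_le_mul (norm_nonneg _) (norm_nonneg _) (norm_nonneg _) ?_ ?_ a
  · have := norm_add_le w (z - w); rwa [add_sub_cancel] at this
  · have := norm_sub_le z (z - w); rwa [sub_sub_cancel] at this

/-- A Gaussian dominates powers and exponentials. -/
theorem exists_one_add_rpow_mul_exp_le (a T : ℝ) {b : ℝ} (hb : 0 < b) :
    ∃ C : ℝ, 0 < C ∧ ∀ r : ℝ, 0 ≤ r → (1 + r) ^ a * Real.exp (T * r - b * r ^ 2) ≤ C := by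
  -- The power is at most ⌈|a|⌉! e^{1+r}, and (T+1)²/(4b) is the maximum of (T+1)r - b r².
  refine ⟨(⌈|a|⌉₊.factorial : ℝ) * Real.exp (1 + (T + 1) ^ 2 / (4 * b)), by positivity,
    fun r hr => ?_⟩
  have h1 : (1 + r) ^ a ≤ (⌈|a|⌉₊.factorial : ℝ) * Real.exp (1 + r) := by
    calc (1 + r) ^ a ≤ (1 + r) ^ ((⌈|a|⌉₊ : ℕ) : ℝ) :=
          Real.rpow_le_rpow_of_exponent_le (by linarith)
            ((le_abs_self a).trans (Nat.le_ceil _))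
      _ = (1 + r) ^ ⌈|a|⌉₊ := Real.rpow_natCast _ _
      _ ≤ _ := by
        have := Real.pow_div_factorial_le_exp (1 + r) (by linarith) ⌈|a|⌉₊
        rw [div_le_iff₀ (by positivity)] at this
        linarith
  calc (1 + r) ^ a * Real.exp (T * r - b * r ^ 2)
      ≤ (⌈|a|⌉₊.factorial : ℝ) * Real.exp (1 + r) * Real.exp (T * r - b * r ^ 2) := by gcongr
    _ = (⌈|a|⌉₊.factorial : ℝ) * Real.exp (1 + r + (T * r - b * r ^ 2)) := by
        rw [Real.exp_add (1 + r)]; ring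
    _ ≤ _ := by
        refine mul_le_mul_of_nonneg_left (Real.exp_le_exp.2 ?_) (by positivity)
        have : (T + 1) * r - b * r ^ 2 ≤ (T + 1) ^ 2 / (4 * b) := by
          rw [le_div_iff₀ (by positivity)]
          nlinarith [sq_nonneg (2 * b * r - (T + 1))]
        linarith

theorem integrable_one_add_norm_rpow {n : ℕ} {a : ℝ} (ha : a < -(2 * n : ℝ)) :
    Integrable (fun z : Cn n => (1 + ‖z‖) ^ a) (fockVol n) := by
  have h := integrable_one_add_norm (E := Cn n) (μ := fockVol n) (r := -a)
    (by rw [finrank_real_Cn]; push_cast; linarith)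
  simpa using h

theorem continuous_one_add_norm_rpow {E : Type*} [SeminormedAddCommGroup E] (a : ℝ) :
    Continuous fun z : E => (1 + ‖z‖) ^ a :=
  Continuous.rpow_const (by fun_prop) fun z => Or.inl (by positivity)

theorem integrable_one_add_norm_rpow_mul_exp (n : ℕ) (a T : ℝ) {b : ℝ} (hb : 0 < b) :
    Integrable (fun z : Cn n => (1 + ‖z‖) ^ a * Real.exp (T * ‖z‖ - b * ‖z‖ ^ 2)) (fockVol n) := by
  obtain ⟨C, hC, h⟩ := exists_one_add_rpow_mul_exp_le (a + (2 * n + 1)) T hb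
  refine ((integrable_one_add_norm_rpow (n := n) (a := -(2 * n + 1))
    (by linarith)).const_mul C).mono' ?_ (Eventually.of_forall fun z => ?_)
  · exact ((continuous_one_add_norm_rpow a).mul (by fun_prop)).aestronglyMeasurable
  · have h1 := h ‖z‖ (norm_nonneg z)
    rw [Real.norm_of_nonneg (by positivity)]
    rw [Real.rpow_add (by positivity)] at h1
    rw [Real.rpow_neg (by positivity), ← div_eq_mul_inv, le_div_iff₀ (by positivity)]
    linarith

/-- Powers of `1 + |z|` are almost constant for Gaussian averages. -/
theorem exists_integral_gaussian_le (n : ℕ) (a : ℝ) : ∃ C : ℝ, 0 < C ∧ ∀ w : Cn n,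
    Integrable (fun z : Cn n => (1 + ‖z‖) ^ a * Real.exp (-‖z - w‖ ^ 2 / 2)) (fockVol n) ∧
    ∫ z, (1 + ‖z‖) ^ a * Real.exp (-‖z - w‖ ^ 2 / 2) ∂(fockVol n) ≤ C * (1 + ‖w‖) ^ a := by
  set G : Cn n → ℝ := fun z => (1 + ‖z‖) ^ |a| * Real.exp (-‖z‖ ^ 2 / 2) with hG
  have hGi : Integrable G (fockVol n) := by
    have := integrable_one_add_norm_rpow_mul_exp n |a| 0 (b := 1 / 2) (by norm_num)
    refine this.congr (Eventually.of_forall fun z => ?_)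
    simp only [hG]
    congr 2
    ring
  have hG0 : ∀ z, 0 ≤ G z := fun z => by positivity
  have hG1 : 0 ≤ ∫ z, G z ∂(fockVol n) := integral_nonneg hG0
  -- Peetre's inequality bounds the integrand by (1+|w|)^a G(z-w), so the mass of G serves as
  -- constant; the added 1 only makes it visibly positive.
  refine ⟨∫ z, G z ∂(fockVol n) + 1, by positivity,
    fun w => ?_⟩
  have hi : Integrable (fun z => (1 + ‖w‖) ^ a * G (z - w)) (fockVol n) :=
    (hGi.comp_sub_right w).const_mul _
  have hle : ∀ z : Cn n, (1 + ‖z‖) ^ a * Real.exp (-‖z - w‖ ^ 2 / 2)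
      ≤ (1 + ‖w‖) ^ a * G (z - w) := fun z => by
    have := one_add_norm_rpow_le_mul z w a
    simp only [hG]
    rw [← mul_assoc]
    gcongr
  have hint : Integrable (fun z : Cn n => (1 + ‖z‖) ^ a * Real.exp (-‖z - w‖ ^ 2 / 2))
      (fockVol n) := by
    refine hi.mono' ?_ (Eventually.of_forall fun z => ?_)
    · exact ((continuous_one_add_norm_rpow a).mul (by fun_prop)).aestronglyMeasurable
    · rw [Real.norm_of_nonneg (by positivity)]
      exact hle z
  refine ⟨hint, ?_⟩
  calc _ ≤ ∫ z, (1 + ‖w‖) ^ a * G (z - w) ∂(fockVol n) :=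
        integral_mono hint hi hle
    _ = (1 + ‖w‖) ^ a * ∫ z, G z ∂(fockVol n) := by
        rw [integral_const_mul, integral_sub_right_eq_self (fun z => G z)]
    _ ≤ _ := by
        rw [mul_comm]
        gcongr
        linarith

/-- The weight `e^{-|z|²/2} (1 + |z|)^{-γ}`. -/
noncomputable def fockWt {n : ℕ} (γ : ℝ) (z : Cn n) : ℝ :=
  Real.exp (-‖z‖ ^ 2 / 2) * (1 + ‖z‖) ^ (-γ)

/-! ### The weights w_γ. -/

section fockWt

variable {n : ℕ}

theorem fockWt_pos (γ : ℝ) (z : Cn n) : 0 < fockWt γ z := by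
  unfold fockWt; positivity

theorem continuous_fockWt (γ : ℝ) : Continuous (fockWt γ : Cn n → ℝ) :=
  Continuous.mul (by fun_prop) (continuous_one_add_norm_rpow _)

/-- Opposite exponents cancel, so functions φ with w_{-γ} φ bounded can be paired with F^1_γ under
the plain Gaussian. -/
theorem fockWt_mul_neg (γ : ℝ) (z : Cn n) : fockWt γ z * fockWt (-γ) z = Real.exp (-‖z‖ ^ 2) := by
  unfold fockWt
  rw [neg_neg, mul_mul_mul_comm, ← Real.exp_add, ← Real.rpow_add (by positivity)]
  simp only [neg_add_cancel, Real.rpow_zero, mul_one]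
  ring_nf

theorem fockWt_add (γ δ : ℝ) (z : Cn n) :
    fockWt (γ + δ) z = fockWt γ z * (1 + ‖z‖) ^ (-δ) := by
  unfold fockWt
  rw [mul_assoc, ← Real.rpow_add (by positivity)]
  congr 2
  ring

theorem fockWt_mul_exp_eq (γ T : ℝ) (z : Cn n) : fockWt γ z * Real.exp (T * ‖z‖) =
    (1 + ‖z‖) ^ (-γ) * Real.exp (T * ‖z‖ - 1 / 2 * ‖z‖ ^ 2) := by
  unfold fockWt
  rw [mul_right_comm, ← Real.exp_add, mul_comm]
  congr 2
  ring

theorem exists_fockWt_mul_exp_le (n : ℕ) (γ T : ℝ) :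
    ∃ C : ℝ, 0 < C ∧ ∀ z : Cn n, fockWt γ z * Real.exp (T * ‖z‖) ≤ C := by
  obtain ⟨C, hC, h⟩ := exists_one_add_rpow_mul_exp_le (-γ) T (b := 1 / 2) (by norm_num)
  refine ⟨C, hC, fun z => ?_⟩
  rw [fockWt_mul_exp_eq]
  exact h _ (norm_nonneg z)

theorem tendsto_fockWt_mul_exp (γ T : ℝ) :
    Tendsto (fun z : Cn n => fockWt γ z * Real.exp (T * ‖z‖)) (cocompact (Cn n)) (𝓝 0) := by
  obtain ⟨C, hC, h⟩ := exists_fockWt_mul_exp_le n γ (T + 1)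
  have h1 : Tendsto (fun z : Cn n => C * Real.exp (-‖z‖)) (cocompact (Cn n)) (𝓝 0) := by
    have := (Real.tendsto_exp_neg_atTop_nhds_zero.comp
      (tendsto_norm_cocompact_atTop (E := Cn n))).const_mul C
    simpa using this
  refine squeeze_zero (fun z => by have := fockWt_pos γ z; positivity) (fun z => ?_) h1
  have h2 := h z
  calc fockWt γ z * Real.exp (T * ‖z‖)
      = fockWt γ z * Real.exp ((T + 1) * ‖z‖) * Real.exp (-‖z‖) := by
        rw [mul_assoc, ← Real.exp_add]; ring_nf
    _ ≤ _ := by gcongr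

theorem integrable_fockWt_mul_exp (γ T : ℝ) :
    Integrable (fun z : Cn n => fockWt γ z * Real.exp (T * ‖z‖)) (fockVol n) := by
  refine (integrable_one_add_norm_rpow_mul_exp n (-γ) T (b := 1 / 2) (by norm_num)).congr
    (Eventually.of_forall fun z => (fockWt_mul_exp_eq γ T z).symm)

/-- Completing the square: up to a power, the weighted exponential kernel is a Gaussian bump centred
at z, of height e^{|z|²/2}. -/
theorem norm_exp_inner_mul_fockWt (γ : ℝ) (u z : Cn n) :
    ‖Complex.exp (inner ℂ u z)‖ * fockWt γ u =
      Real.exp (‖z‖ ^ 2 / 2) * ((1 + ‖u‖) ^ (-γ) * Real.exp (-‖u - z‖ ^ 2 / 2)) := by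
  rw [Complex.norm_exp, fockWt]
  have h : ‖u - z‖ ^ 2 = ‖u‖ ^ 2 - 2 * (inner ℂ u z : ℂ).re + ‖z‖ ^ 2 := by
    have := @norm_sub_sq ℂ (Cn n) _ _ _ u z
    simpa using this
  rw [← mul_assoc, ← Real.exp_add, mul_left_comm, ← Real.exp_add, mul_comm, h]
  congr 2
  ring

end fockWt

/-! ### Rotation invariance and the Gaussian mean value property. -/

section Rotation

variable {n : ℕ}

/-- Multiplication by a unimodular number preserves `fockVol`. -/
theorem measurePreserving_unimodular_smul {a : ℂ} (ha : ‖a‖ = 1) :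
    MeasurePreserving (fun z : Cn n => a • z) (fockVol n) (fockVol n) := by
  have ha0 : a ≠ 0 := by rintro rfl; simp at ha
  let e : Cn n ≃ₗᵢ[ℝ] Cn n :=
    { (LinearEquiv.smulOfNeZero ℂ (Cn n) a ha0).restrictScalars ℝ with
      norm_map' := fun z => by
        change ‖a • z‖ = ‖z‖
        rw [norm_smul, ha, one_mul] }
  exact (e.measurePreserving).smul_measure _

theorem measurableEmbedding_smul_of_ne_zero {a : ℂ} (ha : a ≠ 0) :
    MeasurableEmbedding (fun z : Cn n => a • z) :=
  (Homeomorph.smulOfNeZero a ha).measurableEmbedding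

theorem integral_unimodular_smul {E : Type*} [NormedAddCommGroup E] [NormedSpace ℝ E] {a : ℂ}
    (ha : ‖a‖ = 1) (Φ : Cn n → E) :
    ∫ z, Φ (a • z) ∂(fockVol n) = ∫ z, Φ z ∂(fockVol n) :=
  (measurePreserving_unimodular_smul ha).integral_comp
    (measurableEmbedding_smul_of_ne_zero (by rintro rfl; simp at ha)) Φ

/-- Integrals over `ℂⁿ` may be averaged over rotations. -/
theorem integral_eq_integral_circleAverage {Φ : Cn n → ℂ} (hΦm : Measurable Φ)
    (hΦ : Integrable Φ (fockVol n)) :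
    ∫ u, Φ u ∂(fockVol n) =
      ∫ u, Real.circleAverage (fun a => Φ (a • u)) 0 1 ∂(fockVol n) := by
  have hnorm : ∀ θ : ℝ, ‖circleMap 0 1 θ‖ = 1 := fun θ => by simp
  have hint : Integrable (Function.uncurry fun (θ : ℝ) (u : Cn n) => Φ (circleMap 0 1 θ • u))
      ((volume.restrict (Set.uIoc 0 (2 * Real.pi))).prod (fockVol n)) := by
    have hm : Measurable (Function.uncurry fun (θ : ℝ) (u : Cn n) => Φ (circleMap 0 1 θ • u)) := by
      refine hΦm.comp (Continuous.measurable ?_)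
      exact ((continuous_circleMap 0 1).comp continuous_fst).smul continuous_snd
    rw [integrable_prod_iff hm.aestronglyMeasurable]
    refine ⟨Eventually.of_forall fun θ => ?_, ?_⟩
    · exact (measurePreserving_unimodular_smul (hnorm θ)).integrable_comp_of_integrable hΦ
    · have : ∀ θ : ℝ, ∫ u, ‖Φ (circleMap 0 1 θ • u)‖ ∂(fockVol n) = ∫ u, ‖Φ u‖ ∂(fockVol n) :=
        fun θ => integral_unimodular_smul (hnorm θ) fun u => ‖Φ u‖
      simp only [Function.uncurry_apply_pair, this]
      rw [Set.uIoc_of_le (by positivity)]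
      exact integrable_const _
  simp only [Real.circleAverage]
  rw [integral_smul, ← intervalIntegral_integral_swap hint]
  simp only [integral_unimodular_smul (hnorm _), intervalIntegral.integral_const, sub_zero]
  rw [smul_smul, inv_mul_cancel₀ (by positivity), one_smul]

/-- The mean value property for the Gaussian measure. -/
theorem integral_mul_gaussian_eq {h : Cn n → ℂ} (hd : Differentiable ℂ h)
    (hi : Integrable (fun u => h u * (Real.exp (-‖u‖ ^ 2) : ℝ)) (fockVol n)) :
    ∫ u, h u * (Real.exp (-‖u‖ ^ 2) : ℝ) ∂(fockVol n) = h 0 := by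
  have hc : Continuous h := hd.continuous
  rw [integral_eq_integral_circleAverage (by fun_prop) hi]
  have h1 : ∀ u : Cn n, Real.circleAverage
      (fun a : ℂ => h (a • u) * (Real.exp (-‖a • u‖ ^ 2) : ℝ)) 0 1
      = ((Real.exp (-‖u‖ ^ 2) : ℝ) : ℂ) * h 0 := fun u => by
    -- On the complex line through u, h is an entire function of one variable; the Gaussian factor
    -- is constant on the circle and plays no part.
    have h2 : Real.circleAverage (fun a : ℂ => h (a • u)) 0 1 = h 0 := by
      have hd2 : Differentiable ℂ fun a : ℂ => h (a • u) :=
        hd.comp (differentiable_id.smul_const u)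
      have := hd2.diffContOnCl (s := Metric.ball 0 |1|) |>.circleAverage
      simpa using this
    rw [← h2, ← smul_eq_mul, ← Real.circleAverage_fun_smul]
    refine Real.circleAverage_congr_sphere fun a ha => ?_
    have ha1 : ‖a‖ = 1 := by simpa using ha
    simp only [norm_smul, ha1, one_mul, smul_eq_mul]
    ring
  simp only [h1]
  rw [integral_mul_const, integral_complex_ofReal, integral_exp_fockVol]
  simp

end Rotation

/-! ### Polar coordinates and Gamma factors. -/

section Polar

/-- Integration in polar coordinates of a radial function times a positively homogeneous one. -/
theorem integral_homogeneous_mul_radial {E : Type*} [NormedAddCommGroup E] [NormedSpace ℝ E]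
    [Nontrivial E] [MeasurableSpace E] [BorelSpace E] [FiniteDimensional ℝ E] (μ : Measure E)
    [μ.IsAddHaarMeasure] {Φ : E → ℂ} {d : ℕ}
    (hΦ : ∀ (t : ℝ) (u : E), 0 < t → Φ (t • u) = (t : ℂ) ^ d * Φ u) (ρ : ℝ → ℝ) :
    ∫ u, Φ u * (ρ ‖u‖ : ℂ) ∂μ = (∫ ξ, Φ ξ ∂μ.toSphere) *
      ((∫ r in Set.Ioi (0 : ℝ), r ^ (Module.finrank ℝ E - 1) * (r ^ d * ρ r) : ℝ) : ℂ) := by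
  have h1 : ∫ u, Φ u * (ρ ‖u‖ : ℂ) ∂μ =
      ∫ x : ({(0 : E)}ᶜ : Set E), Φ x.1 * (ρ ‖x.1‖ : ℂ) ∂(μ.comap (↑)) := by
    rw [integral_subtype_comap (measurableSet_singleton _).compl
      fun x => Φ x * (ρ ‖x‖ : ℂ), restrict_compl_singleton]
  have h2 : ∫ x : ({(0 : E)}ᶜ : Set E), Φ x.1 * (ρ ‖x.1‖ : ℂ) ∂(μ.comap (↑)) =
      ∫ x, Φ x.1.1 * ((x.2.1 ^ d * ρ x.2.1 : ℝ) : ℂ)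
        ∂μ.toSphere.prod (.volumeIoiPow (Module.finrank ℝ E - 1)) := by
    rw [← μ.measurePreserving_homeomorphUnitSphereProd.integral_comp
        (Homeomorph.measurableEmbedding _)]
    refine integral_congr_ae (Eventually.of_forall fun x => ?_)
    have hx : 0 < ‖x.1‖ := norm_pos_iff.2 x.2
    have h3 := hΦ ‖x.1‖ (‖x.1‖⁻¹ • x.1) hx
    rw [smul_smul, mul_inv_cancel₀ hx.ne', one_smul] at h3
    simp only [homeomorphUnitSphereProd_apply_snd_coe, homeomorphUnitSphereProd_apply_fst_coe]
    rw [h3]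
    push_cast
    ring
  rw [h1, h2]
  rw [integral_prod_mul (fun ξ : Metric.sphere (0 : E) 1 => Φ ξ)
    (fun r : Set.Ioi (0 : ℝ) => ((r.1 ^ d * ρ r.1 : ℝ) : ℂ))]
  congr 1
  rw [integral_complex_ofReal]
  congr 1
  simp only [Measure.volumeIoiPow, ENNReal.ofReal]
  rw [integral_withDensity_eq_integral_smul
    ((measurable_subtype_coe.pow_const _).real_toNNReal),
    integral_subtype_comap measurableSet_Ioi fun a : ℝ =>
      Real.toNNReal (a ^ (Module.finrank ℝ E - 1)) • (a ^ d * ρ a),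
    setIntegral_congr_fun measurableSet_Ioi fun x hx => ?_]
  rw [NNReal.smul_def, Real.coe_toNNReal _ (pow_nonneg hx.out.le _), smul_eq_mul]

/-- The substitution t = r² gives the Gamma integral. `hk` is convergence at 0, and `hn` keeps the
natural-number subtraction 2n - 1 from truncating. -/
theorem integral_pow_mul_exp_mul_rpow {n k : ℕ} {σ : ℝ} (hn : 0 < n)
    (hk : σ < 2 * n + 2 * k) :
    ∫ r in Set.Ioi (0 : ℝ), r ^ (2 * n - 1) * (r ^ (2 * k) * (Real.exp (-r ^ 2) * r ^ (-σ)))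
      = Real.Gamma (n + k - σ / 2) / 2 := by
  have h := integral_rpow_mul_exp_neg_rpow (p := 2) (q := (2 * n - 1 : ℕ) + (2 * k : ℕ) - σ)
    (by norm_num) (by
      rw [Nat.cast_sub (by omega)]; push_cast; linarith)
  have h2 : ((2 * n - 1 : ℕ) + (2 * k : ℕ) - σ + 1) / 2 = n + k - σ / 2 := by
    rw [Nat.cast_sub (by omega)]; push_cast; ring
  rw [h2] at h
  rw [div_eq_inv_mul, ← one_div, ← h]
  refine setIntegral_congr_fun measurableSet_Ioi fun r hr => ?_
  have hr0 : (0 : ℝ) < r := hr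
  rw [sub_eq_add_neg, Real.rpow_add hr0, Real.rpow_add hr0, Real.rpow_natCast, Real.rpow_natCast,
    Real.rpow_two]
  ring

/-- Replacing the Gaussian weight by `e^{-|z|²} |z|^{-σ}` multiplies the integral of a homogeneous
function by a quotient of Gamma values. -/
theorem integral_homogeneous_mul_exp_mul_rpow {n k : ℕ} {σ : ℝ} (hn : 0 < n)
    (hk : σ < 2 * n + 2 * k) {Φ : Cn n → ℂ}
    (hΦ : ∀ (t : ℝ) (u : Cn n), 0 < t → Φ (t • u) = (t : ℂ) ^ (2 * k) * Φ u) :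
    ∫ u, Φ u * ((Real.exp (-‖u‖ ^ 2) * ‖u‖ ^ (-σ) : ℝ) : ℂ) ∂(fockVol n) =
      ((Real.Gamma (n + k - σ / 2) / Real.Gamma (n + k) : ℝ) : ℂ) *
        ∫ u, Φ u * ((Real.exp (-‖u‖ ^ 2) : ℝ) : ℂ) ∂(fockVol n) := by
  have : Nonempty (Fin n) := ⟨⟨0, hn⟩⟩
  have h1 := integral_homogeneous_mul_radial (fockVol n) hΦ
    (fun r => Real.exp (-r ^ 2) * r ^ (-σ))
  -- The plain Gaussian is the case σ = 0 of the same formula: the sphere integrals agree, and the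
  -- radial ones leave the Gamma quotient.
  have h2 := integral_homogeneous_mul_radial (fockVol n) hΦ
    (fun r => Real.exp (-r ^ 2) * r ^ (-(0 : ℝ)))
  simp only [finrank_real_Cn] at h1 h2
  rw [integral_pow_mul_exp_mul_rpow hn hk] at h1
  rw [integral_pow_mul_exp_mul_rpow hn (by positivity)] at h2
  simp only [neg_zero, Real.rpow_zero, mul_one, zero_div, sub_zero] at h2
  have hG : ((Real.Gamma (n + k) : ℝ) : ℂ) ≠ 0 :=
    Complex.ofReal_ne_zero.2 (Real.Gamma_pos_of_pos (by positivity)).ne'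
  rw [h1, h2]
  push_cast
  field_simp

end Polar

/-! ### Homogeneous parts, heads and tails. -/

section Homogeneous

variable {n : ℕ}

theorem homogPart_smul (k : ℕ) (f : Cn n → ℂ) (a : ℂ) (z : Cn n) :
    homogPart k f (a • z) = a ^ k * homogPart k f z := by
  unfold homogPart
  rw [ContinuousMultilinearMap.map_smul_univ]
  simp only [Finset.prod_const, Finset.card_univ, Fintype.card_fin, smul_eq_mul]
  ring

/-- Restriction to the complex line through u reduces homogeneous parts to one variable, where
Cauchy's formula applies. -/
theorem homogPart_eq_iteratedDeriv {f : Cn n → ℂ} (hf : ContDiff ℂ ⊤ f) (k : ℕ) (u : Cn n) :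
    homogPart k f u = ((k.factorial : ℂ))⁻¹ * iteratedDeriv k (fun a : ℂ => f (a • u)) 0 := by
  have h := ContinuousLinearMap.iteratedFDeriv_comp_right
    (ContinuousLinearMap.toSpanSingleton ℂ u) hf (0 : ℂ) (i := k) (by exact_mod_cast le_top)
  have h3 : (f ∘ (ContinuousLinearMap.toSpanSingleton ℂ u)) = fun a : ℂ => f (a • u) := by
    funext a
    simp [ContinuousLinearMap.toSpanSingleton_apply]
  rw [h3] at h
  rw [homogPart, iteratedDeriv_eq_iteratedFDeriv, h]
  simp [ContinuousLinearMap.toSpanSingleton_apply]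

/-- The homogeneous part is a Fourier coefficient along circles. -/
theorem circleAverage_eq_homogPart {f : Cn n → ℂ} (hf : ContDiff ℂ ⊤ f) (k : ℕ) (u : Cn n) :
    Real.circleAverage (fun a : ℂ => (a ^ k)⁻¹ * f (a • u)) 0 1 = homogPart k f u := by
  have hd : Differentiable ℂ fun a : ℂ => f (a • u) :=
    (hf.differentiable (by simp)).comp (differentiable_id.smul_const u)
  have h := (hd.diffContOnCl (s := Metric.ball 0 1)).circleIntegral_one_div_sub_center_pow_smul
    one_pos k
  have h2 : ∮ z in C(0, 1), (z - 0)⁻¹ • ((z ^ k)⁻¹ * f (z • u)) =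
      ∮ z in C(0, 1), (1 / (z - 0) ^ (k + 1)) • f (z • u) := by
    congr 1
    funext z
    simp only [sub_zero, smul_eq_mul, one_div, pow_succ, mul_inv_rev]
    ring
  rw [Real.circleAverage_eq_circleIntegral one_ne_zero, h2, h, homogPart_eq_iteratedDeriv hf,
    smul_smul, smul_eq_mul]
  congr 1
  field_simp

/-- The homogeneous parts of a homogeneous function. -/
theorem homogPart_of_homogeneous {P : Cn n → ℂ} (hP : ContDiff ℂ ⊤ P) {j : ℕ}
    (hj : ∀ (a : ℂ) (u : Cn n), P (a • u) = a ^ j * P u) (k : ℕ) (u : Cn n) :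
    homogPart k P u = if k = j then P u else 0 := by
  rw [homogPart_eq_iteratedDeriv hP]
  simp only [hj, mul_comm _ (P u)]
  rw [iteratedDeriv_const_mul_field, iteratedDeriv_fun_pow_zero, mul_comm (P u)]
  split_ifs with h
  · subst h
    rw [← mul_assoc, inv_mul_cancel₀ (by exact_mod_cast k.factorial_ne_zero), one_mul]
  · simp

theorem contDiff_homogPart (k : ℕ) (f : Cn n → ℂ) : ContDiff ℂ ⊤ (homogPart k f) := by
  unfold homogPart
  refine contDiff_const.mul ((ContinuousMultilinearMap.contDiff _).comp ?_)
  exact contDiff_pi.2 fun _ => contDiff_id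

theorem homogPart_add {f g : Cn n → ℂ} (hf : ContDiff ℂ ⊤ f) (hg : ContDiff ℂ ⊤ g) (k : ℕ) :
    homogPart k (f + g) = homogPart k f + homogPart k g := by
  funext z
  simp only [homogPart, Pi.add_apply]
  rw [iteratedFDeriv_add_apply (hf.contDiffAt.of_le (by exact_mod_cast le_top))
    (hg.contDiffAt.of_le (by exact_mod_cast le_top)), _root_.add_apply, mul_add]

theorem homogPart_const_smul {f : Cn n → ℂ} (hf : ContDiff ℂ ⊤ f) (c : ℂ) (k : ℕ) :
    homogPart k (c • f) = c • homogPart k f := by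
  funext z
  simp only [homogPart, Pi.smul_apply, smul_eq_mul]
  rw [iteratedFDeriv_const_smul_apply (hf.contDiffAt.of_le (by exact_mod_cast le_top)),
    _root_.smul_apply, smul_eq_mul]
  ring

theorem contDiff_taylorHead (s : ℝ) (f : Cn n → ℂ) : ContDiff ℂ ⊤ (taylorHead s f) := by
  unfold taylorHead
  exact ContDiff.sum fun k _ => contDiff_homogPart k f

theorem taylorHead_add {f g : Cn n → ℂ} (hf : ContDiff ℂ ⊤ f) (hg : ContDiff ℂ ⊤ g) (s : ℝ) :
    taylorHead s (f + g) = taylorHead s f + taylorHead s g := by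
  funext z
  simp only [taylorHead, homogPart_add hf hg, Pi.add_apply, Finset.sum_add_distrib]

theorem taylorHead_const_smul {f : Cn n → ℂ} (hf : ContDiff ℂ ⊤ f) (c : ℂ) (s : ℝ) :
    taylorHead s (c • f) = c • taylorHead s f := by
  funext z
  simp only [taylorHead, homogPart_const_smul hf, Pi.smul_apply, Finset.smul_sum]

theorem taylorTail_add {f g : Cn n → ℂ} (hf : ContDiff ℂ ⊤ f) (hg : ContDiff ℂ ⊤ g) (s : ℝ) :
    taylorTail s (f + g) = taylorTail s f + taylorTail s g := by
  funext z
  simp only [taylorTail, taylorHead_add hf hg, Pi.add_apply]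
  ring

theorem taylorTail_const_smul {f : Cn n → ℂ} (hf : ContDiff ℂ ⊤ f) (c : ℂ) (s : ℝ) :
    taylorTail s (c • f) = c • taylorTail s f := by
  funext z
  simp only [taylorTail, taylorHead_const_smul hf, Pi.smul_apply, smul_sub]

theorem homogPart_taylorHead (s : ℝ) (f : Cn n → ℂ) (k : ℕ) (z : Cn n) :
    homogPart k (taylorHead s f) z = if k < ⌊|s|⌋₊ + 1 then homogPart k f z else 0 := by
  have h : homogPart k (taylorHead s f) z =
      ∑ j ∈ Finset.range (⌊|s|⌋₊ + 1), homogPart k (homogPart j f) z := by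
    simp only [homogPart, ← Finset.mul_sum]
    congr 1
    rw [← _root_.sum_apply, ← iteratedFDeriv_fun_sum_apply]
    · rfl
    · exact fun j _ => (contDiff_homogPart j f).contDiffAt.of_le (by exact_mod_cast le_top)
  rw [h]
  simp only [homogPart_of_homogeneous (contDiff_homogPart _ f) (homogPart_smul _ f)]
  simp

theorem homogPart_taylorTail (s : ℝ) {f : Cn n → ℂ} (hf : ContDiff ℂ ⊤ f) (k : ℕ) (z : Cn n) :
    homogPart k (taylorTail s f) z = if k < ⌊|s|⌋₊ + 1 then 0 else homogPart k f z := by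
  have h : taylorTail s f = f + (-1 : ℂ) • taylorHead s f := by
    funext z
    simp only [taylorTail, Pi.add_apply, Pi.smul_apply, smul_eq_mul]
    ring
  have h2 : ContDiff ℂ ⊤ ((-1 : ℂ) • taylorHead s f) := by
    have := (contDiff_taylorHead s f).const_smul (-1 : ℂ)
    exact this
  rw [h, homogPart_add hf h2,
    homogPart_const_smul (contDiff_taylorHead s f)]
  simp only [Pi.add_apply, Pi.smul_apply, homogPart_taylorHead]
  split_ifs <;> simp

theorem taylorHead_of_homogeneous {P : Cn n → ℂ} (hP : ContDiff ℂ ⊤ P) {j : ℕ}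
    (hj : ∀ (a : ℂ) (u : Cn n), P (a • u) = a ^ j * P u) (s : ℝ) :
    taylorHead s P = if j < ⌊|s|⌋₊ + 1 then P else 0 := by
  funext u
  simp only [taylorHead, homogPart_of_homogeneous hP hj]
  split_ifs with h <;> simp [Finset.mem_range, h]

theorem taylorTail_of_homogeneous {P : Cn n → ℂ} (hP : ContDiff ℂ ⊤ P) {j : ℕ}
    (hj : ∀ (a : ℂ) (u : Cn n), P (a • u) = a ^ j * P u) (s : ℝ) :
    taylorTail s P = if j < ⌊|s|⌋₊ + 1 then 0 else P := by
  funext u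
  simp only [taylorTail, taylorHead_of_homogeneous hP hj]
  split_ifs <;> simp

end Homogeneous

/-! ### Point evaluations on C₀. -/

section ZeroAtInfty

variable {X : Type*} [TopologicalSpace X]

theorem ZeroAtInftyContinuousMap.norm_apply_le (φ : C₀(X, ℂ)) (x : X) : ‖φ x‖ ≤ ‖φ‖ :=
  φ.toBCF.norm_coe_le_norm x

theorem ZeroAtInftyContinuousMap.norm_le_of_forall {φ : C₀(X, ℂ)} {C : ℝ} (hC : 0 ≤ C)
    (h : ∀ x, ‖φ x‖ ≤ C) : ‖φ‖ ≤ C :=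
  (BoundedContinuousFunction.norm_le (f := φ.toBCF) hC).2 h

/-- Evaluation at a point, as a bounded functional on `C₀`. -/
noncomputable def zeroAtInftyEval (x : X) : C₀(X, ℂ) →L[ℂ] ℂ :=
  LinearMap.mkContinuous
    { toFun := fun φ => φ x
      map_add' := fun _ _ => rfl
      map_smul' := fun _ _ => rfl } 1 fun φ => by
    rw [one_mul]
    exact φ.norm_apply_le x

@[simp] theorem zeroAtInftyEval_apply (x : X) (φ : C₀(X, ℂ)) : zeroAtInftyEval x φ = φ x := rfl

end ZeroAtInfty

/-! ### C₀-valued kernels as entire functions of z. -/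

section Kernel

variable {n : ℕ}

theorem prod_norm_inner_le {k : ℕ} (u : Cn n) (v : Fin k → Cn n) :
    ‖∏ j, (inner ℂ u (v j) : ℂ)‖ ≤ ‖u‖ ^ k * ∏ j, ‖v j‖ := by
  rw [norm_prod]
  calc ∏ j, ‖(inner ℂ u (v j) : ℂ)‖ ≤ ∏ j, ‖u‖ * ‖v j‖ :=
        Finset.prod_le_prod (fun _ _ => norm_nonneg _) fun j _ => norm_inner_le_norm u (v j)
    _ = _ := by simp [Finset.prod_mul_distrib]

/-- A single term of the exponential series of e^{Tr}. Since T is free, the factor T^{-k} can beat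
any geometric growth of coefficients. -/
theorem pow_le_factorial_mul_exp {T r : ℝ} (hT : 0 < T) (hr : 0 ≤ r) (k : ℕ) :
    r ^ k ≤ k.factorial * (T⁻¹) ^ k * Real.exp (T * r) := by
  have h := Real.pow_div_factorial_le_exp (T * r) (by positivity) k
  rw [div_le_iff₀ (by positivity), mul_pow] at h
  calc r ^ k = (T⁻¹) ^ k * (T ^ k * r ^ k) := by
        rw [← mul_assoc, ← mul_pow, inv_mul_cancel₀ hT.ne', one_pow, one_mul]
    _ ≤ (T⁻¹) ^ k * (Real.exp (T * r) * k.factorial) := by gcongr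
    _ = _ := by ring

theorem fockWt_mul_norm_prod_le {β T C : ℝ} (hT : 0 < T)
    (hC : ∀ z : Cn n, fockWt β z * Real.exp (T * ‖z‖) ≤ C) {k : ℕ} (u : Cn n)
    (v : Fin k → Cn n) :
    ‖(fockWt β u : ℂ) * ∏ j, (inner ℂ u (v j) : ℂ)‖ ≤
      C * (k.factorial * (T⁻¹) ^ k) * ∏ j, ‖v j‖ := by
  rw [norm_mul, Complex.norm_real, Real.norm_of_nonneg (fockWt_pos β u).le]
  have h0 := fockWt_pos β u
  have hp : 0 ≤ ∏ j, ‖v j‖ := Finset.prod_nonneg fun _ _ => norm_nonneg _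
  calc fockWt β u * ‖∏ j, (inner ℂ u (v j) : ℂ)‖
      ≤ fockWt β u * ((k.factorial * (T⁻¹) ^ k * Real.exp (T * ‖u‖)) * ∏ j, ‖v j‖) := by
        gcongr
        refine (prod_norm_inner_le u v).trans ?_
        gcongr
        exact pow_le_factorial_mul_exp hT (norm_nonneg u) k
    _ = (fockWt β u * Real.exp (T * ‖u‖)) * (k.factorial * (T⁻¹) ^ k) * ∏ j, ‖v j‖ := by ring
    _ ≤ _ := by
        gcongr
        exact hC u

/-- The weighted monomial `u ↦ w_β(u) ∏ⱼ ⟪u, vⱼ⟫` in `C₀(ℂⁿ)`. -/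
noncomputable def fockMono (β : ℝ) {k : ℕ} (v : Fin k → Cn n) : C₀(Cn n, ℂ) where
  toFun u := (fockWt β u : ℂ) * ∏ j, (inner ℂ u (v j) : ℂ)
  continuous_toFun := by
    have := continuous_fockWt (n := n) β
    fun_prop
  zero_at_infty' := by
    rw [tendsto_zero_iff_norm_tendsto_zero]
    have h1 := (tendsto_fockWt_mul_exp (n := n) β 1).mul_const
      ((k.factorial * ((1 : ℝ)⁻¹) ^ k) * ∏ j, ‖v j‖)
    rw [zero_mul] at h1
    refine squeeze_zero (fun u => norm_nonneg _) (fun u => ?_) h1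
    rw [norm_mul, Complex.norm_real, Real.norm_of_nonneg (fockWt_pos β u).le, mul_assoc]
    have h0 := fockWt_pos β u
    have hp : 0 ≤ ∏ j, ‖v j‖ := Finset.prod_nonneg fun _ _ => norm_nonneg _
    refine mul_le_mul_of_nonneg_left ((prod_norm_inner_le u v).trans ?_) h0.le
    rw [← mul_assoc]
    gcongr
    rw [mul_comm]
    exact pow_le_factorial_mul_exp one_pos (norm_nonneg u) k

theorem fockMono_apply (β : ℝ) {k : ℕ} (v : Fin k → Cn n) (u : Cn n) :
    fockMono β v u = (fockWt β u : ℂ) * ∏ j, (inner ℂ u (v j) : ℂ) := rfl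

theorem fockMono_const_apply (β : ℝ) (k : ℕ) (z u : Cn n) :
    fockMono β (fun _ : Fin k => z) u = (fockWt β u : ℂ) * (inner ℂ u z : ℂ) ^ k := by
  simp [fockMono_apply]

/-- `fockMono` as a continuous multilinear map. -/
noncomputable def fockMonoCLM (n : ℕ) (β : ℝ) (k : ℕ) :
    ContinuousMultilinearMap ℂ (fun _ : Fin k => Cn n) C₀(Cn n, ℂ) :=
  MultilinearMap.mkContinuous
    { toFun := fun v => fockMono β v
      map_update_add' := fun {inst} v i x y => by
        obtain rfl : inst = instDecidableEqFin k := Subsingleton.elim _ _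
        ext u
        rw [ZeroAtInftyContinuousMap.add_apply]
        simp only [fockMono_apply, ← mul_add]
        congr 1
        exact ((MultilinearMap.mkPiAlgebra ℂ (Fin k) ℂ).compLinearMap
          fun _ => (innerSL ℂ u).toLinearMap).map_update_add v i x y
      map_update_smul' := fun {inst} v i a x => by
        obtain rfl : inst = instDecidableEqFin k := Subsingleton.elim _ _
        ext u
        rw [ZeroAtInftyContinuousMap.smul_apply]
        simp only [fockMono_apply]
        rw [smul_eq_mul, mul_left_comm]
        congr 1
        exact ((MultilinearMap.mkPiAlgebra ℂ (Fin k) ℂ).compLinearMap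
          fun _ => (innerSL ℂ u).toLinearMap).map_update_smul v i a x }
    ((exists_fockWt_mul_exp_le n β 1).choose * (k.factorial * ((1 : ℝ)⁻¹) ^ k)) fun v => by
    have h := (exists_fockWt_mul_exp_le n β 1).choose_spec
    have hp : 0 ≤ ∏ j, ‖v j‖ := Finset.prod_nonneg fun _ _ => norm_nonneg _
    have h0 := h.1.le
    exact ZeroAtInftyContinuousMap.norm_le_of_forall (by positivity)
      fun u => fockWt_mul_norm_prod_le one_pos h.2 u v

@[simp] theorem fockMonoCLM_apply (β : ℝ) (k : ℕ) (v : Fin k → Cn n) :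
    fockMonoCLM n β k v = fockMono β v := rfl

theorem norm_fockMonoCLM_le {β T C : ℝ} (hT : 0 < T) (hC0 : 0 ≤ C)
    (hC : ∀ z : Cn n, fockWt β z * Real.exp (T * ‖z‖) ≤ C) (k : ℕ) :
    ‖fockMonoCLM n β k‖ ≤ C * (k.factorial * (T⁻¹) ^ k) := by
  refine ContinuousMultilinearMap.opNorm_le_bound (by positivity) fun v => ?_
  have hp : 0 ≤ ∏ j, ‖v j‖ := Finset.prod_nonneg fun _ _ => norm_nonneg _
  exact ZeroAtInftyContinuousMap.norm_le_of_forall (by positivity)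
    fun u => fockWt_mul_norm_prod_le hT hC u v

/-- At most geometric growth of a sequence. -/
def GeometricGrowth (c : ℕ → ℝ) : Prop := ∃ A B : ℝ, 0 ≤ A ∧ 0 ≤ B ∧ ∀ k, |c k| ≤ A * B ^ k

/-- The `C₀(ℂⁿ)`-valued power series with terms `u ↦ w_β(u) c_k ⟪u, z⟫^k / k!`. -/
noncomputable def kerSeries (n : ℕ) (β : ℝ) (c : ℕ → ℝ) :
    FormalMultilinearSeries ℂ (Cn n) C₀(Cn n, ℂ) :=
  fun k => ((c k / k.factorial : ℝ) : ℂ) • fockMonoCLM n β k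

theorem radius_kerSeries (β : ℝ) {c : ℕ → ℝ} (hc : GeometricGrowth c) :
    (kerSeries n β c).radius = ⊤ := by
  obtain ⟨A, B, hA, hB, hAB⟩ := hc
  refine FormalMultilinearSeries.radius_eq_top_of_summable_norm _ fun r => ?_
  -- The k! in the norm of the monomials cancels the 1/k! of the series, leaving (Br/T)^k; this T
  -- makes the ratio at most 1/2.
  set T : ℝ := 2 * (B * r) + 1 with hT
  have hr : (0 : ℝ) ≤ r := r.2
  have hBr : 0 ≤ B * r := by positivity
  have hT0 : 0 < T := by positivity
  obtain ⟨C, hC0, hC⟩ := exists_fockWt_mul_exp_le n β T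
  refine Summable.of_nonneg_of_le (fun k => by positivity) (fun k => ?_)
    ((summable_geometric_of_lt_one (r := 1 / 2) (by norm_num) (by norm_num)).mul_left (A * C))
  have h1 : ‖kerSeries n β c k‖ ≤ (A * B ^ k / k.factorial) * (C * (k.factorial * (T⁻¹) ^ k)) := by
    refine (ContinuousMultilinearMap.opNorm_smul_le _ _).trans ?_
    rw [Complex.norm_real, Real.norm_eq_abs, abs_div, Nat.abs_cast]
    gcongr
    · exact hAB k
    · exact norm_fockMonoCLM_le hT0 hC0.le hC k
  calc ‖kerSeries n β c k‖ * (r : ℝ) ^ k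
      ≤ (A * B ^ k / k.factorial) * (C * (k.factorial * (T⁻¹) ^ k)) * (r : ℝ) ^ k := by gcongr
    _ = A * C * (B * r / T) ^ k := by
        have : (k.factorial : ℝ) ≠ 0 := by positivity
        rw [div_eq_mul_inv (B * (r : ℝ)), mul_pow, mul_pow]
        field_simp
    _ ≤ A * C * (1 / 2) ^ k := by
        have h3 : B * r / T ≤ 1 / 2 := by
          rw [div_le_iff₀ hT0]
          linarith
        gcongr

/-- The weighted kernel `u ↦ w_β(u) ∑_k c_k ⟪u, z⟫^k / k!`. -/
noncomputable def fockKer (n : ℕ) (β : ℝ) (c : ℕ → ℝ) (z : Cn n) : C₀(Cn n, ℂ) :=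
  (kerSeries n β c).sum z

/-- The function `x ↦ ∑_k c_k x^k / k!`. -/
noncomputable def kerFun (c : ℕ → ℝ) (x : ℂ) : ℂ := ∑' k, ((c k / k.factorial : ℝ) : ℂ) * x ^ k

variable {β : ℝ} {c : ℕ → ℝ} (hc : GeometricGrowth c)

include hc

theorem hasFPowerSeriesOnBall_fockKer :
    HasFPowerSeriesOnBall (fockKer n β c) (kerSeries n β c) 0 ⊤ := by
  have h := (kerSeries n β c).hasFPowerSeriesOnBall (by rw [radius_kerSeries β hc]; exact ENNReal.zero_lt_top)
  rwa [radius_kerSeries β hc] at h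

theorem hasSum_fockKer (z : Cn n) :
    HasSum (fun k => ((c k / k.factorial : ℝ) : ℂ) • fockMono β (fun _ : Fin k => z))
      (fockKer n β c z) := by
  have h := (hasFPowerSeriesOnBall_fockKer (β := β) (n := n) hc).hasSum (y := z) (by simp)
  rwa [zero_add] at h

theorem fockKer_apply (z u : Cn n) :
    fockKer n β c z u = (fockWt β u : ℂ) * kerFun c (inner ℂ u z) := by
  have h := (hasSum_fockKer (β := β) hc z).mapL (zeroAtInftyEval u)
  simp only [map_smul, zeroAtInftyEval_apply, fockMono_const_apply, smul_eq_mul] at h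
  rw [kerFun, ← tsum_mul_left, ← h.tsum_eq]
  exact tsum_congr fun k => by ring

theorem continuous_fockKer : Continuous (fockKer n β c) := by
  have h := (hasFPowerSeriesOnBall_fockKer (β := β) (n := n) hc).continuousOn
  rwa [Metric.eball_top, continuousOn_univ] at h

/-- Up to the nonzero factor w_0(w), this is the value at w of a kernel that is continuous in z with
values in C₀. -/
theorem continuous_kerFun_inner (w : Cn n) : Continuous fun z : Cn n => kerFun c (inner ℂ w z) := by
  have h : (fun z : Cn n => kerFun c (inner ℂ w z)) =
      fun z => ((fockWt 0 w : ℂ))⁻¹ * zeroAtInftyEval w (fockKer n 0 c z) := by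
    funext z
    rw [zeroAtInftyEval_apply, fockKer_apply hc, inv_mul_cancel_left₀]
    exact Complex.ofReal_ne_zero.2 (fockWt_pos 0 w).ne'
  rw [h]
  exact ((zeroAtInftyEval w).continuous.comp (continuous_fockKer hc)).const_mul _

variable (L : C₀(Cn n, ℂ) →L[ℂ] ℂ)

theorem hasFPowerSeriesOnBall_comp_fockKer :
    HasFPowerSeriesOnBall (fun z => L (fockKer n β c z))
      (L.compFormalMultilinearSeries (kerSeries n β c)) 0 ⊤ :=
  L.comp_hasFPowerSeriesOnBall (hasFPowerSeriesOnBall_fockKer hc)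

/-- A bounded functional passes through the everywhere convergent power series. This is what makes
the function representing a functional entire. -/
theorem contDiff_comp_fockKer : ContDiff ℂ ⊤ fun z => L (fockKer n β c z) := by
  have h := (hasFPowerSeriesOnBall_comp_fockKer (β := β) hc L).analyticOnNhd
  rw [Metric.eball_top] at h
  exact contDiffOn_univ.1 (h.contDiffOn uniqueDiffOn_univ)

theorem homogPart_comp_fockKer (k : ℕ) (z : Cn n) :
    homogPart k (fun z => L (fockKer n β c z)) z =
      ((c k / k.factorial : ℝ) : ℂ) * L (fockMono β fun _ : Fin k => z) := by
  have h := (hasFPowerSeriesOnBall_comp_fockKer (β := β) hc L).factorial_smul z k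
  rw [homogPart, ← h, nsmul_eq_mul, inv_mul_cancel_left₀ (by exact_mod_cast k.factorial_ne_zero)]
  simp [kerSeries]

theorem hasSum_comp_fockKer (z : Cn n) :
    HasSum (fun k => ((c k / k.factorial : ℝ) : ℂ) * L (fockMono β fun _ : Fin k => z))
      (L (fockKer n β c z)) := by
  simpa using (hasSum_fockKer (β := β) hc z).mapL L

end Kernel

theorem geometricGrowth_one : GeometricGrowth fun _ => 1 := ⟨1, 1, by simp⟩

theorem kerFun_one (x : ℂ) : kerFun (fun _ => 1) x = Complex.exp x := by
  rw [kerFun, Complex.exp_eq_exp_ℂ, NormedSpace.exp_eq_tsum_div]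
  refine tsum_congr fun k => ?_
  push_cast
  ring

/-! ### The reproducing formula in F^1_γ. -/

section Reproducing

variable {n : ℕ} {γ : ℝ} {f : Cn n → ℂ}

/-- The entire functions with `∫ |f| w_γ dV < ∞`. -/
structure InF1 (γ : ℝ) (f : Cn n → ℂ) : Prop where
  differentiable : Differentiable ℂ f
  integrable : Integrable (fun z => (fockWt γ z : ℂ) * f z) (fockVol n)

namespace InF1

theorem integrable_mul (hf : InF1 γ f) {φ : Cn n → ℂ} (hφ : Continuous φ) {C : ℝ}
    (hC : ∀ u, fockWt (-γ) u * ‖φ u‖ ≤ C) :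
    Integrable (fun u => f u * φ u * (Real.exp (-‖u‖ ^ 2) : ℝ)) (fockVol n) := by
  have hw := continuous_fockWt (n := n) (-γ)
  have h := hf.integrable.mul_bdd (c := C) (g := fun u => ((fockWt (-γ) u : ℝ) : ℂ) * φ u)
    (Continuous.aestronglyMeasurable (by fun_prop)) (Eventually.of_forall fun u => by
      rw [norm_mul, Complex.norm_real, Real.norm_of_nonneg (fockWt_pos _ u).le]
      exact hC u)
  refine h.congr (Eventually.of_forall fun u => ?_)
  simp only [← fockWt_mul_neg γ u]
  push_cast
  ring

theorem exists_bound_exp_inner (γ : ℝ) (z : Cn n) :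
    ∃ C : ℝ, ∀ u : Cn n, fockWt γ u * ‖Complex.exp (inner ℂ u z)‖ ≤ C := by
  obtain ⟨C, -, hC⟩ := exists_fockWt_mul_exp_le n γ ‖z‖
  refine ⟨C, fun u => le_trans ?_ (hC u)⟩
  have := fockWt_pos γ u
  rw [Complex.norm_exp]
  gcongr
  calc (inner ℂ u z : ℂ).re ≤ ‖(inner ℂ u z : ℂ)‖ := Complex.re_le_norm _
    _ ≤ ‖u‖ * ‖z‖ := norm_inner_le_norm u z
    _ = _ := mul_comm _ _

/-- The reproducing property of the exponential kernel. -/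
theorem integral_mul_exp_inner (hf : InF1 γ f) (z : Cn n) :
    ∫ u, f u * Complex.exp (inner ℂ u z) * (Real.exp (-‖u‖ ^ 2) : ℝ) ∂(fockVol n) = f z := by
  obtain ⟨C, hC⟩ := exists_bound_exp_inner (-γ) z
  have hi := hf.integrable_mul (φ := fun u => Complex.exp (inner ℂ u z)) (by fun_prop) hC
  -- Translation by z absorbs the kernel: ⟪u+z,z⟫ - |u+z|² = -⟪z,u⟫ - |u|². The leftover factor
  -- e^{-⟪z,u⟫} is holomorphic in u and equals 1 at u = 0, so the mean value property yields f(z).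
  have hshift : ∀ u : Cn n, f (u + z) * Complex.exp (inner ℂ (u + z) z) *
      (Real.exp (-‖u + z‖ ^ 2) : ℝ) =
      f (u + z) * Complex.exp (-inner ℂ z u) * (Real.exp (-‖u‖ ^ 2) : ℝ) := fun u => by
    rw [mul_assoc, mul_assoc, Complex.ofReal_exp, Complex.ofReal_exp, ← Complex.exp_add,
      ← Complex.exp_add]
    congr 2
    have h1 : ((‖u + z‖ ^ 2 : ℝ) : ℂ) = inner ℂ (u + z) (u + z) := by
      rw [inner_self_eq_norm_sq_to_K]; norm_cast
    have h2 : ((‖u‖ ^ 2 : ℝ) : ℂ) = inner ℂ u u := by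
      rw [inner_self_eq_norm_sq_to_K]; norm_cast
    rw [Complex.ofReal_neg, Complex.ofReal_neg, h1, h2]
    simp only [inner_add_left, inner_add_right]
    ring
  have hi2 := hi.comp_add_right z
  simp only [hshift] at hi2
  rw [← integral_add_right_eq_self _ z]
  simp only [hshift]
  have hd : Differentiable ℂ fun u : Cn n => f (u + z) * Complex.exp (-inner ℂ z u) := by
    refine (hf.differentiable.comp (differentiable_id.add_const z)).mul ?_
    exact ((innerSL ℂ z).differentiable.neg).cexp
  rw [integral_mul_gaussian_eq hd hi2]
  simp

/-- Integration against `f w_γ` as a functional on `C₀(ℂⁿ)`. -/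
noncomputable def toDual (hf : InF1 γ f) : C₀(Cn n, ℂ) →L[ℂ] ℂ :=
  LinearMap.mkContinuous
    { toFun := fun φ => ∫ u, (fockWt γ u : ℂ) * f u * φ u ∂(fockVol n)
      map_add' := fun φ ψ => by
        rw [← integral_add]
        · refine integral_congr_ae (Eventually.of_forall fun u => ?_)
          simp only [ZeroAtInftyContinuousMap.add_apply]
          ring
        · exact hf.integrable.mul_bdd (c := ‖φ‖) φ.continuous_toFun.aestronglyMeasurable
            (Eventually.of_forall φ.norm_apply_le)
        · exact hf.integrable.mul_bdd (c := ‖ψ‖) ψ.continuous_toFun.aestronglyMeasurable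
            (Eventually.of_forall ψ.norm_apply_le)
      map_smul' := fun a φ => by
        simp only [RingHom.id_apply, smul_eq_mul]
        rw [← integral_const_mul]
        refine integral_congr_ae (Eventually.of_forall fun u => ?_)
        simp only [ZeroAtInftyContinuousMap.smul_apply, smul_eq_mul]
        ring }
    (∫ u, ‖(fockWt γ u : ℂ) * f u‖ ∂(fockVol n)) fun φ => by
    change ‖∫ u, (fockWt γ u : ℂ) * f u * φ u ∂(fockVol n)‖ ≤ _
    rw [← integral_mul_const]
    refine norm_integral_le_of_norm_le (hf.integrable.norm.mul_const _)
      (Eventually.of_forall fun u => ?_)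
    rw [norm_mul]
    exact mul_le_mul_of_nonneg_left (φ.norm_apply_le u) (norm_nonneg _)

theorem toDual_apply (hf : InF1 γ f) (φ : C₀(Cn n, ℂ)) :
    hf.toDual φ = ∫ u, (fockWt γ u : ℂ) * f u * φ u ∂(fockVol n) := rfl

/-- The reproducing formula with f read as a functional on C₀; everything known about the kernel
series then transfers to f itself. -/
theorem toDual_fockKer (hf : InF1 γ f) (z : Cn n) :
    hf.toDual (fockKer n (-γ) (fun _ => 1) z) = f z := by
  rw [toDual_apply, ← hf.integral_mul_exp_inner z]
  refine integral_congr_ae (Eventually.of_forall fun u => ?_)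
  simp only [fockKer_apply geometricGrowth_one, kerFun_one, ← fockWt_mul_neg γ u]
  push_cast
  ring

theorem toDual_fockKer_eq (hf : InF1 γ f) :
    (fun z => hf.toDual (fockKer n (-γ) (fun _ => 1) z)) = f := funext hf.toDual_fockKer

/-- Only complex differentiability enters the definition of the space; analyticity is inherited from
the kernel through the reproducing formula. -/
theorem contDiff (hf : InF1 γ f) : ContDiff ℂ ⊤ f := by
  have := contDiff_comp_fockKer (β := -γ) geometricGrowth_one hf.toDual
  rwa [hf.toDual_fockKer_eq] at this

theorem continuous (hf : InF1 γ f) : Continuous f := hf.differentiable.continuous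

/-- The homogeneous parts as Gaussian integrals. -/
theorem homogPart_eq (hf : InF1 γ f) (k : ℕ) (z : Cn n) :
    homogPart k f z = ((k.factorial : ℂ))⁻¹ *
      ∫ u, f u * (inner ℂ u z : ℂ) ^ k * (Real.exp (-‖u‖ ^ 2) : ℝ) ∂(fockVol n) := by
  have := homogPart_comp_fockKer (β := -γ) geometricGrowth_one hf.toDual k z
  rw [hf.toDual_fockKer_eq, toDual_apply] at this
  rw [this]
  congr 1
  · push_cast; ring
  · refine integral_congr_ae (Eventually.of_forall fun u => ?_)
    simp only [fockMono_const_apply, ← fockWt_mul_neg γ u]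
    push_cast
    ring

theorem hasSum_homogPart (hf : InF1 γ f) (z : Cn n) :
    HasSum (fun k => homogPart k f z) (f z) := by
  have h := hasSum_comp_fockKer (β := -γ) geometricGrowth_one hf.toDual z
  simp only [← homogPart_comp_fockKer geometricGrowth_one hf.toDual] at h
  rwa [hf.toDual_fockKer_eq, hf.toDual_fockKer] at h

end InF1

end Reproducing

/-! ### Orthogonality of degrees and the pairing coefficients. -/

section Orthogonality

variable {n : ℕ}

/-- Integration against `⟪u, z⟫^k` times a radial function only sees the part of degree `k`. -/
theorem integral_mul_inner_pow_mul_radial {f : Cn n → ℂ} (hf : ContDiff ℂ ⊤ f) {ρ : ℝ → ℝ}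
    (hρ : Measurable ρ) (k : ℕ) (z : Cn n)
    (hi : Integrable (fun u => f u * (inner ℂ u z : ℂ) ^ k * (ρ ‖u‖ : ℂ)) (fockVol n)) :
    ∫ u, f u * (inner ℂ u z : ℂ) ^ k * (ρ ‖u‖ : ℂ) ∂(fockVol n) =
      ∫ u, homogPart k f u * (inner ℂ u z : ℂ) ^ k * (ρ ‖u‖ : ℂ) ∂(fockVol n) := by
  have hc : Continuous f := hf.continuous
  have hm : Measurable fun u : Cn n => f u * (inner ℂ u z : ℂ) ^ k * (ρ ‖u‖ : ℂ) :=
    (Continuous.measurable (by fun_prop)).mul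
      (Complex.measurable_ofReal.comp (hρ.comp measurable_norm))
  rw [integral_eq_integral_circleAverage hm hi]
  refine integral_congr_ae (Eventually.of_forall fun u => ?_)
  dsimp only
  rw [← circleAverage_eq_homogPart hf, mul_assoc, mul_comm, ← smul_eq_mul,
    ← Real.circleAverage_fun_smul]
  refine Real.circleAverage_congr_sphere fun a ha => ?_
  have ha1 : ‖a‖ = 1 := by simpa using ha
  simp only [norm_smul, ha1, one_mul, smul_eq_mul, inner_smul_left, mul_pow,
    ← map_pow]
  -- Conjugation inverts a^k on the unit circle, so averaging over rotations extracts the k-th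
  -- Fourier coefficient of a ↦ f(a u).
  have h2 : conj (a ^ k) = (a ^ k)⁻¹ := by
    rw [Complex.inv_eq_conj (by rw [norm_pow, ha1, one_pow])]
  rw [h2]
  ring

/-- The weighted pairing of an entire function with `⟪z, u⟫^k`. -/
theorem integral_mul_inner_pow_mul_rpow {γ : ℝ} {f : Cn n → ℂ} (hf : InF1 γ f) (hn : 0 < n)
    {σ : ℝ} {k : ℕ} (hk : σ < 2 * n + 2 * k) (z : Cn n)
    (hi : Integrable (fun u => f u * (inner ℂ u z : ℂ) ^ k *
      ((Real.exp (-‖u‖ ^ 2) * ‖u‖ ^ (-σ) : ℝ) : ℂ)) (fockVol n)) :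
    ∫ u, f u * (inner ℂ u z : ℂ) ^ k *
      ((Real.exp (-‖u‖ ^ 2) * ‖u‖ ^ (-σ) : ℝ) : ℂ) ∂(fockVol n) =
      ((Real.Gamma (n + k - σ / 2) / Real.Gamma (n + k) : ℝ) : ℂ) *
        (k.factorial * homogPart k f z) := by
  have hi2 : Integrable (fun u => f u * (inner ℂ u z : ℂ) ^ k *
      ((Real.exp (-‖u‖ ^ 2) : ℝ) : ℂ)) (fockVol n) := by
    obtain ⟨C, hC0, hC⟩ := exists_fockWt_mul_exp_le n (-γ) 1
    refine hf.integrable_mul (φ := fun u => (inner ℂ u z : ℂ) ^ k) (by fun_prop)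
      (C := C * (k.factorial * ((1 : ℝ)⁻¹) ^ k) * ∏ _j : Fin k, ‖z‖) fun u => ?_
    have := fockWt_mul_norm_prod_le one_pos hC u (fun _ : Fin k => z)
    rw [norm_mul, Complex.norm_real, Real.norm_of_nonneg (fockWt_pos _ u).le] at this
    simpa using this
  rw [integral_mul_inner_pow_mul_radial hf.contDiff
    (ρ := fun r => Real.exp (-r ^ 2) * r ^ (-σ)) (by fun_prop) k z hi]
  rw [integral_homogeneous_mul_exp_mul_rpow hn hk, hf.homogPart_eq k z,
    mul_inv_cancel_left₀ (by exact_mod_cast k.factorial_ne_zero),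
    integral_mul_inner_pow_mul_radial hf.contDiff (ρ := fun r => Real.exp (-r ^ 2))
      (by fun_prop) k z hi2]
  intro t u ht
  have h1 : homogPart k f (t • u) = (t : ℂ) ^ k * homogPart k f u := by
    rw [← homogPart_smul]; rfl
  have h2 : (inner ℂ (t • u) z : ℂ) = t * inner ℂ u z := by
    have := inner_smul_left (𝕜 := ℂ) u z (t : ℂ)
    rw [Complex.conj_ofReal] at this
    rw [← this]; rfl
  rw [h1, h2]
  ring

/-- The factor by which the pairing `⟨·,·⟩_σ` differs from `(·,·)_0` in degree `k`. -/
noncomputable def pairCoeff (n : ℕ) (σ : ℝ) (k : ℕ) : ℝ :=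
  if σ < 2 * n ∨ ⌊|σ / 2|⌋₊ + 1 ≤ k then Real.Gamma (n + k - σ / 2) / Real.Gamma (n + k) else 1

theorem rawPairing_inner_pow {γ : ℝ} {g : Cn n → ℂ} (hg : InF1 γ g) (hn : 0 < n)
    {σ : ℝ} {k : ℕ} (hk : σ < 2 * n + 2 * k) (z : Cn n)
    (hi : Integrable (rawIntegrand σ (fun u => (inner ℂ z u : ℂ) ^ k) g) (fockVol n)) :
    rawPairing σ (fun u => (inner ℂ z u : ℂ) ^ k) g =
      ((Real.Gamma (n + k - σ / 2) / Real.Gamma (n + k) : ℝ) : ℂ) *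
        (k.factorial * conj (homogPart k g z)) := by
  have h1 : ∀ u : Cn n, conj (rawIntegrand σ (fun u => (inner ℂ z u : ℂ) ^ k) g u) =
      g u * (inner ℂ u z : ℂ) ^ k * ((Real.exp (-‖u‖ ^ 2) * ‖u‖ ^ (-σ) : ℝ) : ℂ) := fun u => by
    simp only [rawIntegrand, map_mul, map_pow, inner_conj_symm, Complex.conj_conj,
      Complex.conj_ofReal]
    ring
  have hi2 : Integrable (fun u => g u * (inner ℂ u z : ℂ) ^ k *
      ((Real.exp (-‖u‖ ^ 2) * ‖u‖ ^ (-σ) : ℝ) : ℂ)) (fockVol n) := by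
    have := (Complex.conjCLE : ℂ →L[ℝ] ℂ).integrable_comp hi
    refine this.congr (Eventually.of_forall fun u => ?_)
    simpa using h1 u
  have h2 := integral_mul_inner_pow_mul_rpow hg hn hk z hi2
  simp only [← h1] at h2
  rw [integral_conj] at h2
  rw [rawPairing, ← Complex.conj_conj (∫ u, _ ∂_), h2]
  simp

/-- A homogeneous polynomial is entirely head or entirely tail. So for σ ≥ 2n only one integral
survives: the plain Gaussian one if k ≤ σ/2, the one with |z|^{-σ} otherwise. -/
theorem fockPairing_inner_pow {γ : ℝ} {σ : ℝ} {g : Cn n → ℂ} (hg : InF1 γ g)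
    (hhead : InF1 γ (taylorHead (σ / 2) g)) (htail : InF1 γ (taylorTail (σ / 2) g)) (hn : 0 < n)
    (k : ℕ) (z : Cn n)
    (hi : FockPairingConverges σ (fun u => (inner ℂ z u : ℂ) ^ k) g) :
    fockPairing σ (fun u => (inner ℂ z u : ℂ) ^ k) g =
      (pairCoeff n σ k : ℂ) * (k.factorial * conj (homogPart k g z)) := by
  have hG : Real.Gamma (n + k) ≠ 0 := (Real.Gamma_pos_of_pos (by positivity)).ne'
  rw [fockPairing, pairCoeff]
  rw [FockPairingConverges] at hi
  by_cases hσ : σ < 2 * n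
  · rw [if_pos hσ] at hi ⊢
    rw [if_pos (Or.inl hσ)]
    exact rawPairing_inner_pow hg hn (by linarith [Nat.cast_nonneg (α := ℝ) k]) z hi
  · rw [if_neg hσ] at hi ⊢
    have hP : ContDiff ℂ ⊤ fun u : Cn n => (inner ℂ z u : ℂ) ^ k :=
      (innerSL ℂ z).contDiff.pow k
    have hj : ∀ (a : ℂ) (u : Cn n), (inner ℂ z (a • u) : ℂ) ^ k = a ^ k * (inner ℂ z u : ℂ) ^ k :=
      fun a u => by rw [inner_smul_right, mul_pow]
    rw [taylorHead_of_homogeneous hP hj, taylorTail_of_homogeneous hP hj] at hi ⊢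
    by_cases hk : k < ⌊|σ / 2|⌋₊ + 1
    · rw [if_pos hk, if_pos hk] at hi ⊢
      have hz : rawPairing σ (0 : Cn n → ℂ) (taylorTail (σ / 2) g) = 0 := by
        simp [rawPairing, rawIntegrand]
      rw [if_neg (by rw [not_or, not_le]; exact ⟨hσ, hk⟩), hz, add_zero,
        rawPairing_inner_pow hhead hn (by positivity) z hi.1, homogPart_taylorHead, if_pos hk]
      simp [hG]
    · rw [if_neg hk, if_neg hk] at hi ⊢
      have hz : rawPairing 0 (0 : Cn n → ℂ) (taylorHead (σ / 2) g) = 0 := by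
        simp [rawPairing, rawIntegrand]
      have hk2 : σ / 2 < k := by
        have h1 := Nat.lt_floor_add_one |σ / 2|
        have h2 : ((⌊|σ / 2|⌋₊ + 1 : ℕ) : ℝ) ≤ k := by exact_mod_cast not_lt.1 hk
        push_cast at h2
        linarith [le_abs_self (σ / 2)]
      rw [if_pos (Or.inr (not_lt.1 hk)), hz, zero_add,
        rawPairing_inner_pow htail hn (by linarith [Nat.cast_nonneg (α := ℝ) n]) z hi.2,
        homogPart_taylorTail _ hg.contDiff, if_neg hk]

end Orthogonality

/-! ### Exponential generating functions of polynomial sequences. -/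

section KernelBounds

/-- The falling factorial cancels against k!, leaving 1/(k-i)! for k ≥ i and 0 below, so the
exponential series is merely shifted by i. -/
theorem hasSum_descFactorial_mul_pow (i : ℕ) (x : ℂ) :
    HasSum (fun k : ℕ => (((k.descFactorial i : ℝ) / k.factorial : ℝ) : ℂ) * x ^ k)
      (x ^ i * Complex.exp x) := by
  have h : HasSum (fun l : ℕ => x ^ i * (x ^ l / l.factorial)) (x ^ i * Complex.exp x) := by
    refine HasSum.mul_left _ ?_
    rw [Complex.exp_eq_exp_ℂ]
    exact NormedSpace.expSeries_div_hasSum_exp x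
  rw [← (add_left_injective i).hasSum_iff]
  · convert h using 1
    funext l
    have h1 := Nat.factorial_mul_descFactorial (n := l + i) (k := i) (by omega)
    rw [Nat.add_sub_cancel] at h1
    have h2 : (l.factorial : ℂ) ≠ 0 := by exact_mod_cast l.factorial_ne_zero
    have h3 : ((l + i).descFactorial i : ℂ) ≠ 0 := by
      exact_mod_cast (Nat.descFactorial_pos.2 (by omega)).ne'
    simp only [Function.comp]
    rw [← h1]
    push_cast
    field_simp
    ring
  · intro k hk
    have : k < i := by
      by_contra h'
      exact hk ⟨k - i, by simp only []; omega⟩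
    simp [Nat.descFactorial_of_lt this]

/-- The exponential generating function of `q` converges and is `O((1 + |x|)^M e^{Re x})`. -/
def ExpBound (M : ℕ) (q : ℕ → ℝ) : Prop :=
  ∃ C : ℝ, 0 ≤ C ∧ ∀ x : ℂ, Summable (fun k => ((q k / k.factorial : ℝ) : ℂ) * x ^ k) ∧
    ‖kerFun q x‖ ≤ C * (1 + ‖x‖) ^ M * Real.exp x.re

theorem ExpBound.add_const_mul {M : ℕ} {p q : ℕ → ℝ} (hp : ExpBound (M + 1) p)
    (hq : ExpBound M q) (c : ℝ) : ExpBound (M + 1) fun k => p k + c * q k := by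
  obtain ⟨A, hA, hpA⟩ := hp
  obtain ⟨B, hB, hqB⟩ := hq
  refine ⟨A + |c| * B, by positivity, fun x => ?_⟩
  have hs := (hpA x).1.add ((hqB x).1.mul_left (c : ℂ))
  have he : (fun k => ((p k / k.factorial : ℝ) : ℂ) * x ^ k +
      (c : ℂ) * (((q k / k.factorial : ℝ) : ℂ) * x ^ k)) =
      fun k => (((p k + c * q k) / k.factorial : ℝ) : ℂ) * x ^ k := by
    funext k
    push_cast
    ring
  refine ⟨by rwa [he] at hs, ?_⟩
  have hk : kerFun (fun k => p k + c * q k) x = kerFun p x + c * kerFun q x := by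
    rw [kerFun, ← he, (hpA x).1.tsum_add ((hqB x).1.mul_left (c : ℂ)), tsum_mul_left]
    rfl
  rw [hk]
  have h1 : (1 : ℝ) ≤ 1 + ‖x‖ := by linarith [norm_nonneg x]
  calc ‖kerFun p x + c * kerFun q x‖ ≤ ‖kerFun p x‖ + |c| * ‖kerFun q x‖ := by
        refine (norm_add_le _ _).trans ?_
        rw [norm_mul, Complex.norm_real, Real.norm_eq_abs]
    _ ≤ A * (1 + ‖x‖) ^ (M + 1) * Real.exp x.re +
        |c| * (B * (1 + ‖x‖) ^ (M + 1) * Real.exp x.re) := by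
        gcongr
        · exact (hpA x).2
        · refine (hqB x).2.trans ?_
          gcongr
          exact M.le_succ
    _ = _ := by ring

theorem expBound_descFactorial (i : ℕ) : ExpBound i fun k => (k.descFactorial i : ℝ) := by
  refine ⟨1, zero_le_one, fun x => ?_⟩
  have h := hasSum_descFactorial_mul_pow i x
  refine ⟨h.summable, ?_⟩
  rw [kerFun, h.tsum_eq, norm_mul, norm_pow, Complex.norm_exp, one_mul]
  gcongr
  linarith [norm_nonneg x]

theorem expBound_descFactorial_mul_prod (b : ℕ → ℝ) (N : ℕ) : ∀ i : ℕ, ExpBound (N + i)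
    fun k => (k.descFactorial i : ℝ) * ∏ j ∈ Finset.range N, (k + b j) := by
  induction N with
  | zero => intro i; simpa using expBound_descFactorial i
  | succ N ih =>
    intro i
    have h1 := ih (i + 1)
    have h2 := ih i
    rw [← add_assoc] at h1
    -- Write k + b_N = (k - i) + (i + b_N): the first summand lengthens the falling factorial by one
    -- factor, the second is a constant. This is why the induction carries i along.
    have h3 := ExpBound.add_const_mul h1 h2 (i + b N)
    rw [show N + 1 + i = N + i + 1 by omega]
    convert h3 using 2 with k
    rw [Finset.prod_range_succ, Nat.descFactorial_succ]
    rcases le_or_gt i k with hik | hik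
    · push_cast [Nat.cast_sub hik]
      ring
    · simp [Nat.descFactorial_of_lt hik]

theorem expBound_prod (b : ℕ → ℝ) (N : ℕ) :
    ExpBound N fun k => ∏ j ∈ Finset.range N, (k + b j) := by
  simpa using expBound_descFactorial_mul_prod b N 0

theorem Real.Gamma_add_nat {x : ℝ} (hx : 0 < x) (N : ℕ) :
    Real.Gamma (x + N) = (∏ j ∈ Finset.range N, (x + j)) * Real.Gamma x := by
  induction N with
  | zero => simp
  | succ N ih =>
    rw [Nat.cast_succ, ← add_assoc, Real.Gamma_add_one (by positivity), ih,
      Finset.prod_range_succ]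
    ring

theorem integrableOn_rpow_Ioc {b : ℝ} (hb : 0 < b) :
    IntegrableOn (fun y : ℝ => y ^ (b - 1)) (Set.Ioc 0 1) := by
  rw [← intervalIntegrable_iff_integrableOn_Ioc_of_le zero_le_one]
  exact intervalIntegral.intervalIntegrable_rpow' (by linarith)

theorem integral_pow_mul_rpow_eq_beta {m : ℕ} {b : ℝ} (hm : 0 < m) (hb : 0 < b) :
    ∫ y in Set.Ioc (0 : ℝ) 1, (1 - y) ^ (m - 1) * y ^ (b - 1) =
      Real.Gamma m * Real.Gamma b / Real.Gamma (m + b) := by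
  have hm' : (0 : ℝ) < m := by exact_mod_cast hm
  have h := Complex.betaIntegral_eq_Gamma_mul_div (b : ℂ) (m : ℂ) (by simpa) (by simpa)
  have h2 : Complex.betaIntegral b m =
      ((∫ y in Set.Ioc (0 : ℝ) 1, (1 - y) ^ (m - 1) * y ^ (b - 1) : ℝ) : ℂ) := by
    rw [Complex.betaIntegral, intervalIntegral.integral_of_le zero_le_one,
      ← integral_complex_ofReal]
    refine setIntegral_congr_fun measurableSet_Ioc fun y hy => ?_
    rw [Complex.ofReal_mul, Complex.ofReal_cpow hy.1.le]
    have : ((m : ℂ) - 1) = ((m - 1 : ℕ) : ℂ) := by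
      rw [Nat.cast_sub hm]; simp
    rw [this, Complex.cpow_natCast]
    push_cast
    ring
  rw [h2] at h
  have h3 : (m : ℂ) = ((m : ℝ) : ℂ) := by simp
  rw [h3, ← Complex.ofReal_add, Complex.Gamma_ofReal, Complex.Gamma_ofReal,
    Complex.Gamma_ofReal] at h
  have h4 : ∫ y in Set.Ioc (0 : ℝ) 1, (1 - y) ^ (m - 1) * y ^ (b - 1) =
      Real.Gamma b * Real.Gamma m / Real.Gamma (b + m) := by exact_mod_cast h
  rw [h4, mul_comm, add_comm]

end KernelBounds

/-! ### Beta averages and the size of the pairing kernel. -/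

section KernelBounds

theorem integrableOn_mul_rpow_Ioc {b : ℝ} (hb : 0 < b) {φ : ℝ → ℝ} (hφ : Continuous φ) {C : ℝ}
    (hC : ∀ y ∈ Set.Ioc (0 : ℝ) 1, |φ y| ≤ C) :
    IntegrableOn (fun y : ℝ => φ y * y ^ (b - 1)) (Set.Ioc 0 1) := by
  refine Integrable.bdd_mul (c := C) (integrableOn_rpow_Ioc hb) hφ.aestronglyMeasurable ?_
  exact (ae_restrict_iff' measurableSet_Ioc).2 (Eventually.of_forall hC)

/-- Multiplying Taylor coefficients by Beta integrals averages the function over dilations. -/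
theorem exists_kerFun_mul_integral_le {N m : ℕ} {b : ℝ} (hb : 0 < b) {q : ℕ → ℝ}
    (hq : ExpBound N q) : ∃ C : ℝ, 0 ≤ C ∧ ∀ x : ℂ,
    Summable (fun k => ((q k * (∫ y in Set.Ioc (0 : ℝ) 1, (1 - y) ^ (m + k) * y ^ (b - 1)) /
      k.factorial : ℝ) : ℂ) * x ^ k) ∧
    ‖kerFun (fun k => q k * ∫ y in Set.Ioc (0 : ℝ) 1, (1 - y) ^ (m + k) * y ^ (b - 1)) x‖ ≤
      C * (1 + ‖x‖) ^ N * ∫ y in Set.Ioc (0 : ℝ) 1, Real.exp ((1 - y) * x.re) * y ^ (b - 1) := by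
  obtain ⟨C, hC, h⟩ := hq
  refine ⟨C, hC, fun x => ?_⟩
  set F : ℕ → ℝ → ℂ := fun k y => (((q k / k.factorial : ℝ) : ℂ) * x ^ k) *
    (((1 - y) ^ (m + k) * y ^ (b - 1) : ℝ) : ℂ) with hF
  have hle1 : ∀ k : ℕ, ∀ y ∈ Set.Ioc (0 : ℝ) 1, |(1 - y) ^ k| ≤ 1 := fun k y hy => by
    rw [abs_of_nonneg (pow_nonneg (by linarith [hy.2]) _)]
    exact pow_le_one₀ (by linarith [hy.2]) (by linarith [hy.1])
  have hg : ∀ k : ℕ, IntegrableOn (fun y : ℝ => (1 - y) ^ k * y ^ (b - 1)) (Set.Ioc 0 1) :=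
    fun k => integrableOn_mul_rpow_Ioc hb (φ := fun y => (1 - y) ^ k) (by fun_prop) (hle1 k)
  have hFi : ∀ k, Integrable (F k) (volume.restrict (Set.Ioc 0 1)) := fun k =>
    ((hg (m + k)).ofReal (𝕜 := ℂ)).const_mul _
  have hFs : Summable fun k => ∫ y in Set.Ioc (0 : ℝ) 1, ‖F k y‖ := by
    refine Summable.of_nonneg_of_le (fun k => integral_nonneg fun y => norm_nonneg _)
      (fun k => ?_) ((h x).1.norm.mul_right (∫ y in Set.Ioc (0 : ℝ) 1, y ^ (b - 1)))
    simp only [hF]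
    rw [← integral_const_mul]
    refine setIntegral_mono_on (hFi k).norm ((integrableOn_rpow_Ioc hb).const_mul _)
      measurableSet_Ioc fun y hy => ?_
    rw [norm_mul _ ((_ : ℝ) : ℂ), Complex.norm_real, Real.norm_eq_abs, abs_mul,
      abs_of_nonneg (Real.rpow_nonneg hy.1.le _)]
    have := hle1 (m + k) y hy
    have h0 := Real.rpow_nonneg hy.1.le (b - 1)
    refine mul_le_mul_of_nonneg_left ?_ (norm_nonneg _)
    nlinarith
  -- Absolute convergence, from 0 ≤ 1 - y ≤ 1 and the integrability of y^{b-1}, allows sum and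
  -- integral to be exchanged.
  have hsum := hasSum_integral_of_summable_integral_norm hFi hFs
  have hterm : ∀ k, ∫ y in Set.Ioc (0 : ℝ) 1, F k y =
      ((q k * (∫ y in Set.Ioc (0 : ℝ) 1, (1 - y) ^ (m + k) * y ^ (b - 1)) /
      k.factorial : ℝ) : ℂ) * x ^ k := fun k => by
    simp only [hF]
    rw [integral_const_mul, integral_complex_ofReal]
    push_cast
    ring
  simp only [hterm] at hsum
  refine ⟨hsum.summable, ?_⟩
  rw [kerFun, hsum.tsum_eq, ← integral_const_mul]
  have hei : IntegrableOn (fun y : ℝ => Real.exp ((1 - y) * x.re) * y ^ (b - 1))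
      (Set.Ioc 0 1) := by
    refine integrableOn_mul_rpow_Ioc hb (φ := fun y => Real.exp ((1 - y) * x.re)) (by fun_prop)
      (C := Real.exp |x.re|) fun y hy => ?_
    rw [abs_of_pos (Real.exp_pos _)]
    refine Real.exp_le_exp.2 ((le_abs_self _).trans ?_)
    rw [abs_mul, abs_of_nonneg (by linarith [hy.2] : (0 : ℝ) ≤ 1 - y)]
    nlinarith [hy.1, abs_nonneg x.re]
  refine norm_integral_le_of_norm_le (hei.const_mul _)
    ((ae_restrict_iff' measurableSet_Ioc).2 (Eventually.of_forall fun y hy => ?_))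
  have hy1 : (0 : ℝ) ≤ 1 - y := by linarith [hy.2]
  have hy2 : (1 : ℝ) - y ≤ 1 := by linarith [hy.1]
  have h0 := Real.rpow_nonneg hy.1.le (b - 1)
  -- The factor (1-y)^k is absorbed as a dilation of the argument x.
  have htsum : ∑' k, F k y = kerFun q (((1 - y : ℝ) : ℂ) * x) *
      (((1 - y) ^ m * y ^ (b - 1) : ℝ) : ℂ) := by
    rw [kerFun, ← tsum_mul_right]
    refine tsum_congr fun k => ?_
    simp only [hF]
    rw [mul_pow]
    push_cast
    ring
  have hk := (h (((1 - y : ℝ) : ℂ) * x)).2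
  rw [Complex.re_ofReal_mul, norm_mul, Complex.norm_real, Real.norm_of_nonneg hy1] at hk
  rw [htsum, norm_mul, Complex.norm_real, Real.norm_eq_abs, abs_mul, abs_of_nonneg h0]
  calc ‖kerFun q (((1 - y : ℝ) : ℂ) * x)‖ * (|(1 - y) ^ m| * y ^ (b - 1))
      ≤ (C * (1 + (1 - y) * ‖x‖) ^ N * Real.exp ((1 - y) * x.re)) * (1 * y ^ (b - 1)) := by
        gcongr
        exact hle1 m y hy
    _ ≤ (C * (1 + 1 * ‖x‖) ^ N * Real.exp ((1 - y) * x.re)) * (1 * y ^ (b - 1)) := by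
        gcongr
    _ = _ := by ring

theorem geometricGrowth_prod (b : ℕ → ℝ) (N : ℕ) :
    GeometricGrowth fun k => ∏ j ∈ Finset.range N, (k + b j) := by
  refine ⟨∏ j ∈ Finset.range N, (1 + |b j|), 2 ^ N,
    Finset.prod_nonneg fun j _ => by positivity, by positivity, fun k => ?_⟩
  rw [Finset.abs_prod]
  calc ∏ j ∈ Finset.range N, |(k : ℝ) + b j|
      ≤ ∏ j ∈ Finset.range N, ((1 + |b j|) * 2 ^ k) := by
        refine Finset.prod_le_prod (fun _ _ => abs_nonneg _) fun j _ => ?_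
        have h1 : |(k : ℝ) + b j| ≤ k + |b j| := by
          refine (abs_add_le _ _).trans ?_
          rw [Nat.abs_cast]
        have h2 : (k : ℝ) + 1 ≤ 2 ^ k := by
          exact_mod_cast Nat.lt_two_pow_self (n := k)
        have h3 := abs_nonneg (b j)
        have h4 : (0 : ℝ) ≤ k := by positivity
        nlinarith
    _ = _ := by
        rw [Finset.prod_mul_distrib, Finset.prod_const, Finset.card_range, ← pow_mul, ← pow_mul,
          mul_comm k N]

variable {n : ℕ} (σ : ℝ)

theorem pairCoeff_pos (hn : 0 < n) (k : ℕ) : 0 < pairCoeff n σ k := by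
  unfold pairCoeff
  split_ifs with h
  · have hn' : (0 : ℝ) < n := by exact_mod_cast hn
    have hk' : (0 : ℝ) ≤ k := by positivity
    refine div_pos (Real.Gamma_pos_of_pos ?_) (Real.Gamma_pos_of_pos (by positivity))
    rcases h with h | h
    · linarith
    · have h1 := Nat.lt_floor_add_one |σ / 2|
      have h2 : ((⌊|σ / 2|⌋₊ + 1 : ℕ) : ℝ) ≤ k := by exact_mod_cast h
      push_cast at h2
      linarith [le_abs_self (σ / 2)]
  · exact one_pos

theorem half_lt_floor_add_one : 0 < ((⌊|σ / 2|⌋₊ + 1 : ℕ) : ℝ) - σ / 2 := by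
  have h1 := Nat.lt_floor_add_one |σ / 2|
  push_cast
  linarith [le_abs_self (σ / 2)]

/-- With b = N - σ/2 > 0 the Beta integral supplies Γ(n+k)/Γ(n+k+b). Since n+k+b = (n+k-σ/2) + N,
the functional equation of Γ supplies the polynomial factor. No asymptotics of Γ are needed. -/
theorem inv_pairCoeff_eq (hn : 0 < n) {k : ℕ} (hk : σ < 2 * n ∨ ⌊|σ / 2|⌋₊ + 1 ≤ k) :
    (pairCoeff n σ k)⁻¹ =
      (Real.Gamma (((⌊|σ / 2|⌋₊ + 1 : ℕ) : ℝ) - σ / 2))⁻¹ *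
      ((∏ j ∈ Finset.range (⌊|σ / 2|⌋₊ + 1), ((k : ℝ) + (n - σ / 2 + j))) *
        ∫ y in Set.Ioc (0 : ℝ) 1, (1 - y) ^ ((n - 1) + k) *
          y ^ ((((⌊|σ / 2|⌋₊ + 1 : ℕ) : ℝ) - σ / 2) - 1)) := by
  have hb := half_lt_floor_add_one σ
  set N := ⌊|σ / 2|⌋₊ + 1 with hN
  have hn' : (0 : ℝ) < n := by exact_mod_cast hn
  have hk' : (0 : ℝ) ≤ k := by positivity
  have hx : 0 < (n : ℝ) + k - σ / 2 := by
    rcases hk with h | h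
    · linarith
    · have h2 : (N : ℝ) ≤ k := by exact_mod_cast h
      linarith
  have h1 := integral_pow_mul_rpow_eq_beta (m := n + k) (by omega) hb
  rw [show n + k - 1 = n - 1 + k by omega] at h1
  have h2 := Real.Gamma_add_nat hx N
  have h3 : ((n + k : ℕ) : ℝ) + ((N : ℝ) - σ / 2) = (n : ℝ) + k - σ / 2 + N := by push_cast; ring
  rw [h1, h3, h2, pairCoeff, if_pos hk]
  have h4 : ∏ j ∈ Finset.range N, ((k : ℝ) + (n - σ / 2 + j)) =
      ∏ j ∈ Finset.range N, ((n : ℝ) + k - σ / 2 + j) :=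
    Finset.prod_congr rfl fun j _ => by ring
  rw [h4]
  have h5 : ∏ j ∈ Finset.range N, ((n : ℝ) + k - σ / 2 + j) ≠ 0 :=
    (Finset.prod_pos fun j _ => by positivity).ne'
  have h6 := (Real.Gamma_pos_of_pos hx).ne'
  have h7 := (Real.Gamma_pos_of_pos hb).ne'
  have h8 : Real.Gamma ((n : ℝ) + k) ≠ 0 := (Real.Gamma_pos_of_pos (by positivity)).ne'
  rw [inv_div, Nat.cast_add n k]
  generalize Real.Gamma ((n : ℝ) + k) = G₁ at *
  generalize Real.Gamma ((n : ℝ) + k - σ / 2) = G₂ at *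
  generalize Real.Gamma ((N : ℝ) - σ / 2) = G₃ at *
  generalize ∏ j ∈ Finset.range N, ((n : ℝ) + k - σ / 2 + j) = P at *
  field_simp

/-- Growth of the inverse pairing coefficients and of the kernel they generate. -/
theorem geometricGrowth_inv_pairCoeff (hn : 0 < n) :
    GeometricGrowth (fun k => (pairCoeff n σ k)⁻¹) := by
  have hb := half_lt_floor_add_one σ
  obtain ⟨A, B, hA, hB, hAB⟩ := geometricGrowth_prod (fun j => (n : ℝ) - σ / 2 + j)
    (⌊|σ / 2|⌋₊ + 1)
  have hΓ := Real.Gamma_pos_of_pos hb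
  set b := ((⌊|σ / 2|⌋₊ + 1 : ℕ) : ℝ) - σ / 2 with hbdef
  set I := ∫ y in Set.Ioc (0 : ℝ) 1, y ^ (b - 1) with hI
  have hI0 : 0 ≤ I := setIntegral_nonneg measurableSet_Ioc fun y hy => Real.rpow_nonneg hy.1.le _
  refine ⟨1 + (Real.Gamma b)⁻¹ * (A * I), B + 1, by positivity, by positivity, fun k => ?_⟩
  change |(pairCoeff n σ k)⁻¹| ≤ _
  have hone : (1 : ℝ) ≤ (B + 1) ^ k := one_le_pow₀ (by linarith)
  by_cases hk : σ < 2 * n ∨ ⌊|σ / 2|⌋₊ + 1 ≤ k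
  · rw [inv_pairCoeff_eq σ hn hk, abs_mul, abs_mul, abs_of_pos (inv_pos.2 hΓ)]
    have hJ : |∫ y in Set.Ioc (0 : ℝ) 1, (1 - y) ^ ((n - 1) + k) * y ^ (b - 1)| ≤ I := by
      rw [← Real.norm_eq_abs]
      refine norm_integral_le_of_norm_le (integrableOn_rpow_Ioc hb)
        ((ae_restrict_iff' measurableSet_Ioc).2 (Eventually.of_forall fun y hy => ?_))
      have hy0 : (0 : ℝ) ≤ 1 - y := by linarith [hy.2]
      have h0 := Real.rpow_nonneg hy.1.le (b - 1)
      rw [Real.norm_of_nonneg (by positivity)]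
      exact mul_le_of_le_one_left h0 (pow_le_one₀ hy0 (by linarith [hy.1]))
    calc _ ≤ (Real.Gamma b)⁻¹ * ((A * B ^ k) * I) := by
          gcongr
          exact hAB k
      _ ≤ (Real.Gamma b)⁻¹ * ((A * (B + 1) ^ k) * I) := by
          gcongr
          linarith
      _ = ((Real.Gamma b)⁻¹ * (A * I)) * (B + 1) ^ k := by ring
      _ ≤ _ := by
          gcongr
          linarith
  · rw [pairCoeff, if_neg hk, inv_one, abs_one]
    have : (0 : ℝ) ≤ (Real.Gamma b)⁻¹ * (A * I) := by positivity
    nlinarith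

theorem exists_kerFun_inv_pairCoeff_le (hn : 0 < n) : ∃ C : ℝ, 0 < C ∧ ∀ x : ℂ,
    ‖kerFun (fun k => (pairCoeff n σ k)⁻¹) x‖ ≤ C * (1 + ‖x‖) ^ (⌊|σ / 2|⌋₊ + 1) *
      (1 + ∫ y in Set.Ioc (0 : ℝ) 1, Real.exp ((1 - y) * x.re) *
        y ^ ((((⌊|σ / 2|⌋₊ + 1 : ℕ) : ℝ) - σ / 2) - 1)) := by
  have hb := half_lt_floor_add_one σ
  obtain ⟨A, hA, h⟩ := exists_kerFun_mul_integral_le (m := n - 1) hb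
    (expBound_prod (fun j => (n : ℝ) - σ / 2 + j) (⌊|σ / 2|⌋₊ + 1))
  have hΓ := Real.Gamma_pos_of_pos hb
  have heq := fun k => inv_pairCoeff_eq (k := k) σ hn
  set N := ⌊|σ / 2|⌋₊ + 1 with hN
  set b := (N : ℝ) - σ / 2 with hbdef
  set p : ℕ → ℝ := fun k => (∏ j ∈ Finset.range N, ((k : ℝ) + (n - σ / 2 + j))) *
        ∫ y in Set.Ioc (0 : ℝ) 1, (1 - y) ^ ((n - 1) + k) * y ^ (b - 1) with hp
  set c : ℕ → ℝ := fun k => (pairCoeff n σ k)⁻¹ with hc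
  -- The Beta formula can fail only for k < N, where the coefficient is 1 if σ ≥ 2n; so the error
  -- contributes a polynomial in x of degree less than N.
  set e : ℕ → ℝ := fun k => c k - (Real.Gamma b)⁻¹ * p k with he
  have he0 : ∀ k ∉ Finset.range N, e k = 0 := fun k hk => by
    rw [Finset.mem_range, not_lt] at hk
    simp only [he, hc, hp, heq k (Or.inr hk), sub_self]
  set D := ∑ k ∈ Finset.range N, |e k| with hD
  have hD0 : 0 ≤ D := Finset.sum_nonneg fun _ _ => abs_nonneg _
  refine ⟨D + (Real.Gamma b)⁻¹ * A + 1, by positivity, fun x => ?_⟩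
  obtain ⟨hs, hle⟩ := h x
  set J := ∫ y in Set.Ioc (0 : ℝ) 1, Real.exp ((1 - y) * x.re) * y ^ (b - 1) with hJ
  have hJ0 : 0 ≤ J := setIntegral_nonneg measurableSet_Ioc fun y hy =>
    mul_nonneg (Real.exp_pos _).le (Real.rpow_nonneg hy.1.le _)
  have hek : kerFun c x = (∑ k ∈ Finset.range N, ((e k / k.factorial : ℝ) : ℂ) * x ^ k) +
      ((Real.Gamma b)⁻¹ : ℝ) * kerFun p x := by
    have h1 : HasSum (fun k => ((e k / k.factorial : ℝ) : ℂ) * x ^ k)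
        (∑ k ∈ Finset.range N, ((e k / k.factorial : ℝ) : ℂ) * x ^ k) :=
      hasSum_sum_of_ne_finset_zero fun k hk => by simp [he0 k hk]
    have h2 := h1.add (hs.hasSum.mul_left (((Real.Gamma b)⁻¹ : ℝ) : ℂ))
    rw [kerFun, kerFun, ← h2.tsum_eq]
    refine tsum_congr fun k => ?_
    simp only [he, hp]
    push_cast
    ring
  have hone : (1 : ℝ) ≤ 1 + ‖x‖ := by linarith [norm_nonneg x]
  have hsum : ‖∑ k ∈ Finset.range N, ((e k / k.factorial : ℝ) : ℂ) * x ^ k‖ ≤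
      D * (1 + ‖x‖) ^ N := by
    rw [hD, Finset.sum_mul]
    refine norm_sum_le_of_le _ fun k hk => ?_
    rw [norm_mul, Complex.norm_real, Real.norm_eq_abs, abs_div, Nat.abs_cast, norm_pow]
    have h1 : |e k| / k.factorial ≤ |e k| :=
      div_le_self (abs_nonneg _) (by exact_mod_cast Nat.one_le_iff_ne_zero.2 k.factorial_ne_zero)
    have h2 : ‖x‖ ^ k ≤ (1 + ‖x‖) ^ N :=
      (pow_le_pow_left₀ (norm_nonneg x) (by linarith) k).trans
        (pow_le_pow_right₀ hone (Finset.mem_range.1 hk).le)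
    gcongr
  rw [hek]
  calc _ ≤ D * (1 + ‖x‖) ^ N + (Real.Gamma b)⁻¹ * (A * (1 + ‖x‖) ^ N * J) := by
        refine (norm_add_le _ _).trans (add_le_add hsum ?_)
        rw [norm_mul, Complex.norm_real, Real.norm_of_nonneg (inv_pos.2 hΓ).le]
        exact mul_le_mul_of_nonneg_left hle (inv_pos.2 hΓ).le
    _ = (D + (Real.Gamma b)⁻¹ * A * J) * (1 + ‖x‖) ^ N := by ring
    _ ≤ ((D + (Real.Gamma b)⁻¹ * A + 1) * (1 + J)) * (1 + ‖x‖) ^ N := by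
        refine mul_le_mul_of_nonneg_right ?_ (by positivity)
        have h3 : 0 ≤ (Real.Gamma b)⁻¹ * A := by positivity
        nlinarith [mul_nonneg hD0 hJ0]
    _ = _ := by ring

/-- A weighted Laplace integral near the right endpoint. -/
theorem exists_lintegral_dilation_le {b : ℝ} (hb : 0 < b) (a : ℝ) : ∃ C : ℝ, 0 < C ∧
    ∀ r : ℝ, 0 ≤ r → ∫⁻ y in Set.Ioc (0 : ℝ) 1, ENNReal.ofReal
      (y ^ (b - 1) * ((1 + (1 - y) * r) ^ a * Real.exp (((1 - y) * r) ^ 2 / 2))) ≤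
      ENNReal.ofReal (C * (1 + r) ^ (a - 2 * b) * Real.exp (r ^ 2 / 2)) := by
  obtain ⟨K, hK, hKle⟩ := exists_one_add_rpow_mul_exp_le |a| 0 (b := 1 / 4) (by norm_num)
  have hΓ := Real.Gamma_pos_of_pos hb
  refine ⟨K * Real.exp (1 / 4) * Real.Gamma b * 8 ^ b, by positivity, fun r hr => ?_⟩
  -- The exponent ((1-y)r)²/2 lies at least r²y/2 below r²/2. Half of this is spent on the power of
  -- 1 + yr, and r²y/4 remains as decay. The 1 keeps ρ positive at r = 0, at the cost of the factor
  -- e^{1/4}.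
  set ρ := (1 + r ^ 2) / 4 with hρ
  have hρ0 : 0 < ρ := by positivity
  set M := K * Real.exp (1 / 4) * (1 + r) ^ a * Real.exp (r ^ 2 / 2) with hM
  have hM0 : 0 ≤ M := by positivity
  have hpt : ∀ y ∈ Set.Ioc (0 : ℝ) 1,
      y ^ (b - 1) * ((1 + (1 - y) * r) ^ a * Real.exp (((1 - y) * r) ^ 2 / 2)) ≤
      M * (y ^ (b - 1) * Real.exp (-(ρ * y))) := fun y hy => by
    have hy0 := hy.1.le
    have hy1 := hy.2
    have h1 : (1 + (1 - y) * r) ^ a ≤ (1 + r) ^ a * (1 + y * r) ^ |a| :=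
      one_add_rpow_le_mul (mul_nonneg (by linarith) hr) hr (by positivity) (by nlinarith)
        (by nlinarith) a
    have h2 : (1 + y * r) ^ |a| ≤ (1 + √y * r) ^ |a| := by
      have hys : y ≤ √y := by
        rw [Real.le_sqrt' hy.1]
        nlinarith
      gcongr
    have h3 : (1 + √y * r) ^ |a| ≤ K * Real.exp (y * r ^ 2 / 4) := by
      have := hKle (√y * r) (by positivity)
      rw [mul_pow, Real.sq_sqrt hy0] at this
      calc (1 + √y * r) ^ |a| = (1 + √y * r) ^ |a| *
            Real.exp (0 * (√y * r) - 1 / 4 * (y * r ^ 2)) * Real.exp (y * r ^ 2 / 4) := by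
            rw [mul_assoc, ← Real.exp_add]
            ring_nf
            simp
        _ ≤ _ := by gcongr
    have h4 : Real.exp (y * r ^ 2 / 4) * Real.exp (((1 - y) * r) ^ 2 / 2) ≤
        Real.exp (1 / 4) * Real.exp (r ^ 2 / 2) * Real.exp (-(ρ * y)) := by
      rw [← Real.exp_add, ← Real.exp_add, ← Real.exp_add]
      refine Real.exp_le_exp.2 ?_
      rw [hρ]
      nlinarith [mul_nonneg (mul_nonneg hy0 (by linarith : (0 : ℝ) ≤ 1 - y)) (sq_nonneg r)]
    have h0 := Real.rpow_nonneg hy0 (b - 1)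
    have hpos : 0 ≤ (1 + r) ^ a := by positivity
    calc _ ≤ y ^ (b - 1) * (((1 + r) ^ a * (K * Real.exp (y * r ^ 2 / 4))) *
          Real.exp (((1 - y) * r) ^ 2 / 2)) := by
          refine mul_le_mul_of_nonneg_left (mul_le_mul_of_nonneg_right ?_ (Real.exp_pos _).le) h0
          exact h1.trans (mul_le_mul_of_nonneg_left (h2.trans h3) hpos)
      _ = y ^ (b - 1) * ((1 + r) ^ a * K) * (Real.exp (y * r ^ 2 / 4) *
          Real.exp (((1 - y) * r) ^ 2 / 2)) := by ring
      _ ≤ y ^ (b - 1) * ((1 + r) ^ a * K) *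
          (Real.exp (1 / 4) * Real.exp (r ^ 2 / 2) * Real.exp (-(ρ * y))) := by gcongr
      _ = _ := by rw [hM]; ring
  -- Integrability is read off from the value: a non-integrable function has integral 0 by
  -- convention, while the Gamma integral is positive.
  have hgi : IntegrableOn (fun y : ℝ => y ^ (b - 1) * Real.exp (-(ρ * y))) (Set.Ioi 0) := by
    by_contra hcon
    have := Real.integral_rpow_mul_exp_neg_mul_Ioi hb hρ0
    rw [integral_undef hcon] at this
    have : 0 < (1 / ρ) ^ b * Real.Gamma b := by positivity
    linarith
  calc _ ≤ ∫⁻ y in Set.Ioc (0 : ℝ) 1, ENNReal.ofReal (M * (y ^ (b - 1) * Real.exp (-(ρ * y)))) :=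
        setLIntegral_mono' measurableSet_Ioc fun y hy => ENNReal.ofReal_le_ofReal (hpt y hy)
    _ ≤ ∫⁻ y in Set.Ioi (0 : ℝ), ENNReal.ofReal (M * (y ^ (b - 1) * Real.exp (-(ρ * y)))) :=
        lintegral_mono_set Set.Ioc_subset_Ioi_self
    _ = ENNReal.ofReal (M * ((1 / ρ) ^ b * Real.Gamma b)) := by
        rw [← ofReal_integral_eq_lintegral_ofReal (hgi.const_mul M), integral_const_mul,
          Real.integral_rpow_mul_exp_neg_mul_Ioi hb hρ0]
        refine (ae_restrict_iff' measurableSet_Ioi).2 (Eventually.of_forall fun y hy => ?_)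
        have := Real.rpow_nonneg (le_of_lt hy) (b - 1)
        positivity
    _ ≤ _ := by
        refine ENNReal.ofReal_le_ofReal ?_
        -- Since ρ ≥ (1+r)²/8, the Laplace integral ρ^{-b} Γ(b) carries the gain (1+r)^{-2b}.
        have h5 : (1 / ρ) ^ b ≤ 8 ^ b * (1 + r) ^ (-(2 * b)) := by
          have h6 : (1 + r) ^ (-(2 * b)) = (((1 + r) ^ 2)⁻¹) ^ b := by
            rw [Real.rpow_neg (by positivity), Real.inv_rpow (by positivity),
              Real.rpow_mul (by positivity)]
            norm_num
          rw [h6, ← Real.mul_rpow (by positivity) (by positivity)]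
          refine Real.rpow_le_rpow (by positivity) ?_ hb.le
          rw [hρ, one_div, inv_div, ← div_eq_mul_inv,
            div_le_div_iff₀ (by positivity) (by positivity)]
          nlinarith [sq_nonneg (r - 1)]
        calc M * ((1 / ρ) ^ b * Real.Gamma b)
            ≤ M * ((8 ^ b * (1 + r) ^ (-(2 * b))) * Real.Gamma b) := by gcongr
          _ = _ := by
            rw [hM, sub_eq_add_neg, Real.rpow_add (by positivity)]
            ring

end KernelBounds

/-! ### Integrating the kernel against the weight. -/

section KernelIntegral

theorem integrableOn_exp_mul_rpow_Ioc {b : ℝ} (hb : 0 < b) (s : ℝ) :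
    IntegrableOn (fun y : ℝ => Real.exp ((1 - y) * s) * y ^ (b - 1)) (Set.Ioc 0 1) := by
  refine integrableOn_mul_rpow_Ioc hb (φ := fun y => Real.exp ((1 - y) * s)) (by fun_prop)
    (C := Real.exp |s|) fun y hy => ?_
  rw [abs_of_pos (Real.exp_pos _)]
  refine Real.exp_le_exp.2 ((le_abs_self _).trans ?_)
  rw [abs_mul, abs_of_nonneg (by linarith [hy.2] : (0 : ℝ) ≤ 1 - y)]
  nlinarith [hy.1, abs_nonneg s]

variable {n : ℕ}

theorem inv_fockWt (γ : ℝ) (z : Cn n) :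
    (fockWt γ z)⁻¹ = (1 + ‖z‖) ^ γ * Real.exp (‖z‖ ^ 2 / 2) := by
  unfold fockWt
  rw [mul_inv, ← Real.exp_neg, ← Real.rpow_neg (by positivity), neg_neg, mul_comm]
  congr 2
  ring

/-- A dilated exponential kernel integrated against the weight. -/
theorem exists_lintegral_exp_dilation_le (n : ℕ) {b : ℝ} (hb : 0 < b) (α : ℝ) :
    ∃ C : ℝ, 0 < C ∧ ∀ w : Cn n,
    ∫⁻ z, (∫⁻ y in Set.Ioc (0 : ℝ) 1, ENNReal.ofReal (fockWt α z *
      (Real.exp ((1 - y) * (inner ℂ w z : ℂ).re) * y ^ (b - 1)))) ∂(fockVol n) ≤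
      ENNReal.ofReal (C * (1 + ‖w‖) ^ (-α - 2 * b) * Real.exp (‖w‖ ^ 2 / 2)) := by
  obtain ⟨G, hG, hGle⟩ := exists_integral_gaussian_le n (-α)
  obtain ⟨T, hT, hTle⟩ := exists_lintegral_dilation_le hb (-α)
  refine ⟨G * T, by positivity, fun w => ?_⟩
  have hw := continuous_fockWt (n := n) α
  rw [lintegral_lintegral_swap]
  swap
  · refine Measurable.aemeasurable (ENNReal.measurable_ofReal.comp ?_)
    refine (hw.measurable.comp measurable_fst).mul (Measurable.mul ?_ ?_)
    · exact Continuous.measurable (by fun_prop)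
    · exact (measurable_snd.pow_const _)
  have hinner : ∀ y ∈ Set.Ioc (0 : ℝ) 1, ∫⁻ z, ENNReal.ofReal (fockWt α z *
      (Real.exp ((1 - y) * (inner ℂ w z : ℂ).re) * y ^ (b - 1))) ∂(fockVol n) ≤
      ENNReal.ofReal G * ENNReal.ofReal (y ^ (b - 1) * ((1 + (1 - y) * ‖w‖) ^ (-α) *
        Real.exp (((1 - y) * ‖w‖) ^ 2 / 2))) := fun y hy => by
    have hy1 : (0 : ℝ) ≤ 1 - y := by linarith [hy.2]
    have h0 := Real.rpow_nonneg hy.1.le (b - 1)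
    -- Completing the square turns the z-integral into a Gaussian average centred at this point.
    set v : Cn n := ((1 - y : ℝ) : ℂ) • w with hv
    have hvn : ‖v‖ = (1 - y) * ‖w‖ := by
      rw [hv, norm_smul, Complex.norm_real, Real.norm_of_nonneg hy1]
    have heq : ∀ z : Cn n, fockWt α z *
        (Real.exp ((1 - y) * (inner ℂ w z : ℂ).re) * y ^ (b - 1)) =
        (y ^ (b - 1) * Real.exp (((1 - y) * ‖w‖) ^ 2 / 2)) *
          ((1 + ‖z‖) ^ (-α) * Real.exp (-‖z - v‖ ^ 2 / 2)) := fun z => by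
      have h1 := norm_exp_inner_mul_fockWt α z v
      have h2 : (inner ℂ z v : ℂ).re = (1 - y) * (inner ℂ w z : ℂ).re := by
        rw [hv, inner_smul_right, Complex.re_ofReal_mul, ← inner_conj_symm w z, Complex.conj_re]
      rw [Complex.norm_exp, h2, hvn] at h1
      calc _ = (Real.exp ((1 - y) * (inner ℂ w z : ℂ).re) * fockWt α z) * y ^ (b - 1) := by ring
        _ = _ := by rw [h1]; ring
    obtain ⟨hi, hle⟩ := hGle v
    simp only [heq]
    rw [← ofReal_integral_eq_lintegral_ofReal (hi.const_mul _)
      (Eventually.of_forall fun z => by positivity), integral_const_mul,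
      ← ENNReal.ofReal_mul hG.le]
    refine ENNReal.ofReal_le_ofReal ?_
    calc _ ≤ (y ^ (b - 1) * Real.exp (((1 - y) * ‖w‖) ^ 2 / 2)) * (G * (1 + ‖v‖) ^ (-α)) := by
          gcongr
      _ = _ := by rw [hvn]; ring
  calc _ ≤ ∫⁻ y in Set.Ioc (0 : ℝ) 1, ENNReal.ofReal G * ENNReal.ofReal (y ^ (b - 1) *
        ((1 + (1 - y) * ‖w‖) ^ (-α) * Real.exp (((1 - y) * ‖w‖) ^ 2 / 2))) :=
        setLIntegral_mono' measurableSet_Ioc hinner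
    _ = ENNReal.ofReal G * ∫⁻ y in Set.Ioc (0 : ℝ) 1, ENNReal.ofReal (y ^ (b - 1) *
        ((1 + (1 - y) * ‖w‖) ^ (-α) * Real.exp (((1 - y) * ‖w‖) ^ 2 / 2))) :=
        lintegral_const_mul' _ _ ENNReal.ofReal_ne_top
    _ ≤ ENNReal.ofReal G *
        ENNReal.ofReal (T * (1 + ‖w‖) ^ (-α - 2 * b) * Real.exp (‖w‖ ^ 2 / 2)) := by
        gcongr
        exact hTle _ (norm_nonneg w)
    _ = _ := by
        rw [← ENNReal.ofReal_mul hG.le]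
        congr 1
        ring

/-- A pointwise bound for the weighted kernel of the pairing. -/
theorem exists_ofReal_fockWt_mul_kerFun_le (hn : 0 < n) (α σ : ℝ) : ∃ A : ℝ, 0 < A ∧
    ∀ w z : Cn n, ENNReal.ofReal (fockWt α z *
      ‖kerFun (fun k => (pairCoeff n σ k)⁻¹) (inner ℂ w z)‖) ≤
      ENNReal.ofReal (A * (1 + ‖w‖) ^ (⌊|σ / 2|⌋₊ + 1)) *
        (ENNReal.ofReal (fockWt (α - (⌊|σ / 2|⌋₊ + 1 : ℕ)) z) +
        ∫⁻ y in Set.Ioc (0 : ℝ) 1, ENNReal.ofReal (fockWt (α - (⌊|σ / 2|⌋₊ + 1 : ℕ)) z *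
          (Real.exp ((1 - y) * (inner ℂ w z : ℂ).re) *
            y ^ ((((⌊|σ / 2|⌋₊ + 1 : ℕ) : ℝ) - σ / 2) - 1)))) := by
  obtain ⟨A, hA, hAle⟩ := exists_kerFun_inv_pairCoeff_le σ hn
  have hb := half_lt_floor_add_one σ
  set N := ⌊|σ / 2|⌋₊ + 1 with hN
  set b := (N : ℝ) - σ / 2 with hbdef
  refine ⟨A, hA, fun w z => ?_⟩
  set r := 1 + ‖w‖ with hr
  have hwt := fockWt_pos α z
  have hwN := fockWt_pos (α - N) z
  have hnn : ∀ y ∈ Set.Ioc (0 : ℝ) 1, 0 ≤ fockWt (α - N) z *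
      (Real.exp ((1 - y) * (inner ℂ w z : ℂ).re) * y ^ (b - 1)) := fun y hy =>
    mul_nonneg hwN.le (mul_nonneg (Real.exp_pos _).le (Real.rpow_nonneg hy.1.le _))
  rw [← ofReal_integral_eq_lintegral_ofReal ((integrableOn_exp_mul_rpow_Ioc hb _).const_mul _)
    ((ae_restrict_iff' measurableSet_Ioc).2 (Eventually.of_forall hnn)),
    ← ENNReal.ofReal_add hwN.le (setIntegral_nonneg measurableSet_Ioc hnn),
    ← ENNReal.ofReal_mul (by positivity), integral_const_mul]
  refine ENNReal.ofReal_le_ofReal ?_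
  have h1 := hAle (inner ℂ w z)
  have hJ0 : 0 ≤ ∫ y in Set.Ioc (0 : ℝ) 1, Real.exp ((1 - y) * (inner ℂ w z : ℂ).re) *
      y ^ (b - 1) := setIntegral_nonneg measurableSet_Ioc fun y hy =>
    mul_nonneg (Real.exp_pos _).le (Real.rpow_nonneg hy.1.le _)
  generalize ∫ y in Set.Ioc (0 : ℝ) 1, Real.exp ((1 - y) * (inner ℂ w z : ℂ).re) *
    y ^ (b - 1) = J at h1 hJ0 ⊢
  -- Cauchy–Schwarz splits the polynomial factor; the part in z lowers the weight exponent from α to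
  -- α - N.
  have h2 : (1 + ‖(inner ℂ w z : ℂ)‖) ^ N ≤ r ^ N * (1 + ‖z‖) ^ N := by
    rw [← mul_pow]
    have h3 := norm_inner_le_norm (𝕜 := ℂ) w z
    refine pow_le_pow_left₀ (by positivity) ?_ N
    rw [hr]
    nlinarith [norm_nonneg w, norm_nonneg z]
  have h4 : fockWt (α - N) z = fockWt α z * (1 + ‖z‖) ^ N := by
    rw [sub_eq_add_neg, fockWt_add, neg_neg, Real.rpow_natCast]
  calc _ ≤ fockWt α z * (A * (r ^ N * (1 + ‖z‖) ^ N) * (1 + J)) := by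
        refine mul_le_mul_of_nonneg_left (h1.trans ?_) hwt.le
        gcongr
    _ = A * r ^ N * (fockWt (α - N) z + fockWt (α - N) z * J) := by rw [h4]; ring

/-- The kernel of the pairing is integrable against the dual weight, in the form of a lower
integral. -/
theorem exists_lintegral_kerFun_le (hn : 0 < n) (α β : ℝ) : ∃ C : ℝ, 0 < C ∧ ∀ w : Cn n,
    ∫⁻ z, ENNReal.ofReal (fockWt α z *
      ‖kerFun (fun k => (pairCoeff n (α + β) k)⁻¹) (inner ℂ w z)‖) ∂(fockVol n) ≤
      ENNReal.ofReal (C * (fockWt β w)⁻¹) := by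
  set σ := α + β with hσ
  obtain ⟨A, hA, hpt⟩ := exists_ofReal_fockWt_mul_kerFun_le hn α σ
  have hb := half_lt_floor_add_one σ
  set N := ⌊|σ / 2|⌋₊ + 1 with hN
  set b := (N : ℝ) - σ / 2 with hbdef
  obtain ⟨T, hT, hTle⟩ := exists_lintegral_exp_dilation_le n hb (α - N)
  obtain ⟨D, hD, hDle⟩ := exists_one_add_rpow_mul_exp_le (N - β) 0 (b := 1 / 2) (by norm_num)
  have hWi : Integrable (fockWt (α - N) : Cn n → ℝ) (fockVol n) := by
    simpa using integrable_fockWt_mul_exp (n := n) (α - N) 0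
  have hI : ∫⁻ z : Cn n, ENNReal.ofReal (fockWt (α - N) z) ∂(fockVol n) =
      ENNReal.ofReal (∫ z : Cn n, fockWt (α - N) z ∂(fockVol n)) :=
    (ofReal_integral_eq_lintegral_ofReal hWi
      (Eventually.of_forall fun z => (fockWt_pos _ z).le)).symm
  have hI0 : 0 ≤ ∫ z : Cn n, fockWt (α - N) z ∂(fockVol n) :=
    integral_nonneg fun z => (fockWt_pos _ z).le
  generalize ∫ z : Cn n, fockWt (α - N) z ∂(fockVol n) = I at hI hI0
  refine ⟨A * (D * I + T), by positivity, fun w => ?_⟩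
  have hT2 := hTle w
  have h7 := hDle ‖w‖ (norm_nonneg w)
  have hmeas : Measurable fun z : Cn n => ENNReal.ofReal (fockWt (α - N) z) :=
    ENNReal.measurable_ofReal.comp (continuous_fockWt _).measurable
  refine (lintegral_mono (hpt w)).trans ?_
  rw [lintegral_const_mul' _ _ ENNReal.ofReal_ne_top, lintegral_add_left hmeas, hI]
  refine (mul_le_mul_right (add_le_add_right hT2 _) _).trans ?_
  rw [inv_fockWt]
  have hr0 : 0 < 1 + ‖w‖ := by positivity
  generalize hr : 1 + ‖w‖ = r at h7 hr0 ⊢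
  rw [← ENNReal.ofReal_add hI0 (by positivity), ← ENNReal.ofReal_mul (by positivity)]
  refine ENNReal.ofReal_le_ofReal ?_
  -- The exponents balance: N - (α - N) - 2b = σ - α = β.
  have h5 : r ^ N * r ^ (-(α - N) - 2 * b) = r ^ β := by
    rw [← Real.rpow_natCast r N, ← Real.rpow_add hr0]
    congr 1
    rw [hbdef, hσ]
    ring
  -- The term without exponential growth is harmless for every β, because the Gaussian dominates
  -- powers.
  have h6 : r ^ N ≤ D * (r ^ β * Real.exp (‖w‖ ^ 2 / 2)) := by
    rw [Real.rpow_sub hr0, Real.rpow_natCast, div_mul_eq_mul_div,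
      div_le_iff₀ (by positivity)] at h7
    calc r ^ N = r ^ N * Real.exp (0 * ‖w‖ - 1 / 2 * ‖w‖ ^ 2) * Real.exp (‖w‖ ^ 2 / 2) := by
          rw [mul_assoc, ← Real.exp_add]
          ring_nf
          simp
      _ ≤ D * r ^ β * Real.exp (‖w‖ ^ 2 / 2) := by gcongr
      _ = _ := by ring
  calc A * r ^ N * (I + T * r ^ (-(α - N) - 2 * b) * Real.exp (‖w‖ ^ 2 / 2))
      = A * (r ^ N * I + T * (r ^ N * r ^ (-(α - N) - 2 * b)) * Real.exp (‖w‖ ^ 2 / 2)) := by ring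
    _ ≤ A * (D * (r ^ β * Real.exp (‖w‖ ^ 2 / 2)) * I +
        T * r ^ β * Real.exp (‖w‖ ^ 2 / 2)) := by rw [h5]; gcongr
    _ = _ := by ring

/-- The kernel of the pairing is integrable against the dual weight. -/
theorem exists_integral_kerFun_le (hn : 0 < n) (α β : ℝ) : ∃ C : ℝ, 0 < C ∧ ∀ w : Cn n,
    Integrable (fun z => fockWt α z *
      ‖kerFun (fun k => (pairCoeff n (α + β) k)⁻¹) (inner ℂ w z)‖) (fockVol n) ∧
    ∫ z, fockWt α z * ‖kerFun (fun k => (pairCoeff n (α + β) k)⁻¹) (inner ℂ w z)‖ ∂(fockVol n) ≤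
      C * (fockWt β w)⁻¹ := by
  obtain ⟨C, hC, h⟩ := exists_lintegral_kerFun_le hn α β
  have hgrow := geometricGrowth_inv_pairCoeff (α + β) hn
  refine ⟨C, hC, fun w => ?_⟩
  have hbound := h w
  have hcont : Continuous fun z : Cn n => fockWt α z *
      ‖kerFun (fun k => (pairCoeff n (α + β) k)⁻¹) (inner ℂ w z)‖ :=
    (continuous_fockWt α).mul (continuous_kerFun_inner hgrow w).norm
  have hnn : ∀ z : Cn n, 0 ≤ fockWt α z *
      ‖kerFun (fun k => (pairCoeff n (α + β) k)⁻¹) (inner ℂ w z)‖ := fun z =>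
    mul_nonneg (fockWt_pos α z).le (norm_nonneg _)
  have hint : Integrable (fun z => fockWt α z *
      ‖kerFun (fun k => (pairCoeff n (α + β) k)⁻¹) (inner ℂ w z)‖) (fockVol n) := by
    refine ⟨hcont.aestronglyMeasurable, ?_⟩
    rw [hasFiniteIntegral_iff_ofReal (Eventually.of_forall hnn)]
    exact hbound.trans_lt ENNReal.ofReal_lt_top
  refine ⟨hint, ?_⟩
  rw [← ofReal_integral_eq_lintegral_ofReal hint (Eventually.of_forall hnn)] at hbound
  have := fockWt_pos β w
  exact (ENNReal.ofReal_le_ofReal_iff (by positivity)).1 hbound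

end KernelIntegral

/-! ### From functionals on C₀ to integrable functions. -/

section Duality

variable {n : ℕ}

/-- A functional on `C₀(ℂⁿ)` evaluated on the kernels is integrable against the dual weight. -/
theorem integrable_comp_fockKer {α β C : ℝ} (hC : 0 ≤ C) {c : ℕ → ℝ} (hc : GeometricGrowth c)
    (h : ∀ w : Cn n, Integrable (fun z => fockWt α z * ‖kerFun c (inner ℂ w z)‖) (fockVol n) ∧
      ∫ z, fockWt α z * ‖kerFun c (inner ℂ w z)‖ ∂(fockVol n) ≤ C * (fockWt β w)⁻¹)
    (L : C₀(Cn n, ℂ) →L[ℂ] ℂ) :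
    Integrable (fun z => (fockWt α z : ℂ) * L (fockKer n β c z)) (fockVol n) ∧
    ∫ z, ‖(fockWt α z : ℂ) * L (fockKer n β c z)‖ ∂(fockVol n) ≤ C * ‖L‖ := by
  have hKc : Continuous (fockKer n β c) := continuous_fockKer hc
  have hw : Continuous fun z : Cn n => ((fockWt α z : ℝ) : ℂ) :=
    Complex.continuous_ofReal.comp (continuous_fockWt α)
  set g : Cn n → ℂ := fun z => L (fockKer n β c z) with hg
  have hgc : Continuous g := L.continuous.comp hKc
  -- On a ball the C₀-valued integrand is Bochner integrable by compactness; the bound is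
  -- independent of R, so exhaustion by balls finishes.
  have hball : ∀ R : ℝ, ∫ z in Metric.closedBall (0 : Cn n) R, ‖(fockWt α z : ℂ) * g z‖
      ∂(fockVol n) ≤ C * ‖L‖ := fun R => by
    -- The conjugate phase of g, equal to 0 where g vanishes. It makes L of the C₀-valued integral
    -- equal to the L¹ norm over the ball.
    set θ : Cn n → ℂ := fun z => conj (g z) * ((‖g z‖⁻¹ : ℝ) : ℂ) with hθ
    have hθm : Measurable θ :=
      ((Complex.continuous_conj.comp hgc).measurable).mul
        (Complex.measurable_ofReal.comp hgc.measurable.norm.inv)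
    have hθ1 : ∀ z, ‖θ z‖ ≤ 1 := fun z => by
      simp only [hθ]
      rw [norm_mul, RCLike.norm_conj, Complex.norm_real, norm_inv, norm_norm]
      exact mul_inv_le_one
    have hθg : ∀ z, θ z * g z = (‖g z‖ : ℂ) := fun z => by
      simp only [hθ]
      by_cases h0 : g z = 0
      · simp [h0]
      · have h1 : conj (g z) * g z = ((‖g z‖ ^ 2 : ℝ) : ℂ) := by
          rw [Complex.conj_mul']; norm_cast
        rw [mul_right_comm, h1, ← Complex.ofReal_mul]
        have : ‖g z‖ ≠ 0 := norm_ne_zero_iff.2 h0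
        congr 1
        field_simp
    have hi0 : IntegrableOn (fun z => (fockWt α z : ℂ) • fockKer n β c z)
        (Metric.closedBall (0 : Cn n) R) (fockVol n) :=
      (hw.smul hKc).continuousOn.integrableOn_compact (isCompact_closedBall 0 R)
    have hi : IntegrableOn (fun z => θ z • ((fockWt α z : ℂ) • fockKer n β c z))
        (Metric.closedBall (0 : Cn n) R) (fockVol n) := by
      refine Integrable.mono hi0 (hθm.aestronglyMeasurable.smul hi0.aestronglyMeasurable)
        (Eventually.of_forall fun z => ?_)
      rw [norm_smul]
      exact mul_le_of_le_one_left (norm_nonneg _) (hθ1 z)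
    set B := ∫ z in Metric.closedBall (0 : Cn n) R,
      θ z • ((fockWt α z : ℂ) • fockKer n β c z) ∂(fockVol n) with hB
    have hLB : L B = ((∫ z in Metric.closedBall (0 : Cn n) R, ‖(fockWt α z : ℂ) * g z‖
        ∂(fockVol n) : ℝ) : ℂ) := by
      rw [hB, ← L.integral_comp_comm hi, ← integral_complex_ofReal]
      refine integral_congr_ae (Eventually.of_forall fun z => ?_)
      simp only [map_smul, smul_eq_mul]
      rw [mul_left_comm]
      change (fockWt α z : ℂ) * (θ z * g z) = _
      rw [hθg, norm_mul, Complex.norm_real, Real.norm_of_nonneg (fockWt_pos α z).le]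
      push_cast
      ring
    -- The sup norm is estimated pointwise in w, where `h` cancels the weight w_β(w) exactly.
    have hBn : ‖B‖ ≤ C := by
      refine ZeroAtInftyContinuousMap.norm_le_of_forall hC fun w => ?_
      have h1 : B w = ∫ z in Metric.closedBall (0 : Cn n) R,
          θ z * ((fockWt α z : ℂ) * ((fockWt β w : ℂ) * kerFun c (inner ℂ w z))) ∂(fockVol n) := by
        rw [← zeroAtInftyEval_apply, hB, ← ContinuousLinearMap.integral_comp_comm _ hi]
        refine integral_congr_ae (Eventually.of_forall fun z => ?_)
        simp only [map_smul, smul_eq_mul, zeroAtInftyEval_apply, fockKer_apply hc]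
      have hwβ := fockWt_pos β w
      rw [h1]
      calc _ ≤ ∫ z in Metric.closedBall (0 : Cn n) R,
            fockWt β w * (fockWt α z * ‖kerFun c (inner ℂ w z)‖) ∂(fockVol n) := by
            refine norm_integral_le_of_norm_le ((h w).1.const_mul _).integrableOn
              (Eventually.of_forall fun z => ?_)
            have hwα := fockWt_pos α z
            rw [norm_mul (θ z), norm_mul (fockWt α z : ℂ), norm_mul (fockWt β w : ℂ),
              Complex.norm_real, Complex.norm_real,
              Real.norm_of_nonneg hwα.le, Real.norm_of_nonneg hwβ.le]
            calc _ ≤ 1 * (fockWt α z * (fockWt β w * ‖kerFun c (inner ℂ w z)‖)) := by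
                  gcongr
                  exact hθ1 z
              _ = _ := by ring
        _ ≤ ∫ z, fockWt β w * (fockWt α z * ‖kerFun c (inner ℂ w z)‖) ∂(fockVol n) := by
            refine setIntegral_le_integral ((h w).1.const_mul _) (Eventually.of_forall fun z => ?_)
            have hwα := fockWt_pos α z
            positivity
        _ ≤ fockWt β w * (C * (fockWt β w)⁻¹) := by
            rw [integral_const_mul]
            gcongr
            exact (h w).2
        _ = C := by field_simp
    have h2 := L.le_opNorm B
    have h3 : 0 ≤ ∫ z in Metric.closedBall (0 : Cn n) R, ‖(fockWt α z : ℂ) * g z‖ ∂(fockVol n) :=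
      integral_nonneg fun z => norm_nonneg _
    rw [hLB, Complex.norm_real, Real.norm_of_nonneg h3] at h2
    refine h2.trans ?_
    rw [mul_comm]
    gcongr
  have hcover : AECover (fockVol n) atTop fun R : ℕ => Metric.closedBall (0 : Cn n) (R : ℝ) :=
    aecover_closedBall tendsto_natCast_atTop_atTop
  have hint : Integrable (fun z => (fockWt α z : ℂ) * g z) (fockVol n) := by
    refine hcover.integrable_of_integral_norm_bounded (C * ‖L‖) (fun R => ?_)
      (Eventually.of_forall fun R => hball R)
    exact (hw.mul hgc).continuousOn.integrableOn_compact (isCompact_closedBall 0 _)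
  refine ⟨hint, ?_⟩
  exact le_of_tendsto (hcover.integral_tendsto_of_countably_generated hint.norm)
    (Eventually.of_forall fun R => hball R)

end Duality

/-! ### The Fock spaces and extension of functionals to C₀. -/

section Spaces

variable {n : ℕ}

/-- Continuity upgrades the almost everywhere bound: the exceptional set is open and null, hence
empty. -/
theorem norm_le_toReal_eLpNorm_top {φ : Cn n → ℂ} (hφ : Continuous φ)
    (hm : MemLp φ ∞ (fockVol n)) (z : Cn n) : ‖φ z‖ ≤ (eLpNorm φ ∞ (fockVol n)).toReal := by
  have h1 : ∀ᵐ z ∂(fockVol n), ‖φ z‖ₑ ≤ eLpNorm φ ∞ (fockVol n) := by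
    rw [eLpNorm_exponent_top]
    exact ae_le_eLpNormEssSup
  have h2 : ∀ᵐ z ∂(fockVol n), ‖φ z‖ ≤ (eLpNorm φ ∞ (fockVol n)).toReal := by
    filter_upwards [h1] with z hz
    rw [← toReal_enorm]
    exact ENNReal.toReal_mono hm.2.ne hz
  have hopen : IsOpen {z | ¬ ‖φ z‖ ≤ (eLpNorm φ ∞ (fockVol n)).toReal} := by
    simp only [not_le]
    exact isOpen_lt continuous_const hφ.norm
  have h3 := (hopen.measure_eq_zero_iff (fockVol n)).1 h2
  by_contra hcon
  have : z ∈ {z | ¬ ‖φ z‖ ≤ (eLpNorm φ ∞ (fockVol n)).toReal} := hcon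
  rw [h3] at this
  exact this

theorem fockWeighted_top (β : ℝ) (f : Cn n → ℂ) :
    fockWeighted ∞ β f = fun z => (fockWt β z : ℂ) * f z := by
  funext z
  simp [fockWeighted, fockExponent, fockWt]

theorem fockWeighted_one (α : ℝ) (f : Cn n → ℂ) :
    fockWeighted 1 α f = fun z => (fockWt α z : ℂ) * f z := by
  funext z
  simp [fockWeighted, fockExponent, fockWt]

theorem FockSpace.inF1 {α : ℝ} (g : FockSpace n 1 α) : InF1 α g where
  differentiable := g.2.1
  integrable := by
    have h := g.2.2
    rw [memLp_one_iff_integrable] at h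
    rwa [← fockWeighted_one]

theorem FockSpace.norm_eq_integral {α : ℝ} (g : FockSpace n 1 α) :
    ‖g‖ = ∫ z, ‖(fockWt α z : ℂ) * g z‖ ∂(fockVol n) := by
  rw [FockSpace.norm_def, fockWeighted_one, eLpNorm_one_eq_lintegral_enorm,
    integral_norm_eq_lintegral_enorm g.inF1.integrable.aestronglyMeasurable]

/-- An entire function with finite norm, as an element of `F^1_α`. -/
def InF1.toFockSpace {α : ℝ} {g : Cn n → ℂ} (hg : InF1 α g) : FockSpace n 1 α :=
  ⟨g, hg.differentiable, by
    rw [memLp_one_iff_integrable, fockWeighted_one]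
    exact hg.integrable⟩

theorem FockSpace.fockWt_mul_norm_le {β : ℝ} (f : FockSpace n ∞ β) (z : Cn n) :
    fockWt β z * ‖f z‖ ≤ ‖f‖ := by
  have h := norm_le_toReal_eLpNorm_top (FockSpace.continuous_fockWeighted f) f.2.2 z
  rw [FockSpace.norm_def]
  refine le_trans (le_of_eq ?_) h
  rw [fockWeighted_top, norm_mul, Complex.norm_real, Real.norm_of_nonneg (fockWt_pos β z).le]

/-- `F^∞_β` embeds into `F^1_γ` for `γ = β + 2n + 1`. -/
theorem FockSpace.inF1_of_top {β : ℝ} (f : FockSpace n ∞ β) : InF1 (β + (2 * n + 1)) f ∧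
    ∫ z, ‖(fockWt (β + (2 * n + 1)) z : ℂ) * f z‖ ∂(fockVol n) ≤
      (∫ z : Cn n, (1 + ‖z‖) ^ (-(2 * n + 1 : ℝ)) ∂(fockVol n)) * ‖f‖ := by
  have hi := integrable_one_add_norm_rpow (n := n) (a := -(2 * n + 1 : ℝ)) (by linarith)
  have hle : ∀ z : Cn n, ‖(fockWt (β + (2 * n + 1)) z : ℂ) * f z‖ ≤
      (1 + ‖z‖) ^ (-(2 * n + 1 : ℝ)) * ‖f‖ := fun z => by
    rw [norm_mul, Complex.norm_real, Real.norm_of_nonneg (fockWt_pos _ z).le, fockWt_add,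
      mul_right_comm, mul_comm]
    exact mul_le_mul_of_nonneg_left (f.fockWt_mul_norm_le z) (by positivity)
  have hw := continuous_fockWt (n := n) (β + (2 * n + 1))
  have hf : Continuous f.1 := f.2.1.continuous
  have hint : Integrable (fun z => (fockWt (β + (2 * n + 1)) z : ℂ) * f z) (fockVol n) := by
    refine (hi.mul_const ‖f‖).mono' ?_ (Eventually.of_forall hle)
    exact ((Complex.continuous_ofReal.comp hw).mul hf).aestronglyMeasurable
  refine ⟨⟨f.2.1, hint⟩, ?_⟩
  rw [← integral_mul_const]
  exact integral_mono hint.norm (hi.mul_const _) hle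

/-- The weighted function `w_β f`, as an element of `C₀(ℂⁿ)`. -/
noncomputable def weightedZeroAtInfty {β : ℝ} (f : littleFock n β) : C₀(Cn n, ℂ) where
  toFun := fun z => (fockWt β z : ℂ) * f.1 z
  continuous_toFun := by
    have hw := continuous_fockWt (n := n) β
    have hf : Continuous f.1.1 := f.1.2.1.continuous
    exact (Complex.continuous_ofReal.comp hw).mul hf
  zero_at_infty' := by
    rw [tendsto_zero_iff_norm_tendsto_zero]
    refine Tendsto.congr (fun z => ?_) f.2
    rw [norm_mul, Complex.norm_real, Real.norm_of_nonneg (fockWt_pos β z).le, fockWt,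
      Real.rpow_neg (by positivity), div_eq_mul_inv]
    ring

theorem weightedZeroAtInfty_apply {β : ℝ} (f : littleFock n β) (z : Cn n) :
    weightedZeroAtInfty f z = (fockWt β z : ℂ) * f.1 z := rfl

theorem norm_weightedZeroAtInfty {β : ℝ} (f : littleFock n β) : ‖weightedZeroAtInfty f‖ = ‖f‖ := by
  refine le_antisymm ?_ ?_
  · refine ZeroAtInftyContinuousMap.norm_le_of_forall (norm_nonneg f.1) fun z => ?_
    rw [weightedZeroAtInfty_apply, norm_mul, Complex.norm_real,
      Real.norm_of_nonneg (fockWt_pos β z).le]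
    exact f.1.fockWt_mul_norm_le z
  · change ‖f.1‖ ≤ _
    rw [FockSpace.norm_def]
    refine ENNReal.toReal_le_of_le_ofReal (norm_nonneg _) ?_
    rw [eLpNorm_exponent_top, fockWeighted_top]
    exact eLpNormEssSup_le_of_ae_bound (Eventually.of_forall fun z =>
      (weightedZeroAtInfty f).norm_apply_le z)

/-- Multiplication by the weight, as an isometry of the little space into `C₀(ℂⁿ)`. -/
noncomputable def littleToZeroAtInfty (n : ℕ) (β : ℝ) : littleFock n β →ₗᵢ[ℂ] C₀(Cn n, ℂ) where
  toFun := weightedZeroAtInfty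
  map_add' f g := by
    ext z
    exact mul_add _ (f.1 z) (g.1 z)
  map_smul' c f := by
    ext z
    exact mul_left_comm _ c (f.1 z)
  norm_map' := norm_weightedZeroAtInfty

theorem littleToZeroAtInfty_apply {β : ℝ} (f : littleFock n β) (z : Cn n) :
    littleToZeroAtInfty n β f z = (fockWt β z : ℂ) * f.1 z := rfl

/-- The function `u ↦ ⟪z, u⟫^k` as an element of the little space. -/
noncomputable def littleMono (β : ℝ) (k : ℕ) (z : Cn n) : littleFock n β :=
  ⟨⟨fun u => (inner ℂ z u : ℂ) ^ k, by
      have hd : Differentiable ℂ fun u : Cn n => (inner ℂ z u : ℂ) ^ k :=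
        (innerSL ℂ z).differentiable.pow k
      refine ⟨hd, ?_⟩
      rw [fockWeighted_top]
      have hw := continuous_fockWt (n := n) β
      refine memLp_top_of_bound
        ((Complex.continuous_ofReal.comp hw).mul hd.continuous).aestronglyMeasurable
        ‖fockMono β (fun _ : Fin k => z)‖ (Eventually.of_forall fun u => ?_)
      refine le_trans (le_of_eq ?_)
        (ZeroAtInftyContinuousMap.norm_apply_le (fockMono β (fun _ : Fin k => z)) u)
      rw [fockMono_const_apply, norm_mul, norm_mul, norm_pow, norm_pow, norm_inner_symm]⟩, by
    have h := (fockMono β (fun _ : Fin k => z)).zero_at_infty'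
    rw [tendsto_zero_iff_norm_tendsto_zero] at h
    refine Tendsto.congr (fun u => ?_) h
    change ‖fockMono β (fun _ : Fin k => z) u‖ = ‖(inner ℂ z u : ℂ) ^ k‖ * _ / _
    rw [fockMono_const_apply, norm_mul, Complex.norm_real,
      Real.norm_of_nonneg (fockWt_pos β u).le, fockWt, Real.rpow_neg (by positivity),
      div_eq_mul_inv, norm_pow, norm_pow, norm_inner_symm]
    ring⟩

theorem littleMono_apply (β : ℝ) (k : ℕ) (z : Cn n) :
    ((littleMono β k z).1 : Cn n → ℂ) = fun u => (inner ℂ z u : ℂ) ^ k := rfl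

/-- The powers are holomorphic in u, the kernel terms in z, and conjugation interchanges the two.
This is why functionals are extended in conjugated form. -/
theorem star_littleToZeroAtInfty_littleMono (β : ℝ) (k : ℕ) (z : Cn n) :
    star (littleToZeroAtInfty n β (littleMono β k z)) = fockMono β (fun _ : Fin k => z) := by
  ext u
  rw [ZeroAtInftyContinuousMap.star_apply, littleToZeroAtInfty_apply, fockMono_const_apply,
    littleMono_apply, Complex.star_def, map_mul, map_pow, Complex.conj_ofReal, inner_conj_symm]

/-- Extension of functionals on the little space to `C₀(ℂⁿ)`, conjugated. -/
theorem exists_conj_extension {β : ℝ} (μ : StrongDual ℂ (littleFock n β)) :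
    ∃ L : C₀(Cn n, ℂ) →L[ℂ] ℂ, ‖L‖ ≤ ‖μ‖ ∧
      ∀ f, L (star (littleToZeroAtInfty n β f)) = conj (μ f) := by
  set J := littleToZeroAtInfty n β with hJ
  obtain ⟨Λ, hΛ, hΛn⟩ := exists_extension_norm_eq (LinearMap.range J.toLinearMap)
    (μ.comp (J.equivRange.symm.toContinuousLinearEquiv :
      LinearMap.range J.toLinearMap →L[ℂ] littleFock n β))
  have hn : ‖Λ‖ ≤ ‖μ‖ := by
    rw [hΛn]
    refine ContinuousLinearMap.opNorm_le_bound _ μ.opNorm_nonneg fun x => ?_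
    refine (μ.le_opNorm _).trans (le_of_eq ?_)
    congr 1
    exact J.equivRange.symm.norm_map x
  have hΛJ : ∀ f, Λ (J f) = μ f := fun f => by
    have h := hΛ (J.equivRange f)
    have h2 : ((J.equivRange f : LinearMap.range J.toLinearMap) : C₀(Cn n, ℂ)) = J f := rfl
    rw [h2] at h
    rw [h]
    change μ (J.equivRange.symm (J.equivRange f)) = μ f
    rw [LinearIsometryEquiv.symm_apply_apply]
  -- Conjugating both the argument and the value restores complex linearity.
  refine ⟨LinearMap.mkContinuous
    { toFun := fun φ => conj (Λ (star φ))
      map_add' := fun φ ψ => by rw [star_add, map_add, map_add]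
      map_smul' := fun c φ => by
        rw [star_smul, map_smul, smul_eq_mul, map_mul, Complex.star_def, Complex.conj_conj]
        rfl } ‖μ‖ fun φ => ?_, ?_, fun f => ?_⟩
  · change ‖conj (Λ (star φ))‖ ≤ _
    rw [RCLike.norm_conj]
    refine (Λ.le_opNorm _).trans ?_
    have hstar : ‖star φ‖ ≤ ‖φ‖ :=
      ZeroAtInftyContinuousMap.norm_le_of_forall (norm_nonneg _) fun x => by
        rw [ZeroAtInftyContinuousMap.star_apply, Complex.star_def, RCLike.norm_conj]
        exact φ.norm_apply_le x
    exact mul_le_mul hn hstar (norm_nonneg _) μ.opNorm_nonneg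
  · exact LinearMap.mkContinuous_norm_le _ μ.opNorm_nonneg _
  · change conj (Λ (star (star (J f)))) = _
    rw [star_star, hΛJ]

end Spaces

/-! ### Taylor estimates controlled by the F^1_γ norm. -/

section TaylorBounds

variable {n : ℕ}

/-- The norm of `F^1_γ` of a function. -/
noncomputable def l1Norm (γ : ℝ) (f : Cn n → ℂ) : ℝ :=
  ∫ z, ‖(fockWt γ z : ℂ) * f z‖ ∂(fockVol n)

theorem l1Norm_nonneg (γ : ℝ) (f : Cn n → ℂ) : 0 ≤ l1Norm γ f :=
  integral_nonneg fun _ => norm_nonneg _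

theorem InF1.norm_integral_mul_le {γ : ℝ} {f : Cn n → ℂ} (hf : InF1 γ f) {φ : Cn n → ℂ} {K : ℝ}
    (hK : ∀ u, fockWt (-γ) u * ‖φ u‖ ≤ K) :
    ‖∫ u, f u * φ u * (Real.exp (-‖u‖ ^ 2) : ℝ) ∂(fockVol n)‖ ≤ K * l1Norm γ f := by
  rw [l1Norm, ← integral_const_mul]
  refine norm_integral_le_of_norm_le (hf.integrable.norm.const_mul K)
    (Eventually.of_forall fun u => ?_)
  have h1 := fockWt_pos γ u
  have h2 := fockWt_pos (-γ) u
  rw [← fockWt_mul_neg γ u, norm_mul, norm_mul, norm_mul, Complex.norm_real, Complex.norm_real,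
    Real.norm_of_nonneg (by positivity), Real.norm_of_nonneg h1.le]
  calc ‖f u‖ * ‖φ u‖ * (fockWt γ u * fockWt (-γ) u)
      = (fockWt (-γ) u * ‖φ u‖) * (fockWt γ u * ‖f u‖) := by ring
    _ ≤ _ := by
        gcongr
        exact hK u

theorem fockWt_mul_norm_inner_pow_le {β C : ℝ}
    (hC : ∀ z : Cn n, fockWt β z * Real.exp (1 * ‖z‖) ≤ C) (k : ℕ) (u z : Cn n) :
    fockWt β u * ‖(inner ℂ u z : ℂ) ^ k‖ ≤ C * k.factorial * ‖z‖ ^ k := by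
  have h := fockWt_mul_norm_prod_le one_pos hC u (fun _ : Fin k => z)
  rw [norm_mul, Complex.norm_real, Real.norm_of_nonneg (fockWt_pos β u).le] at h
  simpa using h

theorem exists_norm_homogPart_le (n : ℕ) (γ : ℝ) : ∃ C : ℝ, 0 < C ∧ ∀ f : Cn n → ℂ, InF1 γ f →
    ∀ (k : ℕ) (z : Cn n), ‖homogPart k f z‖ ≤ C * l1Norm γ f * ‖z‖ ^ k := by
  obtain ⟨C, hC, h⟩ := exists_fockWt_mul_exp_le n (-γ) 1
  refine ⟨C, hC, fun f hf k z => ?_⟩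
  have hk : (0 : ℝ) < k.factorial := by positivity
  rw [hf.homogPart_eq, norm_mul, norm_inv, Complex.norm_natCast]
  calc _ ≤ (k.factorial : ℝ)⁻¹ * ((C * k.factorial * ‖z‖ ^ k) * l1Norm γ f) := by
        gcongr
        exact hf.norm_integral_mul_le (φ := fun u => (inner ℂ u z : ℂ) ^ k)
          fun u => fockWt_mul_norm_inner_pow_le h k u z
    _ = _ := by
        field_simp

/-- By the reproducing formula the remainder is f integrated against e^x - ∑_{k<p} x^k/k! at x =
⟪u,z⟫, which is at most |x|^p e^{|x|}. For |z| ≤ 1 the exponential is at most e^{|u|}; a second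
e^{|u|} absorbs |u|^p. -/
theorem exists_norm_sub_sum_homogPart_le (n : ℕ) (γ : ℝ) (p : ℕ) : ∃ C : ℝ, 0 < C ∧
    ∀ f : Cn n → ℂ, InF1 γ f → ∀ z : Cn n, ‖z‖ ≤ 1 →
      ‖f z - ∑ k ∈ Finset.range p, homogPart k f z‖ ≤ C * l1Norm γ f * ‖z‖ ^ p := by
  obtain ⟨C, hC, h⟩ := exists_fockWt_mul_exp_le n (-γ) 2
  obtain ⟨C₁, hC₁, h₁⟩ := exists_fockWt_mul_exp_le n (-γ) 1
  refine ⟨C * p.factorial, by positivity, fun f hf z hz => ?_⟩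
  set S : Cn n → ℂ := fun u =>
    ∑ k ∈ Finset.range p, ((k.factorial : ℂ))⁻¹ * (inner ℂ u z : ℂ) ^ k with hS
  obtain ⟨C₂, hC₂⟩ := InF1.exists_bound_exp_inner (-γ) z
  have hie := hf.integrable_mul (φ := fun u => Complex.exp (inner ℂ u z)) (by fun_prop) hC₂
  have hik : ∀ k : ℕ, Integrable (fun u => f u * (inner ℂ u z : ℂ) ^ k *
      (Real.exp (-‖u‖ ^ 2) : ℝ)) (fockVol n) := fun k =>
    hf.integrable_mul (φ := fun u => (inner ℂ u z : ℂ) ^ k) (by fun_prop)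
      fun u => fockWt_mul_norm_inner_pow_le h₁ k u z
  have heq : f z - ∑ k ∈ Finset.range p, homogPart k f z =
      ∫ u, f u * (Complex.exp (inner ℂ u z) - S u) * (Real.exp (-‖u‖ ^ 2) : ℝ) ∂(fockVol n) := by
    have h1 : ∀ u, f u * (Complex.exp (inner ℂ u z) - S u) * (Real.exp (-‖u‖ ^ 2) : ℝ) =
        f u * Complex.exp (inner ℂ u z) * (Real.exp (-‖u‖ ^ 2) : ℝ) -
        ∑ k ∈ Finset.range p, ((k.factorial : ℂ))⁻¹ * (f u * (inner ℂ u z : ℂ) ^ k *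
          (Real.exp (-‖u‖ ^ 2) : ℝ)) := fun u => by
      simp only [hS, mul_sub, sub_mul, Finset.mul_sum, Finset.sum_mul]
      congr 1
      exact Finset.sum_congr rfl fun k _ => by ring
    simp only [h1]
    rw [integral_sub hie (integrable_finsetSum _ fun k _ => (hik k).const_mul _),
      integral_finsetSum _ fun k _ => (hik k).const_mul _, hf.integral_mul_exp_inner]
    congr 1
    refine Finset.sum_congr rfl fun k _ => ?_
    rw [integral_const_mul, hf.homogPart_eq]
  rw [heq]
  calc _ ≤ (C * p.factorial * ‖z‖ ^ p) * l1Norm γ f := by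
        refine hf.norm_integral_mul_le fun u => ?_
        have h2 := Complex.norm_exp_sub_sum_le_norm_mul_exp (inner ℂ u z) p
        have h3 : S u = ∑ m ∈ Finset.range p, (inner ℂ u z : ℂ) ^ m / (m.factorial : ℂ) :=
          Finset.sum_congr rfl fun k _ => by rw [div_eq_inv_mul]
        have h4 : ‖(inner ℂ u z : ℂ)‖ ≤ ‖u‖ * ‖z‖ := norm_inner_le_norm u z
        have h5 : ‖u‖ * ‖z‖ ≤ ‖u‖ := mul_le_of_le_one_right (norm_nonneg u) hz
        have h6 := pow_le_factorial_mul_exp one_pos (norm_nonneg u) p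
        have h7 := fockWt_pos (-γ) u
        rw [h3]
        calc fockWt (-γ) u * ‖Complex.exp (inner ℂ u z) -
              ∑ m ∈ Finset.range p, (inner ℂ u z : ℂ) ^ m / (m.factorial : ℂ)‖
            ≤ fockWt (-γ) u * ((‖u‖ * ‖z‖) ^ p * Real.exp ‖u‖) := by
              refine mul_le_mul_of_nonneg_left (h2.trans ?_) h7.le
              gcongr
              exact h4.trans h5
          _ ≤ fockWt (-γ) u * (((p.factorial * (1 : ℝ)⁻¹ ^ p * Real.exp (1 * ‖u‖)) * ‖z‖ ^ p) *
              Real.exp ‖u‖) := by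
              rw [mul_pow]
              gcongr
          _ = (fockWt (-γ) u * Real.exp (2 * ‖u‖)) * p.factorial * ‖z‖ ^ p := by
              rw [two_mul, Real.exp_add]
              simp only [inv_one, one_pow, one_mul, mul_one]
              ring
          _ ≤ _ := by
              gcongr
              exact h u
    _ = _ := by ring

theorem exists_norm_taylorHead_le (n : ℕ) (γ s : ℝ) : ∃ C : ℝ, 0 < C ∧ ∀ f : Cn n → ℂ,
    InF1 γ f → ∀ z : Cn n,
      ‖taylorHead s f z‖ ≤ C * l1Norm γ f * (1 + ‖z‖) ^ (⌊|s|⌋₊ + 1) := by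
  obtain ⟨C, hC, h⟩ := exists_norm_homogPart_le n γ
  refine ⟨(⌊|s|⌋₊ + 1 : ℕ) * C, by positivity, fun f hf z => ?_⟩
  have h0 := l1Norm_nonneg γ f
  have hz := norm_nonneg z
  rw [taylorHead]
  calc _ ≤ ∑ k ∈ Finset.range (⌊|s|⌋₊ + 1), C * l1Norm γ f * (1 + ‖z‖) ^ (⌊|s|⌋₊ + 1) := by
        refine norm_sum_le_of_le _ fun k hk => (h f hf k z).trans ?_
        have h1 : ‖z‖ ^ k ≤ (1 + ‖z‖) ^ (⌊|s|⌋₊ + 1) :=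
          (pow_le_pow_left₀ hz (by linarith) k).trans
            (pow_le_pow_right₀ (by linarith) (Finset.mem_range.1 hk).le)
        gcongr
    _ = _ := by
        rw [Finset.sum_const, Finset.card_range, nsmul_eq_mul]
        ring

/-- The head is a polynomial of bounded degree, so its weight exponent δ is unrelated to the γ that
measures f. -/
theorem exists_taylorHead_bounds (n : ℕ) (γ s δ : ℝ) : ∃ C : ℝ, 0 < C ∧ ∀ f : Cn n → ℂ,
    InF1 γ f → InF1 δ (taylorHead s f) ∧ l1Norm δ (taylorHead s f) ≤ C * l1Norm γ f ∧
      ∀ z, fockWt δ z * ‖taylorHead s f z‖ ≤ C * l1Norm γ f := by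
  obtain ⟨C, hC, h⟩ := exists_norm_taylorHead_le n γ s
  set M := ⌊|s|⌋₊ + 1 with hM
  have hi : Integrable (fockWt (δ - M) : Cn n → ℝ) (fockVol n) := by
    simpa using integrable_fockWt_mul_exp (n := n) (δ - M) 0
  obtain ⟨D, hD, hDle⟩ := exists_fockWt_mul_exp_le n (δ - M) 0
  have hI : 0 ≤ ∫ z : Cn n, fockWt (δ - M) z ∂(fockVol n) :=
    integral_nonneg fun z => (fockWt_pos _ z).le
  refine ⟨C * (D + ∫ z : Cn n, fockWt (δ - M) z ∂(fockVol n)), by positivity, fun f hf => ?_⟩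
  have h0 := l1Norm_nonneg γ f
  have hle : ∀ z, fockWt δ z * ‖taylorHead s f z‖ ≤ (C * l1Norm γ f) * fockWt (δ - M) z :=
    fun z => by
    have h1 : fockWt (δ - M) z = fockWt δ z * (1 + ‖z‖) ^ M := by
      rw [sub_eq_add_neg, fockWt_add, neg_neg, Real.rpow_natCast]
    have h2 := fockWt_pos δ z
    rw [h1]
    calc _ ≤ fockWt δ z * (C * l1Norm γ f * (1 + ‖z‖) ^ M) := by
          gcongr
          exact h f hf z
      _ = _ := by ring
  have hle2 : ∀ z, ‖(fockWt δ z : ℂ) * taylorHead s f z‖ ≤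
      (C * l1Norm γ f) * fockWt (δ - M) z := fun z => by
    rw [norm_mul, Complex.norm_real, Real.norm_of_nonneg (fockWt_pos δ z).le]
    exact hle z
  have hint : Integrable (fun z => (fockWt δ z : ℂ) * taylorHead s f z) (fockVol n) := by
    refine (hi.const_mul _).mono' ?_ (Eventually.of_forall hle2)
    exact ((Complex.continuous_ofReal.comp (continuous_fockWt δ)).mul
      (contDiff_taylorHead s f).continuous).aestronglyMeasurable
  refine ⟨⟨(contDiff_taylorHead s f).differentiable (by simp), hint⟩, ?_, fun z => ?_⟩
  · calc l1Norm δ (taylorHead s f) ≤ ∫ z, (C * l1Norm γ f) * fockWt (δ - M) z ∂(fockVol n) :=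
          integral_mono hint.norm (hi.const_mul _) hle2
      _ = (C * l1Norm γ f) * ∫ z, fockWt (δ - M) z ∂(fockVol n) := integral_const_mul _ _
      _ ≤ _ := by nlinarith [mul_nonneg (mul_nonneg hC.le h0) hD.le]
  · refine (hle z).trans ?_
    have h1 := hDle z
    simp only [zero_mul, Real.exp_zero, mul_one] at h1
    nlinarith [mul_nonneg (mul_nonneg hC.le h0) hI,
      mul_le_mul_of_nonneg_left h1 (mul_nonneg hC.le h0)]

theorem InF1.sub {γ : ℝ} {f g : Cn n → ℂ} (hf : InF1 γ f) (hg : InF1 γ g) :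
    InF1 γ (fun z => f z - g z) ∧ l1Norm γ (fun z => f z - g z) ≤ l1Norm γ f + l1Norm γ g := by
  have hi : Integrable (fun z => (fockWt γ z : ℂ) * (f z - g z)) (fockVol n) := by
    simp only [mul_sub]
    exact hf.integrable.sub hg.integrable
  refine ⟨⟨hf.differentiable.sub hg.differentiable, hi⟩, ?_⟩
  rw [l1Norm, l1Norm, l1Norm, ← integral_add hf.integrable.norm hg.integrable.norm]
  refine integral_mono hi.norm (hf.integrable.norm.add hg.integrable.norm) fun z => ?_
  simp only [mul_sub]
  exact norm_sub_le _ _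

end TaylorBounds

/-! ### Absolute convergence of (·,·)_σ. -/

section PairingBounds

variable {n : ℕ}

theorem rpow_neg_le_of_one_le {r : ℝ} (hr : 1 ≤ r) (σ : ℝ) :
    r ^ (-σ) ≤ 2 ^ |σ| * (1 + r) ^ (-σ) := by
  rcases le_total 0 σ with hσ | hσ
  · rw [abs_of_nonneg hσ, Real.rpow_neg (by positivity), Real.rpow_neg (by positivity),
      ← div_eq_mul_inv, le_div_iff₀ (by positivity), ← div_eq_inv_mul,
      div_le_iff₀ (by positivity), ← Real.mul_rpow (by norm_num) (by positivity)]
    exact Real.rpow_le_rpow (by positivity) (by linarith) hσ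
  · have h1 : (1 : ℝ) ≤ 2 ^ |σ| := Real.one_le_rpow (by norm_num) (abs_nonneg _)
    have h2 : r ^ (-σ) ≤ (1 + r) ^ (-σ) :=
      Real.rpow_le_rpow (by positivity) (by linarith) (by linarith)
    have h3 : 0 ≤ (1 + r) ^ (-σ) := by positivity
    nlinarith

theorem integrableOn_norm_pow_mul_rpow (hn : 0 < n) {σ : ℝ} {m : ℕ} (hm : σ < 2 * n + m) :
    IntegrableOn (fun z : Cn n => ‖z‖ ^ m * ‖z‖ ^ (-σ)) (Metric.ball 0 1) (fockVol n) := by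
  have : Nonempty (Fin n) := ⟨⟨0, hn⟩⟩
  rw [integrableOn_fun_norm_addHaar (fockVol n) (f := fun r : ℝ => r ^ m * r ^ (-σ)),
    finrank_real_Cn]
  have h : IntegrableOn (fun y : ℝ => y ^ ((2 * n - 1 : ℝ) + m - σ)) (Set.Ioo 0 1) := by
    have h2 : IntervalIntegrable (fun y : ℝ => y ^ ((2 * n - 1 : ℝ) + m - σ)) volume 0 1 :=
      intervalIntegral.intervalIntegrable_rpow' (by linarith)
    rw [intervalIntegrable_iff_integrableOn_Ioc_of_le zero_le_one] at h2
    exact h2.mono_set Set.Ioo_subset_Ioc_self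
  refine h.congr_fun (fun y hy => ?_) measurableSet_Ioo
  have hc : (2 * n - 1 : ℝ) = ((2 * n - 1 : ℕ) : ℝ) := by
    rw [Nat.cast_sub (by omega)]; push_cast; ring
  simp only [smul_eq_mul]
  rw [hc, sub_eq_add_neg, Real.rpow_add hy.1, Real.rpow_add hy.1, Real.rpow_natCast,
    Real.rpow_natCast]
  ring

/-- Boundedness of `(·,·)_σ` for a pair of functions whose product vanishes at the origin to
sufficiently high order. -/
theorem exists_rawPairing_bound (hn : 0 < n) (α β : ℝ) {m : ℕ} (hm : α + β < 2 * n + m) :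
    ∃ C : ℝ, 0 < C ∧ ∀ (F G : Cn n → ℂ) (A D : ℝ), Continuous F → InF1 α G → 0 ≤ A → 0 ≤ D →
      (∀ z, fockWt β z * ‖F z‖ ≤ A) → (∀ z, ‖z‖ ≤ 1 → ‖F z‖ * ‖G z‖ ≤ D * ‖z‖ ^ m) →
      Integrable (rawIntegrand (α + β) F G) (fockVol n) ∧
      ‖rawPairing (α + β) F G‖ ≤ C * (A * l1Norm α G + D) := by
  set σ := α + β with hσ
  have hloc := integrableOn_norm_pow_mul_rpow hn hm
  rw [← integrable_indicator_iff measurableSet_ball] at hloc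
  set H : Cn n → ℝ := (Metric.ball 0 1).indicator fun z => ‖z‖ ^ m * ‖z‖ ^ (-σ) with hH
  have hH0 : ∀ z, 0 ≤ H z := fun z => Set.indicator_nonneg (fun z _ => by positivity) z
  have hI0 : 0 ≤ ∫ z, H z ∂(fockVol n) := integral_nonneg hH0
  refine ⟨2 ^ |σ| + ∫ z, H z ∂(fockVol n), by positivity,
    fun F G A D hF hG hA hD hFA hFG => ?_⟩
  have hle : ∀ z, ‖rawIntegrand σ F G z‖ ≤
      2 ^ |σ| * A * ‖(fockWt α z : ℂ) * G z‖ + D * H z := fun z => by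
    have hwα := fockWt_pos α z
    have hwβ := fockWt_pos β z
    rw [rawIntegrand, norm_mul, norm_mul, RCLike.norm_conj, Complex.norm_real,
      Real.norm_of_nonneg (by positivity), norm_mul, Complex.norm_real,
      Real.norm_of_nonneg hwα.le]
    -- Near the origin the vanishing order pays for |z|^{-σ}; elsewhere |z| and 1 + |z| are
    -- comparable and the two weights absorb the density.
    rcases lt_or_ge ‖z‖ 1 with hz | hz
    · have h1 : H z = ‖z‖ ^ m * ‖z‖ ^ (-σ) := by
        rw [hH, Set.indicator_of_mem (by simpa using hz)]
      rw [h1]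
      have h2 := hFG z hz.le
      have h3 : Real.exp (-‖z‖ ^ 2) ≤ 1 := Real.exp_le_one_iff.2 (by nlinarith [norm_nonneg z])
      have h4 : 0 ≤ 2 ^ |σ| * A * (fockWt α z * ‖G z‖) := by positivity
      have h5 : 0 ≤ ‖z‖ ^ (-σ) := by positivity
      calc ‖F z‖ * ‖G z‖ * (Real.exp (-‖z‖ ^ 2) * ‖z‖ ^ (-σ))
          ≤ (D * ‖z‖ ^ m) * (1 * ‖z‖ ^ (-σ)) := by gcongr
        _ ≤ _ := by linarith
    · have h1 := rpow_neg_le_of_one_le hz σ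
      have h2 : fockWt α z * fockWt β z = Real.exp (-‖z‖ ^ 2) * (1 + ‖z‖) ^ (-σ) := by
        unfold fockWt
        rw [mul_mul_mul_comm, ← Real.exp_add, ← Real.rpow_add (by positivity), hσ]
        congr 2 <;> ring
      have h3 : 0 ≤ D * H z := mul_nonneg hD (hH0 z)
      calc ‖F z‖ * ‖G z‖ * (Real.exp (-‖z‖ ^ 2) * ‖z‖ ^ (-σ))
          ≤ ‖F z‖ * ‖G z‖ * (Real.exp (-‖z‖ ^ 2) * (2 ^ |σ| * (1 + ‖z‖) ^ (-σ))) := by gcongr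
        _ = 2 ^ |σ| * (fockWt β z * ‖F z‖) * (fockWt α z * ‖G z‖) := by
            rw [mul_left_comm (Real.exp _), ← h2]; ring
        _ ≤ 2 ^ |σ| * A * (fockWt α z * ‖G z‖) := by
            gcongr
            exact hFA z
        _ ≤ _ := by linarith
  have hdom : Integrable (fun z => 2 ^ |σ| * A * ‖(fockWt α z : ℂ) * G z‖ + D * H z)
      (fockVol n) := (hG.integrable.norm.const_mul _).add (hloc.const_mul _)
  have hm : Measurable (rawIntegrand σ F G) := by
    have hGc := hG.continuous
    unfold rawIntegrand
    refine Measurable.mul (Continuous.measurable ?_) (Complex.measurable_ofReal.comp ?_)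
    · exact hF.mul (Complex.continuous_conj.comp hGc)
    · exact (Continuous.measurable (by fun_prop)).mul (measurable_norm.pow_const _)
  refine ⟨hdom.mono' hm.aestronglyMeasurable (Eventually.of_forall hle), ?_⟩
  have h0 := l1Norm_nonneg α G
  have h1 : 0 ≤ A * l1Norm α G := mul_nonneg hA h0
  have h2 : (0 : ℝ) ≤ 2 ^ |σ| := by positivity
  calc ‖rawPairing σ F G‖
      ≤ ∫ z, (2 ^ |σ| * A * ‖(fockWt α z : ℂ) * G z‖ + D * H z) ∂(fockVol n) :=
        norm_integral_le_of_norm_le hdom (Eventually.of_forall hle)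
    _ = 2 ^ |σ| * A * l1Norm α G + D * ∫ z, H z ∂(fockVol n) := by
        rw [integral_add (hG.integrable.norm.const_mul _) (hloc.const_mul _), integral_const_mul,
          integral_const_mul, l1Norm]
    _ ≤ _ := by nlinarith [mul_nonneg h1 hI0, mul_nonneg hD h2]

end PairingBounds

/-! ### Boundedness and sesquilinearity of the pairing. -/

section FockPairing

variable {n : ℕ}

theorem norm_le_two_mul_of_fockWt_zero {x B : ℝ} {z : Cn n} (hz : ‖z‖ ≤ 1) (hx : 0 ≤ x)
    (h : fockWt 0 z * x ≤ B) : x ≤ 2 * B := by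
  have h1 : (1 / 2 : ℝ) ≤ fockWt 0 z := by
    have h2 : fockWt 0 z = Real.exp (-‖z‖ ^ 2 / 2) := by simp [fockWt]
    rw [h2]
    have h3 := Real.add_one_le_exp (-‖z‖ ^ 2 / 2)
    nlinarith [norm_nonneg z]
  nlinarith

theorem FockSpace.exists_l1Norm_le_of_top (n : ℕ) (β : ℝ) : ∃ K : ℝ, 0 < K ∧
    ∀ f : FockSpace n ∞ β, l1Norm (β + (2 * n + 1)) f ≤ K * ‖f‖ := by
  have h0 : 0 ≤ ∫ z : Cn n, (1 + ‖z‖) ^ (-(2 * n + 1 : ℝ)) ∂(fockVol n) :=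
    integral_nonneg fun z => by positivity
  refine ⟨_, add_pos_of_nonneg_of_pos h0 one_pos, fun f => f.inF1_of_top.2.trans ?_⟩
  exact mul_le_mul_of_nonneg_right (by linarith) (norm_nonneg f)

theorem exists_fockPairing_bound_of_lt (hn : 0 < n) {α β : ℝ} (hσ : α + β < 2 * n) :
    ∃ C : ℝ, 0 < C ∧ ∀ (f : FockSpace n ∞ β) (g : FockSpace n 1 α),
      Integrable (rawIntegrand (α + β) f g) (fockVol n) ∧
      ‖rawPairing (α + β) f g‖ ≤ C * (‖f‖ * ‖g‖) := by
  obtain ⟨C, hC, h⟩ := exists_rawPairing_bound hn α β (m := 0) (by simpa using hσ)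
  obtain ⟨K, hK, hK'⟩ := FockSpace.exists_l1Norm_le_of_top n β
  -- With p = 0 the Taylor remainder is the function itself, so this bounds |f| on the unit ball.
  obtain ⟨a, ha, ha'⟩ := exists_norm_sub_sum_homogPart_le n (β + (2 * n + 1)) 0
  obtain ⟨b, hb, hb'⟩ := exists_norm_sub_sum_homogPart_le n α 0
  refine ⟨C * (1 + a * K * b), by positivity, fun f g => ?_⟩
  have hg : l1Norm α g = ‖g‖ := g.norm_eq_integral.symm
  obtain ⟨h1, h2⟩ := h f g ‖f‖ ((a * (K * ‖f‖)) * (b * ‖g‖)) f.2.1.continuous g.inF1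
    (norm_nonneg f) (by positivity) f.fockWt_mul_norm_le fun z hz => by
      have h3 := ha' f f.inF1_of_top.1 z hz
      have h4 := hb' g g.inF1 z hz
      simp only [Finset.range_zero, Finset.sum_empty, sub_zero, pow_zero, mul_one] at h3 h4 ⊢
      rw [hg] at h4
      exact mul_le_mul (h3.trans (mul_le_mul_of_nonneg_left (hK' f) ha.le)) h4 (norm_nonneg _)
        (by positivity)
  refine ⟨h1, h2.trans (le_of_eq ?_)⟩
  rw [hg]
  ring

theorem exists_rawPairing_taylorHead_bound (hn : 0 < n) (α β s : ℝ) :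
    ∃ C : ℝ, 0 < C ∧ ∀ (f : FockSpace n ∞ β) (g : FockSpace n 1 α),
      Integrable (rawIntegrand 0 (taylorHead s f) (taylorHead s g)) (fockVol n) ∧
      ‖rawPairing 0 (taylorHead s f) (taylorHead s g)‖ ≤ C * (‖f‖ * ‖g‖) := by
  obtain ⟨C, hC, h⟩ := exists_rawPairing_bound hn 0 0 (m := 0) (by
    have : (0 : ℝ) < n := by exact_mod_cast hn
    simpa using this)
  rw [add_zero] at h
  obtain ⟨K, hK, hK'⟩ := FockSpace.exists_l1Norm_le_of_top n β
  obtain ⟨a, ha, ha'⟩ := exists_taylorHead_bounds n (β + (2 * n + 1)) s 0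
  obtain ⟨b, hb, hb'⟩ := exists_taylorHead_bounds n α s 0
  refine ⟨C * (a * K * b + 4 * (a * K * b)), by positivity, fun f g => ?_⟩
  have hg : l1Norm α g = ‖g‖ := g.norm_eq_integral.symm
  obtain ⟨hf1, hf2, hf3⟩ := ha' f f.inF1_of_top.1
  obtain ⟨hg1, hg2, hg3⟩ := hb' g g.inF1
  rw [hg] at hg2 hg3
  have hf4 : ∀ z, fockWt 0 z * ‖taylorHead s f z‖ ≤ a * (K * ‖f‖) := fun z =>
    (hf3 z).trans (mul_le_mul_of_nonneg_left (hK' f) ha.le)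
  obtain ⟨h1, h2⟩ := h (taylorHead s f) (taylorHead s g) (a * (K * ‖f‖))
    ((2 * (a * (K * ‖f‖))) * (2 * (b * ‖g‖))) hf1.continuous hg1 (by positivity) (by positivity)
    hf4 fun z hz => by
      rw [pow_zero, mul_one]
      exact mul_le_mul (norm_le_two_mul_of_fockWt_zero hz (norm_nonneg _) (hf4 z))
        (norm_le_two_mul_of_fockWt_zero hz (norm_nonneg _) (hg3 z)) (norm_nonneg _)
        (by positivity)
  refine ⟨h1, h2.trans ?_⟩
  calc C * (a * (K * ‖f‖) * l1Norm 0 (taylorHead s g) + 2 * (a * (K * ‖f‖)) * (2 * (b * ‖g‖)))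
      ≤ C * (a * (K * ‖f‖) * (b * ‖g‖) + 2 * (a * (K * ‖f‖)) * (2 * (b * ‖g‖))) := by gcongr
    _ = _ := by ring

theorem exists_rawPairing_taylorTail_bound (hn : 0 < n) (α β : ℝ) :
    ∃ C : ℝ, 0 < C ∧ ∀ (f : FockSpace n ∞ β) (g : FockSpace n 1 α),
      Integrable (rawIntegrand (α + β) (taylorTail ((α + β) / 2) f)
        (taylorTail ((α + β) / 2) g)) (fockVol n) ∧
      ‖rawPairing (α + β) (taylorTail ((α + β) / 2) f) (taylorTail ((α + β) / 2) g)‖ ≤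
        C * (‖f‖ * ‖g‖) := by
  set s := (α + β) / 2 with hs
  set N := ⌊|s|⌋₊ + 1 with hN
  -- Each of the two tails vanishes to order N, and N > |σ/2| gives σ < 2N.
  obtain ⟨C, hC, h⟩ := exists_rawPairing_bound hn α β (m := 2 * N) (by
    have h1 : |s| < (N : ℝ) := by
      rw [hN]
      push_cast
      exact Nat.lt_floor_add_one _
    have h2 := le_abs_self s
    have h3 : (0 : ℝ) ≤ n := by positivity
    push_cast
    linarith)
  obtain ⟨K, hK, hK'⟩ := FockSpace.exists_l1Norm_le_of_top n β
  obtain ⟨a, ha, ha'⟩ := exists_taylorHead_bounds n (β + (2 * n + 1)) s β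
  obtain ⟨b, hb, hb'⟩ := exists_taylorHead_bounds n α s α
  obtain ⟨c, hc, hc'⟩ := exists_norm_sub_sum_homogPart_le n (β + (2 * n + 1)) N
  obtain ⟨d, hd, hd'⟩ := exists_norm_sub_sum_homogPart_le n α N
  refine ⟨C * ((1 + a * K) * (1 + b) + c * K * d), by positivity, fun f g => ?_⟩
  have hg : l1Norm α g = ‖g‖ := g.norm_eq_integral.symm
  obtain ⟨hf1, hf2, hf3⟩ := ha' f f.inF1_of_top.1
  obtain ⟨hg1, hg2, hg3⟩ := hb' g g.inF1
  obtain ⟨ht1, ht2⟩ := g.inF1.sub hg1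
  rw [hg] at hg2 ht2
  have hfc : Continuous f.1 := f.2.1.continuous
  obtain ⟨h1, h2⟩ := h (taylorTail s f) (taylorTail s g) ((1 + a * K) * ‖f‖)
    ((c * (K * ‖f‖)) * (d * ‖g‖)) (hfc.sub hf1.continuous) ht1 (by positivity) (by positivity)
    (fun z => by
      have hw := fockWt_pos β z
      have h1 := f.fockWt_mul_norm_le z
      have h2 := (hf3 z).trans (mul_le_mul_of_nonneg_left (hK' f) ha.le)
      calc fockWt β z * ‖f z - taylorHead s f z‖
          ≤ fockWt β z * (‖f z‖ + ‖taylorHead s f z‖) := by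
            gcongr
            exact norm_sub_le _ _
        _ ≤ _ := by linarith)
    fun z hz => by
      have h3 := hc' f f.inF1_of_top.1 z hz
      have h4 := hd' g g.inF1 z hz
      rw [hg] at h4
      have h5 : ‖taylorTail s f z‖ ≤ c * (K * ‖f‖) * ‖z‖ ^ N :=
        h3.trans (by gcongr; exact hK' f)
      calc ‖taylorTail s f z‖ * ‖taylorTail s g z‖
          ≤ (c * (K * ‖f‖) * ‖z‖ ^ N) * (d * ‖g‖ * ‖z‖ ^ N) :=
            mul_le_mul h5 h4 (norm_nonneg _) (by positivity)
        _ = _ := by ring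
  refine ⟨h1, h2.trans ?_⟩
  have h6 : l1Norm α (taylorTail s g) ≤ ‖g‖ + b * ‖g‖ := ht2.trans (by linarith)
  calc C * ((1 + a * K) * ‖f‖ * l1Norm α (taylorTail s g) + (c * (K * ‖f‖)) * (d * ‖g‖))
      ≤ C * ((1 + a * K) * ‖f‖ * (‖g‖ + b * ‖g‖) + (c * (K * ‖f‖)) * (d * ‖g‖)) := by gcongr
    _ = _ := by ring

/-- The pairing converges, and is bounded, on `F^∞_β × F^1_α`. -/
theorem exists_fockPairing_bound (hn : 0 < n) (α β : ℝ) :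
    ∃ C : ℝ, 0 < C ∧ ∀ (f : FockSpace n ∞ β) (g : FockSpace n 1 α),
      FockPairingConverges (α + β) f g ∧ ‖fockPairing (α + β) f g‖ ≤ C * (‖f‖ * ‖g‖) := by
  unfold FockPairingConverges fockPairing
  by_cases hσ : α + β < 2 * n
  · simp only [if_pos hσ]
    exact exists_fockPairing_bound_of_lt hn hσ
  · simp only [if_neg hσ]
    obtain ⟨C₁, hC₁, h₁⟩ := exists_rawPairing_taylorHead_bound hn α β ((α + β) / 2)
    obtain ⟨C₂, hC₂, h₂⟩ := exists_rawPairing_taylorTail_bound hn α β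
    refine ⟨C₁ + C₂, by positivity, fun f g => ⟨⟨(h₁ f g).1, (h₂ f g).1⟩, ?_⟩⟩
    rw [add_mul]
    exact (norm_add_le _ _).trans (add_le_add (h₁ f g).2 (h₂ f g).2)

theorem rawIntegrand_add_left (σ : ℝ) (f₁ f₂ g : Cn n → ℂ) :
    rawIntegrand σ (f₁ + f₂) g = rawIntegrand σ f₁ g + rawIntegrand σ f₂ g := by
  funext z
  simp only [rawIntegrand, Pi.add_apply]
  ring

theorem rawIntegrand_add_right (σ : ℝ) (f g₁ g₂ : Cn n → ℂ) :
    rawIntegrand σ f (g₁ + g₂) = rawIntegrand σ f g₁ + rawIntegrand σ f g₂ := by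
  funext z
  simp only [rawIntegrand, Pi.add_apply, map_add]
  ring

theorem rawPairing_add_left {σ : ℝ} {f₁ f₂ g : Cn n → ℂ}
    (h₁ : Integrable (rawIntegrand σ f₁ g) (fockVol n))
    (h₂ : Integrable (rawIntegrand σ f₂ g) (fockVol n)) :
    rawPairing σ (f₁ + f₂) g = rawPairing σ f₁ g + rawPairing σ f₂ g := by
  simp only [rawPairing, rawIntegrand_add_left]
  exact integral_add h₁ h₂

theorem rawPairing_add_right {σ : ℝ} {f g₁ g₂ : Cn n → ℂ}
    (h₁ : Integrable (rawIntegrand σ f g₁) (fockVol n))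
    (h₂ : Integrable (rawIntegrand σ f g₂) (fockVol n)) :
    rawPairing σ f (g₁ + g₂) = rawPairing σ f g₁ + rawPairing σ f g₂ := by
  simp only [rawPairing, rawIntegrand_add_right]
  exact integral_add h₁ h₂

theorem rawPairing_smul_left (σ : ℝ) (c : ℂ) (f g : Cn n → ℂ) :
    rawPairing σ (c • f) g = c * rawPairing σ f g := by
  simp only [rawPairing, ← integral_const_mul]
  congr 1
  funext z
  simp only [rawIntegrand, Pi.smul_apply, smul_eq_mul]
  ring

theorem rawPairing_smul_right (σ : ℝ) (c : ℂ) (f g : Cn n → ℂ) :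
    rawPairing σ f (c • g) = conj c * rawPairing σ f g := by
  simp only [rawPairing, ← integral_const_mul]
  congr 1
  funext z
  simp only [rawIntegrand, Pi.smul_apply, smul_eq_mul, map_mul]
  ring

theorem fockPairing_add_left {σ : ℝ} {f₁ f₂ g : Cn n → ℂ} (hf₁ : ContDiff ℂ ⊤ f₁)
    (hf₂ : ContDiff ℂ ⊤ f₂) (h₁ : FockPairingConverges σ f₁ g)
    (h₂ : FockPairingConverges σ f₂ g) :
    fockPairing σ (f₁ + f₂) g = fockPairing σ f₁ g + fockPairing σ f₂ g := by
  unfold FockPairingConverges at h₁ h₂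
  unfold fockPairing
  split_ifs at h₁ h₂ ⊢ with hσ
  · exact rawPairing_add_left h₁ h₂
  · rw [taylorHead_add hf₁ hf₂, taylorTail_add hf₁ hf₂, rawPairing_add_left h₁.1 h₂.1,
      rawPairing_add_left h₁.2 h₂.2]
    ring

theorem fockPairing_add_right {σ : ℝ} {f g₁ g₂ : Cn n → ℂ} (hg₁ : ContDiff ℂ ⊤ g₁)
    (hg₂ : ContDiff ℂ ⊤ g₂) (h₁ : FockPairingConverges σ f g₁)
    (h₂ : FockPairingConverges σ f g₂) :
    fockPairing σ f (g₁ + g₂) = fockPairing σ f g₁ + fockPairing σ f g₂ := by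
  unfold FockPairingConverges at h₁ h₂
  unfold fockPairing
  split_ifs at h₁ h₂ ⊢ with hσ
  · exact rawPairing_add_right h₁ h₂
  · rw [taylorHead_add hg₁ hg₂, taylorTail_add hg₁ hg₂, rawPairing_add_right h₁.1 h₂.1,
      rawPairing_add_right h₁.2 h₂.2]
    ring

theorem fockPairing_smul_left (σ : ℝ) {f : Cn n → ℂ} (hf : ContDiff ℂ ⊤ f) (c : ℂ)
    (g : Cn n → ℂ) : fockPairing σ (c • f) g = c * fockPairing σ f g := by
  unfold fockPairing
  split_ifs
  · exact rawPairing_smul_left σ c f g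
  · rw [taylorHead_const_smul hf, taylorTail_const_smul hf, rawPairing_smul_left,
      rawPairing_smul_left]
    ring

theorem fockPairing_smul_right (σ : ℝ) (f : Cn n → ℂ) {g : Cn n → ℂ} (hg : ContDiff ℂ ⊤ g)
    (c : ℂ) : fockPairing σ f (c • g) = conj c * fockPairing σ f g := by
  unfold fockPairing
  split_ifs
  · exact rawPairing_smul_right σ c f g
  · rw [taylorHead_const_smul hg, taylorTail_const_smul hg, rawPairing_smul_right,
      rawPairing_smul_right]
    ring

end FockPairing

/-! ### Density of the powers in the little space. -/

section Density

variable {n : ℕ}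

theorem exists_norm_fockKer_one_le (n : ℕ) (β : ℝ) : ∃ C : ℝ, 0 < C ∧ ∀ z : Cn n,
    ‖fockKer n β (fun _ => 1) z‖ ≤ C * (Real.exp (‖z‖ ^ 2 / 2) * (1 + ‖z‖) ^ (-β)) := by
  obtain ⟨C, hC, h⟩ := exists_one_add_rpow_mul_exp_le |-β| 0 (b := 1 / 2) (by norm_num)
  refine ⟨C, hC, fun z => ?_⟩
  refine ZeroAtInftyContinuousMap.norm_le_of_forall (by positivity) fun u => ?_
  rw [fockKer_apply geometricGrowth_one, kerFun_one, norm_mul, Complex.norm_real,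
    Real.norm_of_nonneg (fockWt_pos β u).le, mul_comm, norm_exp_inner_mul_fockWt]
  have h1 := one_add_norm_rpow_le_mul u z (-β)
  have h2 := h ‖u - z‖ (norm_nonneg _)
  have h3 : 0 * ‖u - z‖ - 1 / 2 * ‖u - z‖ ^ 2 = -‖u - z‖ ^ 2 / 2 := by ring
  rw [h3] at h2
  calc Real.exp (‖z‖ ^ 2 / 2) * ((1 + ‖u‖) ^ (-β) * Real.exp (-‖u - z‖ ^ 2 / 2))
      ≤ Real.exp (‖z‖ ^ 2 / 2) * (((1 + ‖z‖) ^ (-β) * (1 + ‖u - z‖) ^ |-β|) *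
          Real.exp (-‖u - z‖ ^ 2 / 2)) := by gcongr
    _ = Real.exp (‖z‖ ^ 2 / 2) * (1 + ‖z‖) ^ (-β) *
          ((1 + ‖u - z‖) ^ |-β| * Real.exp (-‖u - z‖ ^ 2 / 2)) := by ring
    _ ≤ Real.exp (‖z‖ ^ 2 / 2) * (1 + ‖z‖) ^ (-β) * C := by gcongr
    _ = _ := by ring

theorem integrable_smul_fockKer_one {β : ℝ} (f : FockSpace n ∞ β) {r : ℝ} (hr0 : 0 ≤ r)
    (hr1 : r < 1) : Integrable (fun u => (conj (f u) * (Real.exp (-‖u‖ ^ 2) : ℝ) : ℂ) •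
      fockKer n β (fun _ => 1) ((r : ℂ) • u)) (fockVol n) := by
  obtain ⟨C, hC, h⟩ := exists_norm_fockKer_one_le n β
  -- Up to powers, f(u) e^{-|u|²} has size e^{-|u|²/2} and the kernel at ru has norm e^{r²|u|²/2};
  -- this is the Gaussian decay left over when r < 1.
  have hb : 0 < (1 - r ^ 2) / 2 := by nlinarith
  have hfc : Continuous f.1 := f.2.1.continuous
  refine ((integrable_one_add_norm_rpow_mul_exp n |-β| 0 hb).const_mul (‖f‖ * C)).mono' ?_
    (Eventually.of_forall fun u => ?_)
  · have hk := (continuous_fockKer (n := n) (β := β) geometricGrowth_one).comp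
      (continuous_const_smul (r : ℂ))
    refine (Continuous.smul (f := fun u => (conj (f u) * (Real.exp (-‖u‖ ^ 2) : ℝ) : ℂ))
      ?_ hk).aestronglyMeasurable
    exact (Complex.continuous_conj.comp hfc).mul (by fun_prop)
  · have hru : ‖(r : ℂ) • u‖ = r * ‖u‖ := by
      rw [norm_smul, Complex.norm_real, Real.norm_of_nonneg hr0]
    have h1 := h ((r : ℂ) • u)
    have h2 : ‖f u‖ * Real.exp (-‖u‖ ^ 2) ≤ ‖f‖ * fockWt (-β) u := by
      rw [← fockWt_mul_neg β u, ← mul_assoc, mul_comm ‖f u‖]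
      exact mul_le_mul_of_nonneg_right (f.fockWt_mul_norm_le u) (fockWt_pos _ u).le
    have h3 : (1 + ‖(r : ℂ) • u‖) ^ (-β) ≤ (1 + ‖u‖) ^ (-β) * (1 + ‖u‖) ^ |-β| := by
      refine (one_add_norm_rpow_le_mul ((r : ℂ) • u) u (-β)).trans ?_
      have h4 : ‖(r : ℂ) • u - u‖ ≤ ‖u‖ := by
        have h5 : (r : ℂ) • u - u = ((r - 1 : ℝ) : ℂ) • u := by
          push_cast; rw [sub_smul, one_smul]
        rw [h5, norm_smul, Complex.norm_real, Real.norm_of_nonpos (by linarith)]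
        nlinarith [norm_nonneg u]
      gcongr
    rw [norm_smul, norm_mul, RCLike.norm_conj, Complex.norm_real,
      Real.norm_of_nonneg (Real.exp_pos _).le]
    calc ‖f u‖ * Real.exp (-‖u‖ ^ 2) * ‖fockKer n β (fun _ => 1) ((r : ℂ) • u)‖
        ≤ (‖f‖ * fockWt (-β) u) * (C * (Real.exp (‖(r : ℂ) • u‖ ^ 2 / 2) *
            ((1 + ‖u‖) ^ (-β) * (1 + ‖u‖) ^ |-β|))) := by
          have := fockWt_pos (-β) u
          refine mul_le_mul h2 (h1.trans ?_) (norm_nonneg _) (by positivity)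
          gcongr
      _ = ‖f‖ * C * ((1 + ‖u‖) ^ |-β| * ((Real.exp (-‖u‖ ^ 2 / 2) *
            Real.exp (‖(r : ℂ) • u‖ ^ 2 / 2)) * ((1 + ‖u‖) ^ (- -β) * (1 + ‖u‖) ^ (-β)))) := by
          rw [fockWt]; ring
      _ = _ := by
          rw [← Real.exp_add, ← Real.rpow_add (by positivity), neg_add_cancel, Real.rpow_zero,
            mul_one, hru]
          congr 3
          ring

/-- The reproducing formula at rw, conjugated: weighted dilates of f are superpositions of
exponential kernels in C₀. -/
theorem integral_smul_fockKer_one_apply {β : ℝ} (f : FockSpace n ∞ β) {r : ℝ} (hr0 : 0 ≤ r)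
    (hr1 : r < 1) (w : Cn n) :
    (∫ u, (conj (f u) * (Real.exp (-‖u‖ ^ 2) : ℝ) : ℂ) •
      fockKer n β (fun _ => 1) ((r : ℂ) • u) ∂(fockVol n)) w =
    (fockWt β w : ℂ) * conj (f ((r : ℂ) • w)) := by
  have h := (zeroAtInftyEval w).integral_comp_comm (integrable_smul_fockKer_one f hr0 hr1)
  rw [zeroAtInftyEval_apply] at h
  rw [← h, ← f.inF1_of_top.1.integral_mul_exp_inner ((r : ℂ) • w), ← integral_conj,
    ← integral_const_mul]
  refine integral_congr_ae (Eventually.of_forall fun u => ?_)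
  simp only [map_smul, zeroAtInftyEval_apply, fockKer_apply geometricGrowth_one, kerFun_one,
    smul_eq_mul, map_mul, Complex.conj_ofReal, ← Complex.exp_conj, inner_smul_right,
    inner_conj_symm]
  ring

theorem fockWt_le_two_rpow_mul {β r : ℝ} (hr : 1 / 2 ≤ r) (hr1 : r ≤ 1) (w : Cn n) :
    fockWt β w ≤ 2 ^ |β| * fockWt β ((r : ℂ) • w) := by
  have hw := norm_nonneg w
  have hrw : ‖(r : ℂ) • w‖ = r * ‖w‖ := by
    rw [norm_smul, Complex.norm_real, Real.norm_of_nonneg (by linarith)]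
  have h0 : 0 ≤ r * ‖w‖ := by positivity
  have h1 : r * ‖w‖ ≤ ‖w‖ := by nlinarith
  have h2 : Real.exp (-‖w‖ ^ 2 / 2) ≤ Real.exp (-(r * ‖w‖) ^ 2 / 2) :=
    Real.exp_le_exp.2 (by nlinarith)
  have h3 : (1 + ‖w‖) ^ (-β) ≤ 2 ^ |β| * (1 + r * ‖w‖) ^ (-β) := by
    rcases le_total 0 β with hβ | hβ
    · have h4 : (1 + ‖w‖) ^ (-β) ≤ (1 + r * ‖w‖) ^ (-β) :=
        Real.rpow_le_rpow_of_nonpos (by positivity) (by linarith) (by linarith)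
      have h5 : (1 : ℝ) ≤ 2 ^ |β| := Real.one_le_rpow (by norm_num) (abs_nonneg _)
      exact h4.trans (le_mul_of_one_le_left (by positivity) h5)
    · rw [abs_of_nonpos hβ, ← Real.mul_rpow (by norm_num) (by positivity)]
      exact Real.rpow_le_rpow (by positivity) (by nlinarith) (by linarith)
  rw [fockWt, fockWt, hrw]
  calc _ ≤ Real.exp (-(r * ‖w‖) ^ 2 / 2) * (2 ^ |β| * (1 + r * ‖w‖) ^ (-β)) := by gcongr
    _ = _ := by ring

/-- Dilations of a function in the little space converge to it in norm. -/
theorem exists_dilation_close {β : ℝ} (f : littleFock n β) {ε : ℝ} (hε : 0 < ε) :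
    ∃ r : ℝ, 0 ≤ r ∧ r < 1 ∧
      ∀ w, fockWt β w * ‖f.1 ((r : ℂ) • w) - f.1 w‖ ≤ ε := by
  have hfc : Continuous f.1.1 := f.1.2.1.continuous
  have hβ1 : (0 : ℝ) < 2 ^ |β| := by positivity
  -- Far out, f and its dilate are bounded separately, the dilate at the cost of the factor 2^{|β|}
  -- from comparing weights.
  set ε₁ := ε / (2 ^ |β| + 1) with hε₁
  have hε₁p : 0 < ε₁ := by positivity
  obtain ⟨R, hR, hdec⟩ : ∃ R : ℝ, 0 < R ∧ ∀ w, R ≤ ‖w‖ → fockWt β w * ‖f.1 w‖ ≤ ε₁ := by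
    have h := (littleToZeroAtInfty n β f).zero_at_infty'
    have h1 : ∀ᶠ w in cocompact (Cn n), ‖littleToZeroAtInfty n β f w‖ < ε₁ := by
      have h2 := (tendsto_zero_iff_norm_tendsto_zero.1 h).eventually (gt_mem_nhds hε₁p)
      exact h2
    rw [← Metric.cobounded_eq_cocompact, (hasBasis_cobounded_norm (E := Cn n)).eventually_iff] at h1
    obtain ⟨R, -, hR⟩ := h1
    refine ⟨max R 1, by positivity, fun w hw => ?_⟩
    have h3 := hR (x := w) ((le_max_left _ _).trans hw)
    rw [littleToZeroAtInfty_apply, norm_mul, Complex.norm_real,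
      Real.norm_of_nonneg (fockWt_pos β w).le] at h3
    exact h3.le
  obtain ⟨M, hM, hwM⟩ := exists_fockWt_mul_exp_le n β 0
  simp only [zero_mul, Real.exp_zero, mul_one] at hwM
  have huc := (isCompact_closedBall (0 : Cn n) (2 * R)).uniformContinuousOn_of_continuous
    hfc.continuousOn
  rw [Metric.uniformContinuousOn_iff] at huc
  obtain ⟨δ, hδ, hclose⟩ := huc (ε / M) (by positivity)
  have hq : 0 < δ / (4 * R) := by positivity
  -- The bound 1/2 keeps (1-t)w outside radius R when |w| ≥ 2R; the bound δ/(4R) makes |tw| < δ when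
  -- |w| ≤ 2R.
  set t := min (1 / 2) (δ / (4 * R)) with ht
  have ht0 : 0 < t := lt_min (by norm_num) hq
  have ht1 : t ≤ 1 / 2 := min_le_left _ _
  have ht2 : t * (2 * R) < δ := by
    have h1 : t ≤ δ / (4 * R) := min_le_right _ _
    rw [le_div_iff₀ (by positivity)] at h1
    linarith
  refine ⟨1 - t, by linarith, by linarith, fun w => ?_⟩
  have hw := fockWt_pos β w
  have hrw : ‖((1 - t : ℝ) : ℂ) • w‖ = (1 - t) * ‖w‖ := by
    rw [norm_smul, Complex.norm_real, Real.norm_of_nonneg (by linarith)]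
  rcases le_total ‖w‖ (2 * R) with hwR | hwR
  · have h1 : dist (((1 - t : ℝ) : ℂ) • w) w < δ := by
      have h5 : ((1 - t : ℝ) : ℂ) • w - w = ((-t : ℝ) : ℂ) • w := by
        push_cast; rw [sub_smul, one_smul, neg_smul]; abel
      rw [dist_eq_norm, h5, norm_smul, Complex.norm_real, Real.norm_of_nonpos (by linarith),
        neg_neg]
      exact (mul_le_mul_of_nonneg_left hwR ht0.le).trans_lt ht2
    have h2 := hclose _ (by
      rw [mem_closedBall_zero_iff, hrw]
      nlinarith [norm_nonneg w]) w (by rwa [mem_closedBall_zero_iff]) h1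
    rw [dist_eq_norm] at h2
    calc _ ≤ M * (ε / M) := mul_le_mul (hwM w) h2.le (norm_nonneg _) hM.le
      _ = ε := by field_simp
  · have h1 := hdec w (by linarith)
    have h2 := hdec (((1 - t : ℝ) : ℂ) • w) (by rw [hrw]; nlinarith)
    have h3 := fockWt_le_two_rpow_mul (β := β) (r := 1 - t) (by linarith) (by linarith) w
    calc fockWt β w * ‖f.1 (((1 - t : ℝ) : ℂ) • w) - f.1 w‖
        ≤ fockWt β w * (‖f.1 (((1 - t : ℝ) : ℂ) • w)‖ + ‖f.1 w‖) := by
          gcongr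
          exact norm_sub_le _ _
      _ = fockWt β w * ‖f.1 (((1 - t : ℝ) : ℂ) • w)‖ + fockWt β w * ‖f.1 w‖ := by ring
      _ ≤ 2 ^ |β| * fockWt β (((1 - t : ℝ) : ℂ) • w) * ‖f.1 (((1 - t : ℝ) : ℂ) • w)‖ + ε₁ := by
          gcongr
      _ = 2 ^ |β| * (fockWt β (((1 - t : ℝ) : ℂ) • w) * ‖f.1 (((1 - t : ℝ) : ℂ) • w)‖) + ε₁ := by
          ring
      _ ≤ 2 ^ |β| * ε₁ + ε₁ := by gcongr
      _ = ε := by rw [hε₁]; field_simp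

/-- A bounded functional on the little space that vanishes on the powers `u ↦ ⟪z, u⟫^k` is `0`. -/
theorem eq_zero_of_forall_littleMono {β : ℝ} {μ : StrongDual ℂ (littleFock n β)}
    (h : ∀ k z, μ (littleMono β k z) = 0) : μ = 0 := by
  obtain ⟨L, -, hL⟩ := exists_conj_extension μ
  -- The exponential kernel is a norm-convergent sum in C₀ of multiples of conjugated weighted
  -- powers, on which L vanishes.
  have hker : ∀ z, L (fockKer n β (fun _ => 1) z) = 0 := fun z => by
    have h1 := hasSum_comp_fockKer (β := β) geometricGrowth_one L z
    have h2 : ∀ k : ℕ, L (fockMono β fun _ : Fin k => z) = 0 := fun k => by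
      rw [← star_littleToZeroAtInfty_littleMono, hL, h, map_zero]
    simp only [h2, mul_zero] at h1
    exact h1.unique hasSum_zero
  have hlim : ∀ f, L (star (littleToZeroAtInfty n β f)) = 0 := fun f => by
    rw [← norm_le_zero_iff]
    refine le_of_forall_pos_le_add fun ε hε => ?_
    obtain ⟨r, hr0, hr1, hr⟩ := exists_dilation_close f (ε := ε / (‖L‖ + 1)) (by positivity)
    set b := ∫ u, (conj (f.1 u) * (Real.exp (-‖u‖ ^ 2) : ℝ) : ℂ) •
      fockKer n β (fun _ => 1) ((r : ℂ) • u) ∂(fockVol n) with hb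
    have hLb : L b = 0 := by
      rw [hb, ← L.integral_comp_comm (integrable_smul_fockKer_one f.1 hr0 hr1)]
      simp [hker]
    have hdist : ‖b - star (littleToZeroAtInfty n β f)‖ ≤ ε / (‖L‖ + 1) := by
      refine ZeroAtInftyContinuousMap.norm_le_of_forall (by positivity) fun w => ?_
      rw [ZeroAtInftyContinuousMap.sub_apply, ZeroAtInftyContinuousMap.star_apply,
        littleToZeroAtInfty_apply, hb, integral_smul_fockKer_one_apply f.1 hr0 hr1,
        Complex.star_def, map_mul, Complex.conj_ofReal, ← mul_sub, ← map_sub, norm_mul,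
        RCLike.norm_conj, Complex.norm_real, Real.norm_of_nonneg (fockWt_pos β w).le]
      exact hr w
    have h1 : ‖L (b - star (littleToZeroAtInfty n β f))‖ ≤ ‖L‖ * (ε / (‖L‖ + 1)) :=
      L.le_opNorm_of_le hdist
    rw [map_sub, hLb, zero_sub, norm_neg] at h1
    rw [zero_add]
    refine h1.trans ?_
    rw [mul_div_assoc', div_le_iff₀ (by positivity)]
    nlinarith [norm_nonneg L]
  ext f
  have h1 := hL f
  rw [hlim] at h1
  simpa using h1.symm

end Density

/-! ### Representation of functionals by the pairing. -/

section Duality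

variable {n : ℕ}

theorem fockPairing_littleMono (hn : 0 < n) {α β : ℝ} (g : FockSpace n 1 α) (k : ℕ) (z : Cn n) :
    fockPairing (α + β) (littleMono β k z).1 g =
      (pairCoeff n (α + β) k : ℂ) * (k.factorial * conj (homogPart k g z)) := by
  obtain ⟨C, -, hC⟩ := exists_fockPairing_bound hn α β
  obtain ⟨a, -, ha⟩ := exists_taylorHead_bounds n α ((α + β) / 2) α
  have hhead := (ha g g.inF1).1
  have hconv := (hC (littleMono β k z).1 g).1
  have htail : InF1 α (taylorTail ((α + β) / 2) g) := (g.inF1.sub hhead).1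
  rw [littleMono_apply] at hconv ⊢
  exact fockPairing_inner_pow g.inF1 hhead htail hn k z hconv

/-- The functional `⟨·, g⟩_{α+β}` on the little space. -/
noncomputable def pairingDual (hn : 0 < n) (α β : ℝ) (g : FockSpace n 1 α) :
    StrongDual ℂ (littleFock n β) :=
  LinearMap.mkContinuousOfExistsBound
    { toFun := fun f => fockPairing (α + β) f.1 g
      map_add' := fun f₁ f₂ => by
        obtain ⟨C, -, hC⟩ := exists_fockPairing_bound hn α β
        exact fockPairing_add_left f₁.1.inF1_of_top.1.contDiff f₂.1.inF1_of_top.1.contDiff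
          (hC f₁.1 g).1 (hC f₂.1 g).1
      map_smul' := fun c f =>
        fockPairing_smul_left (α + β) f.1.inF1_of_top.1.contDiff c g }
    (by
      obtain ⟨C, -, hC⟩ := exists_fockPairing_bound hn α β
      exact ⟨C * ‖g‖, fun f => (hC f.1 g).2.trans (le_of_eq (by
        rw [mul_right_comm, mul_assoc]; rfl))⟩)

theorem pairingDual_apply (hn : 0 < n) {α β : ℝ} (g : FockSpace n 1 α) (f : littleFock n β) :
    pairingDual hn α β g f = fockPairing (α + β) f.1 g := rfl

/-- `g ↦ ⟨·, g⟩_{α+β}` as a conjugate-linear map. -/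
noncomputable def pairingDualMap (hn : 0 < n) (α β : ℝ) :
    FockSpace n 1 α →ₛₗ[starRingEnd ℂ] StrongDual ℂ (littleFock n β) where
  toFun := pairingDual hn α β
  map_add' g₁ g₂ := by
    obtain ⟨C, -, hC⟩ := exists_fockPairing_bound hn α β
    ext f
    exact fockPairing_add_right g₁.inF1.contDiff g₂.inF1.contDiff (hC f.1 g₁).1 (hC f.1 g₂).1
  map_smul' c g := by
    ext f
    exact fockPairing_smul_right (α + β) f.1 g.inF1.contDiff c

/-- The pairing represents every bounded functional on the little space, with norm control. -/
theorem exists_pairingDual_eq (hn : 0 < n) (α β : ℝ) : ∃ C : ℝ, 0 < C ∧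
    ∀ μ : StrongDual ℂ (littleFock n β), ∃ g : FockSpace n 1 α, ‖g‖ ≤ C * ‖μ‖ ∧
      pairingDual hn α β g = μ := by
  obtain ⟨C, hC, hK⟩ := exists_integral_kerFun_le hn α β
  have hc := geometricGrowth_inv_pairCoeff (α + β) hn
  refine ⟨C, hC, fun μ => ?_⟩
  obtain ⟨L, hLμ, hL⟩ := exists_conj_extension μ
  obtain ⟨hi, hb⟩ := integrable_comp_fockKer hC.le hc hK L
  -- The degree formula forces the k-th homogeneous part to be conj(μ(⟪z,·⟫^k)) / (p_k k!), and the
  -- inverse coefficients in the kernel produce exactly that.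
  have hg : InF1 α fun z => L (fockKer n β (fun k => (pairCoeff n (α + β) k)⁻¹) z) :=
    ⟨(contDiff_comp_fockKer hc L).differentiable (by simp), hi⟩
  refine ⟨hg.toFockSpace, ?_, ?_⟩
  · rw [FockSpace.norm_eq_integral]
    exact hb.trans (mul_le_mul_of_nonneg_left hLμ hC.le)
  · rw [← sub_eq_zero]
    refine eq_zero_of_forall_littleMono fun k z => ?_
    rw [sub_apply, sub_eq_zero, pairingDual_apply,
      fockPairing_littleMono hn]
    have h1 : homogPart k hg.toFockSpace z = _ := homogPart_comp_fockKer hc L k z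
    have hp : (pairCoeff n (α + β) k : ℂ) ≠ 0 := by
      exact_mod_cast (pairCoeff_pos (α + β) hn k).ne'
    have hk : (k.factorial : ℂ) ≠ 0 := by exact_mod_cast k.factorial_ne_zero
    rw [h1, ← star_littleToZeroAtInfty_littleMono, hL, map_mul, Complex.conj_ofReal,
      Complex.conj_conj]
    push_cast
    field_simp

/-- The coefficients p_k are nonzero, so testing against powers recovers every homogeneous part, and
a function in F^1_α is the sum of these. -/
theorem pairingDual_injective (hn : 0 < n) (α β : ℝ) :
    Function.Injective (pairingDual (n := n) hn α β) := by
  intro g₁ g₂ h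
  refine Subtype.ext (funext fun z => ?_)
  have hhom : ∀ k, homogPart k g₁ z = homogPart k g₂ z := fun k => by
    have h1 := DFunLike.congr_fun h (littleMono β k z)
    rw [pairingDual_apply, pairingDual_apply, fockPairing_littleMono hn,
      fockPairing_littleMono hn] at h1
    have hp : (pairCoeff n (α + β) k : ℂ) ≠ 0 := by
      exact_mod_cast (pairCoeff_pos (α + β) hn k).ne'
    have hk : (k.factorial : ℂ) ≠ 0 := by exact_mod_cast k.factorial_ne_zero
    exact (starRingEnd ℂ).injective (mul_left_cancel₀ hk (mul_left_cancel₀ hp h1))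
  have h1 := g₁.inF1.hasSum_homogPart z
  simp only [hhom] at h1
  exact h1.unique (g₂.inF1.hasSum_homogPart z)

end Duality

/-- `(F^{∞,0}_β)^* = F^1_α` with equivalent norms under the pairing `⟨·,·⟩_{α+β}`: the pairing
converges on `F^{∞,0}_β × F^1_α`, and `g ↦ ⟨·, g⟩_{α+β}` is a conjugate-linear bijection of `F^1_α`
onto the space of bounded linear functionals on `F^{∞,0}_β`, bounded above and below. -/
theorem theorem5p8 (n : ℕ) (hn : 0 < n) (α β : ℝ) :
    (∀ (f : littleFock n β) (g : FockSpace n 1 α), FockPairingConverges (α + β) f.1 g) ∧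
    ∃ Φ : FockSpace n 1 α ≃ₛₗ[starRingEnd ℂ] StrongDual ℂ (littleFock n β),
      (∀ (g : FockSpace n 1 α) (f : littleFock n β), Φ g f = fockPairing (α + β) f.1 g) ∧
      ∃ C : ℝ, 0 < C ∧ ∀ g : FockSpace n 1 α, C⁻¹ * ‖g‖ ≤ ‖Φ g‖ ∧ ‖Φ g‖ ≤ C * ‖g‖ := by
  obtain ⟨C₁, hC₁, h₁⟩ := exists_fockPairing_bound hn α β
  obtain ⟨C₂, hC₂, h₂⟩ := exists_pairingDual_eq hn α β
  have hinj := pairingDual_injective hn α β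
  refine ⟨fun f g => (h₁ f.1 g).1, LinearEquiv.ofBijective (pairingDualMap hn α β)
    ⟨hinj, fun μ => (h₂ μ).imp fun g hg => hg.2⟩, fun g f => rfl, C₁ + C₂, by positivity,
    fun g => ⟨?_, ?_⟩⟩
  -- By injectivity the norm-controlled representative of ⟨·,g⟩ is g itself, which gives the lower
  -- bound.
  · obtain ⟨g', hg', hΦ⟩ := h₂ (pairingDual hn α β g)
    rw [hinj hΦ] at hg'
    rw [inv_mul_le_iff₀ (by positivity)]
    exact hg'.trans (mul_le_mul_of_nonneg_right (by linarith)
      (pairingDual hn α β g).opNorm_nonneg)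
  · refine ContinuousLinearMap.opNorm_le_bound _ (by positivity) fun f => ?_
    calc ‖fockPairing (α + β) f.1 g‖ ≤ C₁ * (‖f.1‖ * ‖g‖) := (h₁ f.1 g).2
      _ ≤ (C₁ + C₂) * (‖f.1‖ * ‖g‖) := by gcongr; linarith
      _ = (C₁ + C₂) * ‖g‖ * ‖f‖ := by rw [mul_assoc, mul_comm ‖g‖]; rfl
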